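/- Let $g\ge 0$ be an integer and let $\Delta$ be a finite multiset of nonzero integers with sum $0$ such that $n:=\#\Delta-2+2g>0$. Let $d$ be the sum of the positive entries of $\Delta$, and let $\eta$ and $\nu$ be the partitions of $d$ given by the absolute values of the negative entries and by the positive entries of $\Delta$. *Hurwitz number.* $H^g_d(\eta,\nu)$ is $\frac1{d!}$ times the number of tuples $(\sigma,\tau_1,\dots,\tau_n,\rho)$ in $S_d$ such that $\sigma$ has cycle type $\eta$, $\rho$ has cycle type $\nu$, all $\tau_i$ are transpositions, $\rho\,\tau_n\cdots\tau_1\,\sigma=1$, and the subgroup generated by $\sigma,\rho,\tau_1,\dots,\tau_n$ acts transitively on $\{1,\dots,d\}$; this is the number of connected genus $g$, degree $d$ covers of $\mathbb P^1$ with profiles $\eta,\nu$ over two points and simple ramification over $n$ further points, each weighted by $1/|\mathrm{Aut}|$. *Tropical curves.* A tropical curve $(\Gamma,h)$ of degree $\Delta$ and genus $g$ is a finite connected graph $\Gamma$ of genus $h_1(\Gamma)\le g$, with inner vertices $V$, bounded edges $e$ of lengths $l(e)>0$ and weights $\omega(e)\in\mathbb Z_{\ge0}$, and unbounded ends, together with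 a continuous map $h$ to $\mathbb R\cup\{\pm\infty\}$ which is finite away from the outer endpoints of the ends, is affine of slope $\pm\omega(e)$ on each bounded edge $e$, and is affine of nonzero integral slope on each end. The direction of a flag $(V,e)$ is the slope of $h$ along $e$ away from $V$. The directions of all flags at each inner vertex sum to $0$, and the directions of the ends form the multiset $\Delta$. Moreover labels $1,\dots,n$ are distributed on the inner vertices so that each $V$ carries $\mathrm{val}(V)-2+2k_V$ of them for some $k_V\ge 0$; every inner vertex has valency at least $2$, and those of valency $2$ (which represent labelled points in the interior of an edge) carry at least one label. Let $V_i$ be the vertex with label $i$. Curves are identified if there is an isomorphism of graphs preserving lengths, labels and $h$. The combinatorial type $\alpha$ of a curve is its labelled graph with the directions of all flags. The curves of type $\alpha$ form a cell, which is the open polyhedron of positive lengths in the linear space $S_\alpha$ of all values of $h$ at the inner vertices and lengths of the bounded edges that are compatible with the directions. The type $\alpha$ is regular if $\dim S_\alpha=1+\#\{\text{bounded edges}\}-h_1(\Gamma)$. The moduli space $\mathcal M_{g,\mathrm{trop}}(\mathbb P^1,\Delta)$ consists of the curves whose type $\alpha$ is regular if $\dim S_\alpha\ge n$, and has a cell contained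 in the closed cell of some regular type of dimension $n$ (so that $\alpha$ is obtained from the latter by contracting bounded edges) if $\dim S_\alpha<n$. The branch map is $$br:\mathcal M_{g,\mathrm{trop}}(\mathbb P^1,\Delta)\to\mathbb R^{n},\qquad (\Gamma,h)\mapsto(h(V_1),\dots,h(V_n)).$$ *Multiplicities.* For a regular type $\alpha$ of dimension $n$ let $I_\alpha$ be the index of the image of the map sending an integral length vector $(l(e))_e$ to the homomorphism $H_1(\Gamma,\mathbb Z)\to\mathbb Z$ whose value on a cycle is the sum of (direction)$\,\cdot\, l(e)$ over the flags passed. Let $w(\alpha)$ be the product of $I_\alpha$, a factor $\frac12$ for every vertex $V$ such that $\Gamma\setminus V$ has two connected components of the same combinatorial type (labels included), and a factor $\frac12$ for every cycle consisting of two edges of equal weight. The multiplicity of a curve of type $\alpha$ is $w(\alpha)\cdot|\det(br|_{S_\alpha})|$, the determinant being taken with respect to the lattice of integral points of $S_\alpha$ and $\mathbb Z^{n}$. **Theorem.** Let $p\in\mathbb R^{n}$ have pairwise distinct coordinates. Then $p$ is in general position (every curve in $br^{-1}(p)$ has a regular type of dimension $n$), the fibre $br^{-1}(p)$ is finite, and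 its weighted count, which is the degree of the tropical branch map, satisfies $$\deg(br)=\sum_{C\in br^{-1}(p)}\mathrm{mult}(C)=H^g_d(\eta,\nu).$$ In particular the count does not depend on $p$. -/

import Mathlib

noncomputable section

namespace TropicalHurwitz

/-! ### Classical double Hurwitz numbers -/

/-- The number of simple branch points of a genus `g` cover of the projective line with two special
points of profiles `η` and `ν` (Riemann–Hurwitz). -/
def numSimple {d : ℕ} (g : ℕ) (η ν : d.Partition) : ℕ :=
  Multiset.card η.parts + Multiset.card ν.parts + 2 * g - 2

/-- Monodromy representations: permutations `σ`, `ρ` of `{1, …, d}` of cycle types `η` and `ν`, and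
transpositions `τ 0, …, τ (s - 1)`, whose product is the identity and which together generate a
transitive subgroup. These are the homomorphisms to the symmetric group from the fundamental group
of the projective line without the branch points, recorded by the images of standard loops. -/
structure IsMonodromy {d s : ℕ} (η ν : d.Partition) (σ : Equiv.Perm (Fin d))
    (τ : Fin s → Equiv.Perm (Fin d)) (ρ : Equiv.Perm (Fin d)) : Prop where
  type_left : σ.partition.parts = η.parts
  type_right : ρ.partition.parts = ν.parts
  swap : ∀ i, (τ i).IsSwap
  prod_eq_one : ρ * (List.ofFn τ).reverse.prod * σ = 1
  transitive : MulAction.IsPretransitive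
    (Subgroup.closure ({σ, ρ} ∪ Set.range τ) : Subgroup (Equiv.Perm (Fin d))) (Fin d)

/-- The double Hurwitz number of genus `g` and degree `d`: the number of monodromy representations
divided by the order of the symmetric group. -/
def hurwitzNumber (g d : ℕ) (η ν : d.Partition) : ℚ :=
  (Nat.card {t : Equiv.Perm (Fin d) × (Fin (numSimple g η ν) → Equiv.Perm (Fin d)) ×
      Equiv.Perm (Fin d) // IsMonodromy η ν t.1 t.2.1 t.2.2} : ℚ) / (d.factorial : ℚ)

/-! ### Combinatorial types of tropical curves in tropical projective line -/

/-- The number of labels of a tropical curve of genus `g` and degree `Δ`. -/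
def numLabels (g : ℕ) (Δ : Multiset ℤ) : ℕ := Multiset.card Δ + 2 * g - 2

open scoped Classical in
/-- A combinatorial type of tropical curves of degree `Δ` and genus `g` in the tropical projective
line: a finite connected graph with inner vertices `V`, bounded edges `E` and unbounded ends `L`
(loops and multiple edges are allowed; the one-valent vertex at the outer side of an end is not
recorded), with labels and with the directions of all flags.

A labelled point in the interior of an edge is recorded as a vertex of valency two. Such a vertex
is required to carry a label, so unlabelled two-valent vertices do not occur.

A bounded edge is written from `src e` to `tgt e` so that its flag at `src e` has direction `wt e`
and its flag at `tgt e` has direction `- wt e`; if `wt e = 0` the choice of orientation has no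
meaning, and it is ignored by isomorphisms. -/
structure CombType (g : ℕ) (Δ : Multiset ℤ) where
  /-- inner vertices -/
  V : Type
  /-- bounded edges -/
  E : Type
  /-- unbounded ends -/
  L : Type
  [fintypeV : Fintype V]
  [fintypeE : Fintype E]
  [fintypeL : Fintype L]
  [nonemptyV : Nonempty V]
  src : E → V
  tgt : E → V
  /-- the weight of a bounded edge -/
  wt : E → ℕ
  /-- the inner vertex of an end -/
  base : L → V
  /-- the direction of an end, seen from its inner vertex -/
  dir : L → ℤ
  /-- the position of the labels -/
  label : Fin (numLabels g Δ) → V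
  connected : ∀ u v, Relation.EqvGen (fun a b => ∃ e, src e = a ∧ tgt e = b) u v
  /-- the genus `h₁ = #E - #V + 1` of the graph is at most `g` -/
  genus_le : (Fintype.card E : ℤ) - Fintype.card V + 1 ≤ g
  /-- every vertex has valency at least two, and two-valent vertices carry a label -/
  two_le_val : ∀ v, 2 ≤ Nat.card {e // src e = v} + Nat.card {e // tgt e = v}
    + Nat.card {l // base l = v}
  label_of_val_two : ∀ v, Nat.card {e // src e = v} + Nat.card {e // tgt e = v}
    + Nat.card {l // base l = v} = 2 → ∃ i, label i = v
  /-- the number of labels at `v` is `val v - 2 + 2 k` for some `k ≥ 0` -/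
  label_count : ∀ v, ∃ k : ℕ, Nat.card {i // label i = v} + 2 =
    Nat.card {e // src e = v} + Nat.card {e // tgt e = v} + Nat.card {l // base l = v} + 2 * k
  /-- the multiset of directions of the ends is `Δ` -/
  dir_ends : (Finset.univ : Finset L).val.map dir = Δ
  /-- the balancing condition -/
  balanced : ∀ v, (∑ e with src e = v, (wt e : ℤ)) - (∑ e with tgt e = v, (wt e : ℤ))
    + ∑ l with base l = v, dir l = 0

attribute [instance] CombType.fintypeV CombType.fintypeE CombType.fintypeL CombType.nonemptyV

/-- The oriented edge `(a, b)` of weight `ω` agrees with `(c, d)`; the orientation of an edge of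
weight zero is irrelevant. -/
def SameEnds {X : Type} (ω : ℕ) (a b c d : X) : Prop :=
  (a = c ∧ b = d) ∨ (ω = 0 ∧ a = d ∧ b = c)

namespace CombType

variable {g : ℕ} {Δ : Multiset ℤ}

/-- The genus `h₁` of the (connected) underlying graph. -/
def genus (α : CombType g Δ) : ℤ := (Fintype.card α.E : ℤ) - Fintype.card α.V + 1

/-- The given bijections form an isomorphism of combinatorial types. -/
def IsIso (α β : CombType g Δ) (φV : α.V ≃ β.V) (φE : α.E ≃ β.E) (φL : α.L ≃ β.L) : Prop :=
  (∀ i, φV (α.label i) = β.label i) ∧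
  (∀ e, β.wt (φE e) = α.wt e ∧
    SameEnds (α.wt e) (φV (α.src e)) (φV (α.tgt e)) (β.src (φE e)) (β.tgt (φE e))) ∧
  (∀ l, β.base (φL l) = φV (α.base l) ∧ β.dir (φL l) = α.dir l)

/-- The linear equations between the positions `h v` of the vertices and the lengths of the bounded
edges, over a coefficient ring `R`. The projection to the position of one root vertex and the
lengths identifies this module with the solutions of the equations of all loops. -/
def solutions (α : CombType g Δ) (R : Type) [CommRing R] :
    Submodule R ((α.V → R) × (α.E → R)) where
  carrier := {z | ∀ e, z.1 (α.tgt e) - z.1 (α.src e) = (α.wt e : R) * z.2 e}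
  zero_mem' := by intro e; simp
  add_mem' := by
    intro a b ha hb e
    have h1 := ha e
    have h2 := hb e
    simp only [Prod.fst_add, Prod.snd_add, Pi.add_apply]
    linear_combination h1 + h2
  smul_mem' := by
    intro c a ha e
    have h1 := ha e
    simp only [Prod.smul_fst, Prod.smul_snd, Pi.smul_apply, smul_eq_mul]
    linear_combination c * h1

/-- The cell of a type: positions of the vertices and positive lengths of the bounded edges. -/
def cell (α : CombType g Δ) : Set ((α.V → ℝ) × (α.E → ℝ)) :=
  {z | z ∈ α.solutions ℝ ∧ ∀ e, 0 < z.2 e}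

/-- The dimension of the cell, which is an open polyhedron in the space of solutions. -/
def dim (α : CombType g Δ) : ℕ := Module.finrank ℝ (α.solutions ℝ)

/-- A type is regular if its cell has the expected dimension. -/
def IsRegular (α : CombType g Δ) : Prop := (α.dim : ℤ) = 1 + Fintype.card α.E - α.genus

/-- Regular types of top dimension (of an existing tropical curve). -/
def IsTop (α : CombType g Δ) : Prop :=
  α.cell.Nonempty ∧ α.IsRegular ∧ α.dim = numLabels g Δ

/-- `α` is obtained from `β` by shrinking some of the bounded edges of `β` to length zero:
`π` maps the vertices of `β` to those of `α`, and `j` embeds the edges of `α` as the edges of `β`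
that are not contracted. If the cell of `β` is not empty, this says that the cell of `α` is
contained in the closed cell of `β`. -/
def IsFaceOf (α β : CombType g Δ) : Prop :=
  ∃ (π : β.V → α.V) (j : α.E → β.E) (φL : α.L ≃ β.L),
    Function.Surjective π ∧ Function.Injective j ∧
    (∀ u w, π u = π w ↔ Relation.EqvGen
      (fun a b => ∃ e, e ∉ Set.range j ∧ β.src e = a ∧ β.tgt e = b) u w) ∧
    (∀ i, α.label i = π (β.label i)) ∧
    (∀ e, β.wt (j e) = α.wt e ∧
      SameEnds (α.wt e) (α.src e) (α.tgt e) (π (β.src (j e))) (π (β.tgt (j e)))) ∧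
    (∀ l, α.base l = π (β.base (φL l)) ∧ β.dir (φL l) = α.dir l)

/-- The types that occur in the tropical moduli space: those of dimension at least the expected top
dimension have to be regular, and the smaller ones have to lie in a cell of top dimension. -/
def IsAdmissible (α : CombType g Δ) : Prop :=
  (numLabels g Δ ≤ α.dim → α.IsRegular) ∧
  (α.dim < numLabels g Δ → ∃ β : CombType g Δ, β.IsTop ∧ α.IsFaceOf β)

/-! ### The weight of a type -/

open scoped Classical in
/-- The first homology group of the graph: integral cycles. -/
def cycles (α : CombType g Δ) : Submodule ℤ (α.E → ℤ) where
  carrier := {c | ∀ v, ∑ e with α.src e = v, c e = ∑ e with α.tgt e = v, c e}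
  zero_mem' := by intro v; simp
  add_mem' := by
    intro a b ha hb v
    simp only [Pi.add_apply, Finset.sum_add_distrib]
    rw [ha v, hb v]
  smul_mem' := by
    intro c a ha v
    simp only [Pi.smul_apply, smul_eq_mul, ← Finset.mul_sum]
    rw [ha v]

/-- The equations of the loops: an assignment of lengths is sent to the map taking a loop to the
sum of `direction * length` over the flags passed by it. With a basis of the cycles this is the
matrix with one row for each generating loop. (The column of the position of the root vertex is
zero and is left out.) -/
def loopMap (α : CombType g Δ) : (α.E → ℤ) →ₗ[ℤ] (α.cycles →ₗ[ℤ] ℤ) :=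
  LinearMap.mk₂ ℤ (fun l c => ∑ e, c.1 e * ((α.wt e : ℤ) * l e))
    (by intro a b c; simp only [Pi.add_apply, mul_add, Finset.sum_add_distrib])
    (by
      intro a b c
      simp only [Pi.smul_apply, smul_eq_mul, Finset.mul_sum]
      exact Finset.sum_congr rfl fun e _ => by ring)
    (by intro a b c; simp only [Submodule.coe_add, Pi.add_apply, add_mul, Finset.sum_add_distrib])
    (by
      intro a b c
      simp only [Submodule.coe_smul, Pi.smul_apply, smul_eq_mul, Finset.mul_sum]
      exact Finset.sum_congr rfl fun e _ => by ring)

/-- The index of the image of the loop equations. -/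
def loopIndex (α : CombType g Δ) : ℕ := (LinearMap.range α.loopMap).toAddSubgroup.index

/-- The pieces of the graph with the vertex `v` removed. -/
inductive Piece (α : CombType g Δ) (v : α.V) : Type
  | vertex (w : α.V) (hw : w ≠ v) : Piece α v
  | edge (e : α.E) : Piece α v
  | leg (l : α.L) : Piece α v

/-- Incidence of the pieces of the graph with the vertex `v` removed. -/
inductive Incident (α : CombType g Δ) (v : α.V) : α.Piece v → α.Piece v → Prop
  | src (e : α.E) (h : α.src e ≠ v) : Incident α v (.edge e) (.vertex (α.src e) h)
  | tgt (e : α.E) (h : α.tgt e ≠ v) : Incident α v (.edge e) (.vertex (α.tgt e) h)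
  | base (l : α.L) (h : α.base l ≠ v) : Incident α v (.leg l) (.vertex (α.base l) h)

/-- The connected components of the graph with the vertex `v` removed. -/
def Component (α : CombType g Δ) (v : α.V) : Type := Quot (α.Incident v)

/-- The component of a piece. -/
def comp (α : CombType g Δ) {v : α.V} (x : α.Piece v) : α.Component v := Quot.mk _ x

/-- Two components of the graph with the vertex `v` removed have the same combinatorial type: there
is an isomorphism that respects incidence, directions and labels. -/
def SameType (α : CombType g Δ) {v : α.V} (c c' : α.Component v) : Prop :=
  ∃ (φV : {w : α.V // ∃ h : w ≠ v, α.comp (.vertex w h) = c} ≃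
          {w : α.V // ∃ h : w ≠ v, α.comp (.vertex w h) = c'})
    (φE : {e : α.E // α.comp (v := v) (.edge e) = c} ≃ {e : α.E // α.comp (v := v) (.edge e) = c'})
    (φL : {l : α.L // α.comp (v := v) (.leg l) = c} ≃ {l : α.L // α.comp (v := v) (.leg l) = c'}),
    (∀ w i, α.label i = w.1 ↔ α.label i = (φV w).1) ∧
    (∀ e, α.wt (φE e).1 = α.wt e.1 ∧
      ((∀ w, (α.src e.1 = w.1 ↔ α.src (φE e).1 = (φV w).1) ∧
          (α.tgt e.1 = w.1 ↔ α.tgt (φE e).1 = (φV w).1)) ∨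
        (α.wt e.1 = 0 ∧
          ∀ w, (α.src e.1 = w.1 ↔ α.tgt (φE e).1 = (φV w).1) ∧
            (α.tgt e.1 = w.1 ↔ α.src (φE e).1 = (φV w).1)))) ∧
    (∀ l, α.dir (φL l).1 = α.dir l.1 ∧
      ∀ w, α.base l.1 = w.1 ↔ α.base (φL l).1 = (φV w).1)

/-- The number of vertices whose removal leaves two components of the same combinatorial type. -/
def numTwins (α : CombType g Δ) : ℕ :=
  Set.ncard {v : α.V | ∃ c c' : α.Component v, c ≠ c' ∧ α.SameType c c'}

/-- The number of wieners: cycles consisting of two edges of the same weight. -/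
def numWieners (α : CombType g Δ) : ℕ :=
  Set.ncard {P : Set α.E | ∃ e e' : α.E, e ≠ e' ∧ P = {e, e'} ∧ α.src e ≠ α.tgt e ∧
    s(α.src e, α.tgt e) = s(α.src e', α.tgt e') ∧ α.wt e = α.wt e'}

/-- The weight of a type of top dimension. -/
def weight (α : CombType g Δ) : ℚ :=
  (1 / 2) ^ α.numTwins * (α.loopIndex : ℚ) * (1 / 2) ^ α.numWieners

open scoped Classical in
/-- The absolute value of the determinant of the branch map `(h, length) ↦ (h (label i))_i` on the
cell of a type of top dimension, with respect to the lattice of integral points of the space of the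
cell and the standard lattice of the target. It does not depend on the basis of the lattice. -/
def brDet (α : CombType g Δ) : ℕ :=
  if h : Nonempty (Module.Basis (Fin (numLabels g Δ)) ℤ (α.solutions ℤ)) then
    (Matrix.det (Matrix.of fun i k => ((h.some k : α.solutions ℤ).1.1 (α.label i)))).natAbs
  else 0

/-- The multiplicity of the branch map on the cell of a type of top dimension. -/
def mult (α : CombType g Δ) : ℚ := α.weight * (α.brDet : ℚ)

end CombType

/-! ### Tropical curves, the moduli space and the branch map -/

/-- A tropical curve of degree `Δ` and genus `g` in the tropical projective line: a combinatorial
type with positive lengths of the bounded edges and a map `h` to the line which is affine on all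
edges with the given directions; `h` is determined by its values `pos` at the inner vertices. -/
structure TropCurve (g : ℕ) (Δ : Multiset ℤ) where
  type : CombType g Δ
  /-- the map `h` on the inner vertices -/
  pos : type.V → ℝ
  /-- the lengths of the bounded edges -/
  len : type.E → ℝ
  mem_cell : (pos, len) ∈ type.cell

/-- Isomorphism of tropical curves. -/
def TropCurve.Iso {g : ℕ} {Δ : Multiset ℤ} (C D : TropCurve g Δ) : Prop :=
  ∃ (φV : C.type.V ≃ D.type.V) (φE : C.type.E ≃ D.type.E) (φL : C.type.L ≃ D.type.L),
    C.type.IsIso D.type φV φE φL ∧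
    (∀ v, D.pos (φV v) = C.pos v) ∧ (∀ e, D.len (φE e) = C.len e)

/-- Isomorphism of tropical curves is an equivalence relation. -/
instance TropCurve.setoid (g : ℕ) (Δ : Multiset ℤ) : Setoid (TropCurve g Δ) where
  r := TropCurve.Iso
  iseqv := by
    refine ⟨?_, ?_, ?_⟩
    · intro C
      exact ⟨Equiv.refl _, Equiv.refl _, Equiv.refl _,
        ⟨fun _ => rfl, fun _ => ⟨rfl, Or.inl ⟨rfl, rfl⟩⟩, fun _ => ⟨rfl, rfl⟩⟩,
        fun _ => rfl, fun _ => rfl⟩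
    · rintro C D ⟨φV, φE, φL, ⟨h1, h2, h3⟩, h4, h5⟩
      refine ⟨φV.symm, φE.symm, φL.symm, ⟨?_, ?_, ?_⟩, ?_, ?_⟩
      · intro i
        rw [← h1 i, Equiv.symm_apply_apply]
      · intro e
        obtain ⟨e, rfl⟩ := φE.surjective e
        obtain ⟨hw, hs⟩ := h2 e
        rw [Equiv.symm_apply_apply]
        refine ⟨hw.symm, ?_⟩
        rcases hs with ⟨a, b⟩ | ⟨z, a, b⟩
        · exact Or.inl ⟨by rw [← a, Equiv.symm_apply_apply], by rw [← b, Equiv.symm_apply_apply]⟩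
        · exact Or.inr ⟨hw.trans z, by rw [← b, Equiv.symm_apply_apply],
            by rw [← a, Equiv.symm_apply_apply]⟩
      · intro l
        obtain ⟨l, rfl⟩ := φL.surjective l
        rw [Equiv.symm_apply_apply, (h3 l).1, (h3 l).2, Equiv.symm_apply_apply]
        exact ⟨rfl, rfl⟩
      · intro v
        rw [← h4, Equiv.apply_symm_apply]
      · intro e
        rw [← h5, Equiv.apply_symm_apply]
    · rintro C D F ⟨φV, φE, φL, ⟨h1, h2, h3⟩, h4, h5⟩ ⟨ψV, ψE, ψL, ⟨k1, k2, k3⟩, k4, k5⟩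
      refine ⟨φV.trans ψV, φE.trans ψE, φL.trans ψL, ⟨?_, ?_, ?_⟩, ?_, ?_⟩
      · intro i
        simp [h1, k1]
      · intro e
        obtain ⟨hw, hs⟩ := h2 e
        obtain ⟨kw, ks⟩ := k2 (φE e)
        refine ⟨kw.trans hw, ?_⟩
        simp only [Equiv.trans_apply]
        rw [hw] at ks
        rcases hs with ⟨a, b⟩ | ⟨z, a, b⟩ <;> rcases ks with ⟨a', b'⟩ | ⟨z', a', b'⟩ <;>
          rw [a, b]
        · exact Or.inl ⟨a', b'⟩
        · exact Or.inr ⟨z', a', b'⟩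
        · exact Or.inr ⟨z, b', a'⟩
        · exact Or.inl ⟨b', a'⟩
      · intro l
        simp [h3, k3]
      · intro v
        simp [h4, k4]
      · intro e
        simp [h5, k5]

/-- The space of all tropical curves of degree `Δ` and genus `g`, up to isomorphism. -/
def AllCurves (g : ℕ) (Δ : Multiset ℤ) : Type 1 := Quotient (TropCurve.setoid g Δ)

/-- The images of the labelled vertices of a tropical curve. -/
def AllCurves.branch {g : ℕ} {Δ : Multiset ℤ} (q : AllCurves g Δ) : Fin (numLabels g Δ) → ℝ :=
  Quotient.lift (s := TropCurve.setoid g Δ) (fun C i => C.pos (C.type.label i))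
    (by
      rintro C D ⟨φV, φE, φL, ⟨h1, -, -⟩, h4, -⟩
      funext i
      rw [← h1 i, h4]) q

/-- The tropical moduli space: the curves of an admissible combinatorial type. -/
def ModuliSpace (g : ℕ) (Δ : Multiset ℤ) : Type 1 :=
  {q : AllCurves g Δ // ∃ C : TropCurve g Δ, Quotient.mk _ C = q ∧ C.type.IsAdmissible}

/-- The combinatorial type of a point of the moduli space (of some representative; the notions below
are invariant under isomorphism). -/
def ModuliSpace.type {g : ℕ} {Δ : Multiset ℤ} (q : ModuliSpace g Δ) : CombType g Δ :=
  (Quotient.out (s := TropCurve.setoid g Δ) q.1).type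

/-- The tropical branch map. -/
def br (g : ℕ) (Δ : Multiset ℤ) (q : ModuliSpace g Δ) : Fin (numLabels g Δ) → ℝ := q.1.branch

/-- A point is in general position for the branch map if all its preimages lie in (open) cells of
top dimension. -/
def IsBrGeneral (g : ℕ) (Δ : Multiset ℤ) (p : Fin (numLabels g Δ) → ℝ) : Prop :=
  ∀ q : ModuliSpace g Δ, br g Δ q = p → q.type.IsTop

/-- The degree of the branch map at a point: the number of preimages counted with multiplicity. -/
def degreeAt (g : ℕ) (Δ : Multiset ℤ) (p : Fin (numLabels g Δ) → ℝ) : ℚ :=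
  ∑ᶠ q ∈ br g Δ ⁻¹' {p}, q.type.mult

end TropicalHurwitz

end

/-!
Let `p` have distinct coordinates. If a curve lies over `p`, then its labels lie on distinct
vertices. Counting labels and valencies, every vertex carries exactly one label and is trivalent,
and the genus of the graph is `g`. An edge of weight zero would be a loop, because its end points
have the same image, and then the third flag at the vertex would have direction zero, which is
impossible. So the type of the curve is regular of dimension `n` (`IsOver.isTop`), and every curve
over `p` belongs to the moduli space.

Such a curve is determined by a `Diagram`: its edges and ends are strands with a positive weight,
and only the order of the branch points matters. The strand diagrams that arise are those with three
strands at each branch point, equal sums of weights on both sides of it, a connected graph, and the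
prescribed left and right ends (`TropCurve.IsOver.diagram_isTrivalent`, `Diagram.exists_curve`).

On the other side, a monodromy representation is recorded by the sequence `P 0, …, P n` of its
partial products, which are permutations of the `d` sheets (`card_isMonodromy`). Multiplication by
a transposition joins two cycles or cuts one cycle, so the cycles of `P 0, …, P n` form a strand
diagram (`canonicalDiagram`), and this diagram is unique up to isomorphism
(`Diagram.IsCover.exists_isIso`). Transitivity corresponds to connectedness. Hence every monodromy
representation belongs to exactly one point of the fibre (`existsUnique_marking`), which shows that
the fibre is finite.

It remains to count the monodromy representations of a given diagram. Fix the diagram and count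
the sequences `P` together with an assignment of the sheets to the strands. There are `d!` divided
by the product of the weights of the left ends ways to begin (`Diagram.card_isColoring_zero`).
Strands of weights `w₁` and `w₂` can be joined in `w₁ w₂` ways, and a strand of weight `w₃` can be
cut into two given strands in `w₃` ways (`Diagram.IsTrivalent.card_isStep`). So each strand
contributes its weight where it ends at a branch point, and the number of pairs is `d!` times the
product of the weights of the bounded strands (`Diagram.IsTrivalent.card_cover`). Each `P` is
counted once for every automorphism of the diagram (`Diagram.card_marking`). An automorphism can
only exchange pairs of strands with the same weight and the same position, which are the pairs of
parallel edges of equal weight and the pairs of equal ends at a common vertex. This gives the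
factors `1 / 2` of the multiplicity (`TropCurve.IsOver.card_aut`).

The other factors of the multiplicity are the index of the loop map and the determinant of the
branch map, and their product is the product of the weights of the bounded edges
(`CombType.loopIndex_mul_brDet`). For this, let `A` be the homomorphism that sends a function on the
vertices to its differences along the edges modulo the weights. The index of the loop map is the
index of the image of `A`, because both count the functions on the edges modulo the differences and
the multiples of the weights. The determinant is the index of the kernel of `A`, which is the order
of the image, because integral solutions are the functions on the vertices whose differences are
divisible by the weights.
-/

noncomputable section

namespace TropicalHurwitz

/-! ### Cycles of a permutation multiplied by a transposition -/

section Perm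

open Equiv Equiv.Perm

variable {X : Type*}

/-- If two permutations agree on the cycle of `z`, then this cycle is a cycle of both. -/
theorem sameCycle_congr [Finite X] {σ σ' : Perm X} {z : X}
    (h : ∀ u, σ.SameCycle z u → σ' u = σ u) (u : X) :
    σ'.SameCycle z u ↔ σ.SameCycle z u := by
  have key : ∀ i : ℕ, (σ' ^ i) z = (σ ^ i) z := by
    intro i
    induction i with
    | zero => rfl
    | succ i ih =>
      rw [pow_succ', pow_succ', Perm.mul_apply, Perm.mul_apply, ih]
      exact h _ ⟨i, by simp⟩
  constructor
  · intro hu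
    obtain ⟨i, rfl⟩ := hu.exists_nat_pow_eq
    rw [key]
    exact ⟨i, by simp⟩
  · intro hu
    obtain ⟨i, rfl⟩ := hu.exists_nat_pow_eq
    rw [← key]
    exact ⟨i, by simp⟩

/-- The cycle of a point that returns to itself for the first time after `j` steps. -/
theorem sameCycle_iff_of_pow_eq {σ : Perm X} {x : X} {j : ℕ} (hj : 0 < j)
    (h : (σ ^ j) x = x) (u : X) : σ.SameCycle x u ↔ ∃ i < j, (σ ^ i) x = u := by
  constructor
  · rintro ⟨m, rfl⟩
    have hj' : (0 : ℤ) < j := by exact_mod_cast hj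
    refine ⟨(m % j).toNat, ?_, ?_⟩
    · have := Int.emod_lt_of_pos m hj'
      have := Int.emod_nonneg m hj'.ne'
      omega
    · have h1 : (σ ^ (j : ℤ)) x = x := by simpa using h
      have h2 : ((m % j).toNat : ℤ) = m % j := Int.toNat_of_nonneg (Int.emod_nonneg m hj'.ne')
      rw [← zpow_natCast, h2]
      conv_rhs => rw [← Int.emod_add_mul_ediv m j, zpow_add, zpow_mul, Perm.mul_apply]
      congr 1
      have : ∀ q : ℤ, ((σ ^ (j : ℤ)) ^ q) x = x := fun q => zpow_apply_eq_self_of_apply_eq_self h1 q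
      rw [this]
  · rintro ⟨i, -, rfl⟩
    exact ⟨i, by simp⟩

variable [DecidableEq X]

/-- A cycle that avoids `x` and `y` is not changed by multiplication with `swap x y`. -/
theorem sameCycle_swap_mul_of_not [Finite X] {σ : Perm X} {x y z : X}
    (hx : ¬ σ.SameCycle z x) (hy : ¬ σ.SameCycle z y) (u : X) :
    (swap x y * σ).SameCycle z u ↔ σ.SameCycle z u := by
  refine sameCycle_congr (fun u hu => ?_) u
  rw [Perm.mul_apply, swap_apply_of_ne_of_ne]
  · rintro rfl
    exact hx (sameCycle_apply_right.2 hu)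
  · rintro rfl
    exact hy (sameCycle_apply_right.2 hu)

/-- Before its orbit under `σ` meets `x` or `y` again, the point `x` moves in the same way under
`swap x y * σ`. -/
theorem swap_mul_pow_apply {σ : Perm X} {x y : X} {j : ℕ}
    (h : ∀ i, 0 < i → i < j → (σ ^ i) x ≠ x ∧ (σ ^ i) x ≠ y) {i : ℕ} (hi : i < j) :
    ((swap x y * σ) ^ i) x = (σ ^ i) x := by
  induction i with
  | zero => rfl
  | succ i ih =>
    have h1 := h (i + 1) i.succ_pos hi
    rw [pow_succ', Perm.mul_apply, ih (by omega), Perm.mul_apply, ← Perm.mul_apply σ, ← pow_succ',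
      swap_apply_of_ne_of_ne h1.1 h1.2]

theorem swap_mul_pow_apply_last {σ : Perm X} {x y : X} {j : ℕ} (hj : 0 < j)
    (h : ∀ i, 0 < i → i < j → (σ ^ i) x ≠ x ∧ (σ ^ i) x ≠ y) :
    ((swap x y * σ) ^ j) x = swap x y ((σ ^ j) x) := by
  obtain ⟨i, rfl⟩ : ∃ i, j = i + 1 := ⟨j - 1, by omega⟩
  rw [pow_succ', Perm.mul_apply, swap_mul_pow_apply h (by omega), Perm.mul_apply,
    ← Perm.mul_apply σ, ← pow_succ']

/-- Multiplication with `swap x y` splits a cycle through `x` and `y`. The cycle through `x` of the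
product consists of the points from `x` to the point before `y`. -/
theorem sameCycle_swap_mul_of_pow {σ : Perm X} {x y : X} {j : ℕ} (hj : 0 < j)
    (hy : (σ ^ j) x = y) (h : ∀ i, 0 < i → i < j → (σ ^ i) x ≠ x ∧ (σ ^ i) x ≠ y) (u : X) :
    (swap x y * σ).SameCycle x u ↔ ∃ i < j, (σ ^ i) x = u := by
  rw [sameCycle_iff_of_pow_eq hj (by rw [swap_mul_pow_apply_last hj h, hy, swap_apply_right])]
  constructor
  · rintro ⟨i, hi, rfl⟩
    exact ⟨i, hi, (swap_mul_pow_apply h hi).symm⟩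
  · rintro ⟨i, hi, rfl⟩
    exact ⟨i, hi, swap_mul_pow_apply h hi⟩

theorem exists_first_pow [Finite X] {σ : Perm X} {x y : X} (h : σ.SameCycle x y) :
    ∃ j, 0 < j ∧ (σ ^ j) x = y ∧ ∀ i, 0 < i → i < j → (σ ^ i) x ≠ y := by
  classical
  have hex : ∃ j, 0 < j ∧ (σ ^ j) x = y := by
    obtain ⟨i, hi, -, h'⟩ := h.exists_pow_eq''
    exact ⟨i, hi, h'⟩
  refine ⟨Nat.find hex, (Nat.find_spec hex).1, (Nat.find_spec hex).2, fun i hi hlt he => ?_⟩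
  exact Nat.find_min hex hlt ⟨hi, he⟩

theorem exists_first_pow' [Finite X] {σ : Perm X} {x y : X} (h : σ.SameCycle x y) :
    ∃ j, 0 < j ∧ (σ ^ j) x = y ∧ ∀ i, 0 < i → i < j → (σ ^ i) x ≠ x ∧ (σ ^ i) x ≠ y := by
  obtain ⟨j, hj, hy, hmin⟩ := exists_first_pow h
  refine ⟨j, hj, hy, fun i hi hlt => ⟨fun hx => ?_, hmin i hi hlt⟩⟩
  -- a return to `x` before reaching `y` would give a shorter way to `y`
  refine hmin (j - i) (by omega) (by omega) ?_
  rw [← hy]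
  conv_rhs => rw [show j = (j - i) + i by omega, pow_add, Perm.mul_apply, hx]

theorem not_sameCycle_swap_mul [Finite X] {σ : Perm X} {x y : X} (h : σ.SameCycle x y)
    (hne : x ≠ y) : ¬ (swap x y * σ).SameCycle x y := by
  obtain ⟨j, hj, hy, hmin⟩ := exists_first_pow' h
  rw [sameCycle_swap_mul_of_pow hj hy hmin]
  rintro ⟨i, hi, he⟩
  rcases Nat.eq_zero_or_pos i with rfl | hpos
  · exact hne he
  · exact (hmin i hpos hi).2 he

theorem sameCycle_swap_mul [Finite X] {σ : Perm X} {x y : X} (h : ¬ σ.SameCycle x y) :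
    (swap x y * σ).SameCycle x y := by
  obtain ⟨j, hj, hx, hmin⟩ := exists_first_pow (SameCycle.refl σ x)
  have hmin' : ∀ i, 0 < i → i < j → (σ ^ i) x ≠ x ∧ (σ ^ i) x ≠ y := fun i h1 h2 =>
    ⟨hmin i h1 h2, fun he => h ⟨i, by simpa using he⟩⟩
  exact ⟨j, by rw [zpow_natCast, swap_mul_pow_apply_last hj hmin', hx, swap_apply_left]⟩

/-- Multiplication with `swap x y` joins two different cycles through `x` and `y`. -/
theorem sameCycle_swap_mul_iff [Finite X] {σ : Perm X} {x y : X} (h : ¬ σ.SameCycle x y) (z : X) :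
    (swap x y * σ).SameCycle x z ↔ σ.SameCycle x z ∨ σ.SameCycle y z := by
  have aux : ∀ {x y : X}, ¬ σ.SameCycle x y → ∀ z, σ.SameCycle x z →
      (swap x y * σ).SameCycle x z := by
    intro x y h z hz
    obtain ⟨j, hj, hx, hmin⟩ := exists_first_pow (SameCycle.refl σ x)
    have hmin' : ∀ i, 0 < i → i < j → (σ ^ i) x ≠ x ∧ (σ ^ i) x ≠ y := fun i h1 h2 =>
      ⟨hmin i h1 h2, fun he => h ⟨i, by simpa using he⟩⟩
    obtain ⟨i, hi, rfl⟩ := (sameCycle_iff_of_pow_eq hj hx z).1 hz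
    exact ⟨i, by rw [zpow_natCast, swap_mul_pow_apply hmin' hi]⟩
  constructor
  · intro hz
    by_contra hcon
    rw [not_or] at hcon
    exact hcon.1 (((sameCycle_swap_mul_of_not (fun h' => hcon.1 h'.symm)
      (fun h' => hcon.2 h'.symm) x).1 hz.symm).symm)
  · rintro (hz | hz)
    · exact aux h z hz
    · refine (sameCycle_swap_mul h).trans ?_
      rw [swap_comm]
      exact aux (fun h' => h h'.symm) z hz

theorem sameCycle_iff_swap_mul [Finite X] {σ : Perm X} {x y : X} (h : σ.SameCycle x y)
    (hne : x ≠ y) (z : X) :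
    σ.SameCycle x z ↔ (swap x y * σ).SameCycle x z ∨ (swap x y * σ).SameCycle y z := by
  rw [← sameCycle_swap_mul_iff (not_sameCycle_swap_mul h hne), ← mul_assoc, swap_mul_self, one_mul]

end Perm

end TropicalHurwitz

namespace TropicalHurwitz

/-! ### Cycle types and fibres of colorings -/

section Partition

open Equiv Equiv.Perm Finset

open scoped Classical in
/-- If the fibres of `f` are the cycles of `σ`, then the sizes of the fibres form the partition
of `σ`. -/
theorem map_card_fiber_eq_partition {d : ℕ} {S : Type*} {σ : Perm (Fin d)} {f : Fin d → S}
    (h : ∀ x y, f x = f y ↔ σ.SameCycle x y) :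
    (univ.image f).val.map (fun s => #{x | f x = s}) = σ.partition.parts := by
  set w : S → ℕ := fun s => #{x | f x = s} with hw
  set m := (univ.image f).val.map w with hm
  have hfib : ∀ x, 2 ≤ w (f x) → x ∈ σ.support ∧ (σ.cycleOf x).support.card = w (f x) := by
    intro x hx
    have hmem : x ∈ σ.support := by
      by_contra hns
      rw [notMem_support] at hns
      have : ({y | f y = f x} : Finset (Fin d)) ⊆ {x} := by
        intro y hy
        simp only [mem_filter, mem_univ, true_and] at hy
        obtain ⟨i, rfl⟩ := (h x y).1 hy.symm
        simp [zpow_apply_eq_self_of_apply_eq_self hns i]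
      have := card_le_card this
      simp only [hw] at hx
      simp at this
      omega
    refine ⟨hmem, ?_⟩
    simp only [hw]
    congr 1
    ext y
    rw [mem_support_cycleOf_iff' (mem_support.1 hmem), ← h]
    simp [eq_comm]
  have hpos : ∀ a ∈ m, 0 < a := by
    intro a ha
    rw [hm, Multiset.mem_map] at ha
    obtain ⟨s, hs, rfl⟩ := ha
    rw [mem_val, mem_image] at hs
    obtain ⟨x, -, rfl⟩ := hs
    exact card_pos.2 ⟨x, by simp⟩
  have hsum : m.sum = d := by
    have := card_eq_sum_card_image f (univ : Finset (Fin d))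
    rw [card_univ, Fintype.card_fin] at this
    exact this.symm
  have hfilter : m.filter (fun a => 2 ≤ a) = σ.cycleType := by
    rw [hm, Multiset.filter_map, cycleType_def]
    have hch : ∀ s ∈ (univ.image f).val.filter ((fun a => 2 ≤ a) ∘ w), ∃ x, f x = s := by
      intro s hs
      obtain ⟨x, -, hx⟩ := mem_image.1 (show s ∈ univ.image f from (Multiset.mem_filter.1 hs).1)
      exact ⟨x, hx⟩
    choose g hg using hch
    have hg2 : ∀ s hs, 2 ≤ w (f (g s hs)) := by
      intro s hs
      rw [hg]
      exact (Multiset.mem_filter.1 hs).2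
    refine Multiset.map_eq_map_of_bij_of_nodup _ _ (Multiset.Nodup.filter _ (nodup _))
      (cycleFactorsFinset σ).nodup (fun s hs => σ.cycleOf (g s hs)) ?_ ?_ ?_ ?_
    · intro s hs
      rw [mem_val, cycleOf_mem_cycleFactorsFinset_iff]
      exact (hfib _ (hg2 s hs)).1
    · intro s hs s' hs' heq
      rw [← hg s hs, ← hg s' hs', h]
      have := mem_support_cycleOf_iff.2 ⟨SameCycle.refl σ _, (hfib _ (hg2 s hs)).1⟩
      rw [heq, mem_support_cycleOf_iff] at this
      exact this.1.symm
    · intro c hc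
      replace hc : c ∈ cycleFactorsFinset σ := hc
      have hcyc := (mem_cycleFactorsFinset_iff.1 hc).1
      obtain ⟨x, hx⟩ := hcyc.nonempty_support
      have hcx := cycle_is_cycleOf hx hc
      have hxs : x ∈ σ.support := by
        rw [← cycleOf_mem_cycleFactorsFinset_iff, ← hcx]; exact hc
      have h2 : 2 ≤ w (f x) := by
        have h1 : ({x, σ x} : Finset (Fin d)) ⊆ ({y | f y = f x} : Finset (Fin d)) := by
          intro y hy
          rw [mem_insert, mem_singleton] at hy
          simp only [mem_filter, mem_univ, true_and]
          rcases hy with rfl | rfl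
          · rfl
          · rw [h]; exact (sameCycle_apply_left.2 (SameCycle.refl _ _))
        have := card_le_card h1
        rwa [card_pair (mem_support.1 hxs).symm] at this
      refine ⟨f x, Multiset.mem_filter.2
        ⟨show f x ∈ univ.image f from mem_image_of_mem _ (mem_univ _), h2⟩, ?_⟩
      rw [hcx]
      exact ((h _ _).1 (hg (f x) _)).cycleOf_eq
    · intro s hs
      rw [Function.comp_apply, (hfib _ (hg2 s hs)).2, hg]
  have hrep : m.filter (fun a => ¬ 2 ≤ a) =
      Multiset.replicate (m.filter (fun a => ¬ 2 ≤ a)).card 1 := by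
    rw [Multiset.eq_replicate_card]
    intro a ha
    rw [Multiset.mem_filter] at ha
    have := hpos a ha.1
    omega
  have hm2 := Multiset.filter_add_not (fun a => 2 ≤ a) m
  have hs2 : (m.filter (fun a => 2 ≤ a)).sum + (m.filter (fun a => ¬ 2 ≤ a)).sum = d := by
    rw [← Multiset.sum_add, hm2, hsum]
  rw [hrep, Multiset.sum_replicate, hfilter, sum_cycleType] at hs2
  rw [parts_partition, ← hm2, hfilter, hrep]
  congr 2
  simp at hs2 ⊢
  omega

end Partition

end TropicalHurwitz

namespace TropicalHurwitz

/-! ### Strand diagrams and their covers -/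

/-- The combinatorial data of a branched cover of the line with `n` branch points that lie at the
times between `k` and `k + 1` for `k < n`: the strands `s` of the cover have a weight `w s` and
live at the times `k` with `a s ≤ k < b s`. Thus a strand with `b s = k + 1` ends and a strand with
`a s = k + 1` starts at the branch point `k`, left ends have `a s = 0`, and right ends have
`b s = n + 1`. -/
structure Diagram (S : Type) where
  /-- the weight of a strand -/
  w : S → ℕ
  /-- the first time at which a strand is alive -/
  a : S → ℕ
  /-- the first time at which a strand is no longer alive -/
  b : S → ℕ

namespace Diagram

open Equiv Equiv.Perm Finset

variable {S : Type} (D : Diagram S) {d : ℕ}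

/-- The strand `s` is alive at time `k`. -/
def Alive (k : ℕ) (s : S) : Prop := D.a s ≤ k ∧ k < D.b s

/-- `f` identifies the cycles of `σ` with the strands that are alive at time `k`; the length of a
cycle is the weight of its strand. -/
structure IsColoring (k : ℕ) (σ : Perm (Fin d)) (f : Fin d → S) : Prop where
  eq_iff : ∀ x y, f x = f y ↔ σ.SameCycle x y
  exists_iff : ∀ s, (∃ x, f x = s) ↔ D.Alive k s
  card_fiber : ∀ x, Nat.card {y // f y = f x} = D.w (f x)

/-- The colored permutation `(σ', f')` at time `k + 1` continues the colored permutation `(σ, f)` at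
time `k`: the two permutations differ by a transposition, the strands that it touches end, and all
other strands go on. -/
structure IsStep (k : ℕ) (σ : Perm (Fin d)) (f : Fin d → S) (σ' : Perm (Fin d)) (f' : Fin d → S) :
    Prop where
  isSwap : (σ' * σ⁻¹).IsSwap
  dying_iff : ∀ x, D.b (f x) = k + 1 ↔ ∃ z, f z = f x ∧ (σ' * σ⁻¹) z ≠ z
  persist : ∀ x, D.b (f x) ≠ k + 1 → f' x = f x
  born : ∀ x, D.b (f x) = k + 1 → D.a (f' x) = k + 1
  coloring : D.IsColoring (k + 1) σ' f'

/-- The times `0, …, n` of a sequence of permutations are colored by the strands of `D`. -/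
structure IsCover (n : ℕ) (σ : ℕ → Perm (Fin d)) (f : ℕ → Fin d → S) : Prop where
  zero : D.IsColoring 0 (σ 0) (f 0)
  step : ∀ k < n, D.IsStep k (σ k) (f k) (σ (k + 1)) (f (k + 1))

/-- Every strand lives for some time between `0` and `n`. -/
structure IsTimed (n : ℕ) : Prop where
  lt : ∀ s, D.a s < D.b s
  le : ∀ s, D.b s ≤ n + 1

/-- A diagram in which exactly three strands meet at each of the `n` branch points, and the weights
of the strands on both sides of a branch point have the same sum. There are no strands that are both
a left and a right end. -/
structure IsTrivalent [Fintype S] (n : ℕ) : Prop extends D.IsTimed n where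
  w_pos : ∀ s, 0 < D.w s
  no_line : ∀ s, D.a s = 0 → D.b s ≤ n
  card_eq : ∀ k < n, #{s | D.b s = k + 1} + #{s | D.a s = k + 1} = 3
  balanced : ∀ k < n, ∑ s with D.b s = k + 1, D.w s = ∑ s with D.a s = k + 1, D.w s

/-- The graph of the branch points and the bounded strands is connected. -/
def IsConnected (n : ℕ) : Prop :=
  ∀ c : ℕ → Prop, (∀ s, 0 < D.a s → D.b s ≤ n → (c (D.a s - 1) ↔ c (D.b s - 1))) →
    ∀ u < n, ∀ v < n, c u → c v

/-- The only subsets that are invariant under all permutations of the sequence up to time `n` are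
the trivial ones. -/
def _root_.TropicalHurwitz.IsTransitiveSeq (n : ℕ) (σ : ℕ → Perm (Fin d)) : Prop :=
  ∀ c : Fin d → Prop, (∀ k ≤ n, ∀ x, c (σ k x) ↔ c x) → ∀ x y, c x → c y

variable {D} {k n : ℕ} {σ σ' : Perm (Fin d)} {f f' : Fin d → S}

theorem IsColoring.alive (h : D.IsColoring k σ f) (x : Fin d) : D.Alive k (f x) :=
  (h.exists_iff _).1 ⟨x, rfl⟩

theorem IsColoring.apply_eq (h : D.IsColoring k σ f) (x : Fin d) : f (σ x) = f x :=
  (h.eq_iff _ _).2 (sameCycle_apply_left.2 (SameCycle.refl _ _))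

/-- The number of points on a set of living strands is the sum of the weights. -/
theorem IsColoring.sum_w (h : D.IsColoring k σ f) (A : Finset S) (hA : ∀ s ∈ A, D.Alive k s)
    [DecidablePred fun x => f x ∈ A] : ∑ s ∈ A, D.w s = #{x | f x ∈ A} := by
  classical
  rw [card_eq_sum_card_fiberwise (f := f) (t := A) (fun x hx => by simpa using hx)]
  refine sum_congr rfl fun s hs => ?_
  obtain ⟨x, rfl⟩ := (h.exists_iff s).2 (hA s hs)
  rw [← h.card_fiber x, Nat.card_eq_fintype_card, Fintype.card_subtype, filter_filter]
  congr 1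
  ext y
  simp only [mem_filter, mem_univ, true_and]
  exact ⟨fun hy => ⟨hy ▸ hs, hy⟩, fun hy => hy.2⟩

/-- The weights of the living strands are the parts of the partition of the permutation. -/
theorem IsColoring.partition [Fintype S] (h : D.IsColoring k σ f) (p : S → Prop) [DecidablePred p]
    (hp : ∀ s, p s ↔ D.Alive k s) : ({s | p s} : Finset S).val.map D.w = σ.partition.parts := by
  classical
  rw [← map_card_fiber_eq_partition h.eq_iff]
  have : ({s | p s} : Finset S) = univ.image f := by
    ext s
    simp [hp, ← h.exists_iff]
  rw [this]
  refine Multiset.map_congr rfl fun s hs => ?_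
  replace hs : s ∈ univ.image f := hs
  obtain ⟨x, -, rfl⟩ := mem_image.1 hs
  rw [← h.card_fiber x, Nat.card_eq_fintype_card, Fintype.card_subtype]

theorem IsStep.born_iff (hs : D.IsStep k σ f σ' f') (h : D.IsColoring k σ f) (x : Fin d) :
    D.a (f' x) = k + 1 ↔ D.b (f x) = k + 1 := by
  refine ⟨fun hx => ?_, hs.born x⟩
  by_contra hne
  rw [hs.persist x hne] at hx
  have := (h.alive x).1
  omega

/-- At a step, the strands that end are those of the two points that are exchanged, and the strands
that start are those of the same points afterwards. Exactly one of the two pairs of strands consists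
of two different strands. -/
theorem IsStep.exists_swap (hs : D.IsStep k σ f σ' f') (h : D.IsColoring k σ f)
    (hD : D.IsTimed n) : ∃ x y, x ≠ y ∧ σ' = swap x y * σ ∧
      (∀ s, D.b s = k + 1 ↔ s = f x ∨ s = f y) ∧ (∀ s, D.a s = k + 1 ↔ s = f' x ∨ s = f' y) ∧
      (f' x = f' y ↔ f x ≠ f y) := by
  obtain ⟨x, y, hne, hxy⟩ := hs.isSwap
  have hσ : σ' = swap x y * σ := by rw [← hxy]; group
  have htouch : ∀ z, (σ' * σ⁻¹) z ≠ z ↔ z = x ∨ z = y := by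
    intro z
    rw [hxy, swap_apply_ne_self_iff]
    simp [hne]
  have hdie : ∀ z, D.b (f z) = k + 1 ↔ f z = f x ∨ f z = f y := by
    intro z
    rw [hs.dying_iff]
    simp only [htouch]
    constructor
    · rintro ⟨u, h1, rfl | rfl⟩
      · exact Or.inl h1.symm
      · exact Or.inr h1.symm
    · rintro (h1 | h1)
      · exact ⟨x, h1.symm, Or.inl rfl⟩
      · exact ⟨y, h1.symm, Or.inr rfl⟩
  have hborn : ∀ z, D.a (f' z) = k + 1 ↔ f' z = f' x ∨ f' z = f' y := by
    intro z
    rw [hs.born_iff h, hdie, h.eq_iff, h.eq_iff, hs.coloring.eq_iff, hs.coloring.eq_iff, hσ]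
    by_cases hc : σ.SameCycle x y
    · have := sameCycle_iff_swap_mul hc hne z
      rw [σ.sameCycle_comm (x := z), σ.sameCycle_comm (x := z) (y := y),
        (swap x y * σ).sameCycle_comm (x := z), (swap x y * σ).sameCycle_comm (x := z) (y := y),
        ← this]
      exact ⟨fun h' => h'.elim id hc.trans, Or.inl⟩
    · have := sameCycle_swap_mul_iff hc z
      rw [σ.sameCycle_comm (x := z), σ.sameCycle_comm (x := z) (y := y),
        (swap x y * σ).sameCycle_comm (x := z), (swap x y * σ).sameCycle_comm (x := z) (y := y),
        ← this]
      exact ⟨Or.inl, fun h' => h'.elim id (sameCycle_swap_mul hc).trans⟩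
  refine ⟨x, y, hne, hσ, fun s => ⟨fun hb => ?_, ?_⟩, fun s => ⟨fun ha => ?_, ?_⟩, ?_⟩
  · obtain ⟨z, rfl⟩ := (h.exists_iff s).2 ⟨by have := hD.lt s; omega, by omega⟩
    exact (hdie z).1 hb
  · rintro (rfl | rfl)
    · exact (hdie x).2 (Or.inl rfl)
    · exact (hdie y).2 (Or.inr rfl)
  · obtain ⟨z, rfl⟩ := (hs.coloring.exists_iff s).2 ⟨by omega, by have := hD.lt s; omega⟩
    exact (hborn z).1 ha
  · rintro (rfl | rfl)
    · exact (hborn x).2 (Or.inl rfl)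
    · exact (hborn y).2 (Or.inr rfl)
  · rw [hs.coloring.eq_iff, Ne, h.eq_iff, hσ]
    exact ⟨fun h1 h2 => not_sameCycle_swap_mul h2 hne h1, sameCycle_swap_mul⟩

theorem IsStep.card_eq [Fintype S] (hs : D.IsStep k σ f σ' f') (h : D.IsColoring k σ f)
    (hD : D.IsTimed n) : #{s | D.b s = k + 1} + #{s | D.a s = k + 1} = 3 := by
  classical
  obtain ⟨x, y, -, -, hb, ha, hxy⟩ := hs.exists_swap h hD
  have h1 : ({s | D.b s = k + 1} : Finset S) = {f x, f y} := by ext s; simp [hb]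
  have h2 : ({s | D.a s = k + 1} : Finset S) = {f' x, f' y} := by ext s; simp [ha]
  rw [h1, h2]
  by_cases hc : f x = f y
  · rw [hc, pair_eq_singleton, card_singleton, card_pair (fun h' => hxy.1 h' hc)]
  · rw [card_pair hc, hxy.2 hc, pair_eq_singleton, card_singleton]

theorem IsStep.balanced [Fintype S] (hs : D.IsStep k σ f σ' f') (h : D.IsColoring k σ f)
    (hD : D.IsTimed n) :
    ∑ s with D.b s = k + 1, D.w s = ∑ s with D.a s = k + 1, D.w s := by
  classical
  rw [h.sum_w, hs.coloring.sum_w]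
  · congr 1
    ext x
    simp [hs.born_iff h]
  · intro s hs
    have := hD.lt s
    simp only [mem_filter, mem_univ, true_and] at hs
    exact ⟨by omega, by omega⟩
  · intro s hs
    have := hD.lt s
    simp only [mem_filter, mem_univ, true_and] at hs
    exact ⟨by omega, by omega⟩

variable {P : ℕ → Perm (Fin d)} {F : ℕ → Fin d → S}

theorem IsCover.coloring (h : D.IsCover n P F) : ∀ k ≤ n, D.IsColoring k (P k) (F k)
  | 0, _ => h.zero
  | k + 1, hk => (h.step k hk).coloring

/-- A point stays on its strand as long as the strand is alive. -/
theorem IsCover.persist (h : D.IsCover n P F) {j : ℕ} {x : Fin d} {l : ℕ} (hjl : j ≤ l)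
    (hl : l ≤ n) (hb : l < D.b (F j x)) : F l x = F j x := by
  induction l, hjl using Nat.le_induction with
  | base => rfl
  | succ l hjl ih =>
    have h1 := ih (by omega) (by omega)
    rw [(h.step l (by omega)).persist x (by rw [h1]; omega), h1]

theorem IsCover.w_pos (h : D.IsCover n P F) (hD : D.IsTimed n) (s : S) : 0 < D.w s := by
  have h1 := hD.lt s
  have h2 := hD.le s
  have hc := h.coloring (D.a s) (by omega)
  obtain ⟨x, hx⟩ := (hc.exists_iff s).2 ⟨le_rfl, h1⟩
  rw [← hx, ← hc.card_fiber]
  exact Nat.card_pos_iff.2 ⟨⟨x, rfl⟩, inferInstance⟩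

/-- The first point of a strand that is not a left end is on a strand that ends there. -/
theorem IsCover.exists_born (h : D.IsCover n P F) (hD : D.IsTimed n) {s : S} {u : ℕ}
    (hs : D.a s = u + 1) : ∃ x, F (u + 1) x = s ∧ D.b (F u x) = u + 1 := by
  have h1 := hD.lt s
  have h2 := hD.le s
  have hc := h.coloring (u + 1) (by omega)
  obtain ⟨x, hx⟩ := (hc.exists_iff s).2 ⟨hs.le, by omega⟩
  refine ⟨x, hx, ((h.step u (by omega)).born_iff (h.coloring u (by omega)) x).1 ?_⟩
  rw [hx, hs]

/-- Covers of connected diagrams are transitive. -/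
theorem IsCover.isTransitiveSeq [Fintype S] (h : D.IsCover n P F) (hD : D.IsTrivalent n)
    (hconn : D.IsConnected n) : IsTransitiveSeq n P := by
  intro c hc
  have hcyc : ∀ k ≤ n, ∀ x y, F k x = F k y → (c x ↔ c y) := by
    intro k hk x y hxy
    obtain ⟨i, rfl⟩ := (((h.coloring k hk).eq_iff x y).1 hxy).exists_nat_pow_eq
    clear hxy
    induction i with
    | zero => rfl
    | succ i ih => rw [pow_succ', Perm.mul_apply, hc k hk, ih]
  -- all points on the strands that end at a branch point have the same color
  have hvert : ∀ u < n, ∀ z z', D.b (F u z) = u + 1 → D.b (F u z') = u + 1 → (c z ↔ c z') := by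
    intro u hu
    obtain ⟨x, y, hne, hσ, hb, -, -⟩ := (h.step u hu).exists_swap (h.coloring u hu.le) hD.toIsTimed
    have hxy : c x ↔ c y := by
      obtain ⟨z, hz⟩ := (P u).surjective x
      have h1 := hc (u + 1) hu z
      have h2 := hc u hu.le z
      rw [hσ, Perm.mul_apply, hz, swap_apply_left] at h1
      rw [hz] at h2
      exact h2.trans h1.symm
    have : ∀ z, D.b (F u z) = u + 1 → (c z ↔ c x) := by
      intro z hz
      rcases (hb _).1 hz with h1 | h1
      · exact hcyc u hu.le _ _ h1
      · exact (hcyc u hu.le _ _ h1).trans hxy.symm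
    intro z z' hz hz'
    exact (this z hz).trans (this z' hz').symm
  have hC : ∀ u < n, ∀ z, D.b (F u z) = u + 1 →
      ((∃ z', D.b (F u z') = u + 1 ∧ c z') ↔ c z) := fun u hu z hz =>
    ⟨fun ⟨z', h1, h2⟩ => (hvert u hu z' z h1 hz).1 h2, fun h1 => ⟨z, hz, h1⟩⟩
  have hall := hconn (fun u => ∃ z', D.b (F u z') = u + 1 ∧ c z') (by
    intro s ha hb
    have hlt := hD.lt s
    obtain ⟨u, hu⟩ : ∃ u, D.a s = u + 1 := ⟨D.a s - 1, by omega⟩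
    obtain ⟨v, hv⟩ : ∃ v, D.b s = v + 1 := ⟨D.b s - 1, by omega⟩
    obtain ⟨x, hx, hx'⟩ := h.exists_born hD.toIsTimed hu
    have h1 : F v x = s := by
      rw [h.persist (j := u + 1) (by omega) (by omega) (by rw [hx]; omega), hx]
    rw [hu, hv, Nat.add_sub_cancel, Nat.add_sub_cancel, hC u (by omega) x hx',
      hC v (by omega) x (by rw [h1, hv])])
  -- a point reaches the first branch point of its strand
  have hpt : ∀ x, ∃ v < n, D.b (F v x) = v + 1 := by
    intro x
    have ha : D.a (F 0 x) = 0 := Nat.le_zero.1 (h.zero.alive x).1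
    have hb := hD.no_line _ ha
    have hlt := hD.lt (F 0 x)
    obtain ⟨v, hv⟩ : ∃ v, D.b (F 0 x) = v + 1 := ⟨D.b (F 0 x) - 1, by omega⟩
    refine ⟨v, by omega, ?_⟩
    rw [h.persist (j := 0) (by omega) (by omega) (by omega), hv]
  intro x y hx
  obtain ⟨u, hu, hu'⟩ := hpt x
  obtain ⟨v, hv, hv'⟩ := hpt y
  exact (hC v hv y hv').1 (hall u hu v hv ((hC u hu x hu').2 hx))

/-- In a transitive cover with a branch point, no strand is both a left and a right end. -/
theorem IsCover.no_line (h : D.IsCover n P F) (hD : D.IsTimed n) (hn : 0 < n)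
    (ht : IsTransitiveSeq n P) (s : S) (ha : D.a s = 0) : D.b s ≤ n := by
  by_contra hb
  obtain ⟨x, hx⟩ := (h.zero.exists_iff s).2 ⟨ha.le, by omega⟩
  have hall := ht (fun y => F 0 y = s) (by
    have key : ∀ k ≤ n, ∀ y, F k y = s ↔ F 0 y = s := by
      intro k hk y
      constructor
      · intro hy
        have hc := h.coloring k hk
        have h1 : F k x = s := by
          rw [h.persist k.zero_le hk (by rw [hx]; omega), hx]
        -- the strands of `y` up to time `k` have to be `s`, as `s` has no start
        have : ∀ j ≤ k, F (k - j) y = s := by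
          intro j hj
          induction j with
          | zero => simpa using hy
          | succ j ih =>
            have h2 := ih (by omega)
            have hst := h.step (k - (j + 1)) (by omega)
            have he : k - (j + 1) + 1 = k - j := by omega
            by_contra hne
            by_cases hd : D.b (F (k - (j + 1)) y) = k - (j + 1) + 1
            · have := hst.born y hd
              rw [he, h2] at this
              omega
            · have := hst.persist y hd
              rw [he, h2] at this
              exact hne this.symm
        simpa using this k le_rfl
      · intro hy
        rw [h.persist k.zero_le hk (by rw [hy]; omega), hy]
    intro k hk y
    rw [← key k hk, ← key k hk, (h.coloring k hk).apply_eq])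
  obtain ⟨u, v, -, -, hb', -, -⟩ := (h.step 0 hn).exists_swap h.zero hD
  have h1 := (hb' (F 0 u)).2 (Or.inl rfl)
  rw [hall x u hx] at h1
  omega

/-- The diagram of a transitive cover is connected. -/
theorem IsCover.isConnected (h : D.IsCover n P F) (hD : D.IsTimed n)
    (ht : IsTransitiveSeq n P) : D.IsConnected n := by
  intro c hc
  -- extend the coloring of the branch points to the strands
  set κ : S → Prop := fun s => (D.b s ≤ n ∧ c (D.b s - 1)) ∨ (¬ D.b s ≤ n ∧ c (D.a s - 1)) with hκ
  have hκb : ∀ s, D.b s ≤ n → (κ s ↔ c (D.b s - 1)) := by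
    intro s hs
    simp [hκ, hs]
  have hκa : ∀ s, 0 < D.a s → (κ s ↔ c (D.a s - 1)) := by
    intro s hs
    by_cases hb : D.b s ≤ n
    · rw [hκb s hb, hc s hs hb]
    · simp [hκ, hb, not_le.1 hb]
  have hstep : ∀ k < n, ∀ x, κ (F (k + 1) x) ↔ κ (F k x) := by
    intro k hk x
    by_cases hb : D.b (F k x) = k + 1
    · have ha := (h.step k hk).born x hb
      rw [hκb (F k x) (by omega), hκa (F (k + 1) x) (by omega), ha, hb]
    · rw [(h.step k hk).persist x hb]
  have hzero : ∀ k ≤ n, ∀ x, κ (F k x) ↔ κ (F 0 x) := by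
    intro k
    induction k with
    | zero => exact fun _ _ => Iff.rfl
    | succ k ih => exact fun hk x => (hstep k hk x).trans (ih (by omega) x)
  have hall := ht (fun x => κ (F 0 x)) (by
    intro k hk x
    rw [← hzero k hk, ← hzero k hk, (h.coloring k hk).apply_eq])
  have hvert : ∀ u < n, ∃ x, c u ↔ κ (F 0 x) := by
    intro u hu
    obtain ⟨x, y, -, -, hb', -, -⟩ := (h.step u hu).exists_swap (h.coloring u hu.le) hD
    have h1 := (hb' (F u x)).2 (Or.inl rfl)
    refine ⟨x, ?_⟩
    rw [← hzero u hu.le, hκb _ (by omega), h1, Nat.add_sub_cancel]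
  intro u hu v hv hcu
  obtain ⟨x, hx⟩ := hvert u hu
  obtain ⟨y, hy⟩ := hvert v hv
  exact hy.2 (hall x y (hx.1 hcu))

/-- The diagram of a transitive cover is trivalent. -/
theorem IsCover.isTrivalent [Fintype S] (h : D.IsCover n P F) (hD : D.IsTimed n) (hn : 0 < n)
    (ht : IsTransitiveSeq n P) : D.IsTrivalent n where
  toIsTimed := hD
  w_pos := h.w_pos hD
  no_line := h.no_line hD hn ht
  card_eq k hk := (h.step k hk).card_eq (h.coloring k hk.le) hD
  balanced k hk := (h.step k hk).balanced (h.coloring k hk.le) hD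

end Diagram

end TropicalHurwitz

namespace TropicalHurwitz

/-! ### Uniqueness of the diagram of a sequence of permutations -/

/-- Two surjections that identify the same pairs of points have isomorphic images. -/
theorem exists_equiv_of_ker_eq {A S S' : Type*} {G : A → S} {G' : A → S'}
    (hG : Function.Surjective G) (hG' : Function.Surjective G')
    (h : ∀ p q, G p = G q ↔ G' p = G' q) : ∃ φ : S ≃ S', ∀ p, φ (G p) = G' p := by
  choose r hr using hG
  choose r' hr' using hG'
  refine ⟨⟨fun s => G' (r s), fun s => G (r' s), fun s => ?_, fun s => ?_⟩, fun p => ?_⟩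
  · conv_rhs => rw [← hr s]
    rw [h, hr']
  · conv_rhs => rw [← hr' s]
    rw [← h, hr]
  · change G' (r (G p)) = G' p
    rw [← h, hr]

namespace Diagram

open Equiv Equiv.Perm Finset

variable {S S' : Type} {D : Diagram S} {D' : Diagram S'} {d n : ℕ}
  {P : ℕ → Perm (Fin d)} {F : ℕ → Fin d → S} {F' : ℕ → Fin d → S'}

variable (D D') in
/-- A bijection of the strands is an isomorphism of diagrams. -/
structure IsIso (φ : S ≃ S') : Prop where
  w : ∀ s, D'.w (φ s) = D.w s
  a : ∀ s, D'.a (φ s) = D.a s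
  b : ∀ s, D'.b (φ s) = D.b s

theorem IsIso.symm {φ : S ≃ S'} (h : D.IsIso D' φ) : D'.IsIso D φ.symm where
  w s := by rw [← h.w, apply_symm_apply]
  a s := by rw [← h.a, apply_symm_apply]
  b s := by rw [← h.b, apply_symm_apply]

theorem IsIso.trans {S'' : Type} {D'' : Diagram S''} {φ : S ≃ S'} {ψ : S' ≃ S''}
    (h : D.IsIso D' φ) (h' : D'.IsIso D'' ψ) : D.IsIso D'' (φ.trans ψ) where
  w s := by rw [Equiv.trans_apply, h'.w, h.w]
  a s := by rw [Equiv.trans_apply, h'.a, h.a]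
  b s := by rw [Equiv.trans_apply, h'.b, h.b]

theorem IsColoring.of_isIso {φ : S ≃ S'} (h : D.IsIso D' φ) {k : ℕ} {σ : Perm (Fin d)}
    {f : Fin d → S} (hf : D.IsColoring k σ f) : D'.IsColoring k σ (φ ∘ f) where
  eq_iff x y := by rw [← hf.eq_iff]; exact φ.injective.eq_iff
  exists_iff s := by
    obtain ⟨s, rfl⟩ := φ.surjective s
    have : D'.Alive k (φ s) ↔ D.Alive k s := by rw [Alive, Alive, h.a, h.b]
    rw [this, ← hf.exists_iff]
    simp
  card_fiber x := by
    rw [Function.comp_apply, h.w, ← hf.card_fiber]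
    simp

theorem IsCover.of_isIso {φ : S ≃ S'} (h : D.IsIso D' φ) (hF : D.IsCover n P F) :
    D'.IsCover n P (fun k => φ ∘ F k) where
  zero := hF.zero.of_isIso h
  step k hk := by
    have := hF.step k hk
    refine ⟨this.isSwap, fun x => ?_, fun x hx => ?_, fun x hx => ?_, this.coloring.of_isIso h⟩
    · rw [Function.comp_apply, h.b, this.dying_iff]
      simp
    · rw [Function.comp_apply, h.b] at hx
      rw [Function.comp_apply, this.persist x hx, Function.comp_apply]
    · rw [Function.comp_apply, h.b] at hx
      rw [Function.comp_apply, h.a, this.born x hx]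

/-- Whether two points are on the same strand is determined by the permutations. -/
theorem IsCover.eq_iff (h : D.IsCover n P F) {k l : ℕ} (hkl : k ≤ l) (hl : l ≤ n) (x y : Fin d) :
    F k x = F l y ↔ (∀ j, k ≤ j → j < l → ¬ ∃ z, (P j).SameCycle z x ∧
      (P (j + 1) * (P j)⁻¹) z ≠ z) ∧ (P l).SameCycle x y := by
  have htouch : ∀ j, j < l → ((∃ z, (P j).SameCycle z x ∧ (P (j + 1) * (P j)⁻¹) z ≠ z) ↔
      D.b (F j x) = j + 1) := by
    intro j hj
    rw [(h.step j (by omega)).dying_iff]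
    simp only [(h.coloring j (by omega)).eq_iff]
  rw [← (h.coloring l hl).eq_iff]
  constructor
  · intro he
    have hb : l < D.b (F k x) := by
      rw [he]
      exact ((h.coloring l hl).alive y).2
    refine ⟨fun j hj hjl => ?_, by rw [h.persist hkl hl hb, he]⟩
    rw [htouch j hjl, h.persist hj (by omega) (by omega)]
    omega
  · rintro ⟨h1, h2⟩
    rw [← h2]
    have : ∀ j, k ≤ j → j ≤ l → F k x = F j x := by
      intro j hj
      induction j, hj using Nat.le_induction with
      | base => exact fun _ => rfl
      | succ j hj ih =>
        intro hjl
        have h3 := h1 j hj hjl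
        rw [htouch j hjl] at h3
        rw [(h.step j (by omega)).persist x h3, ih (by omega)]
    exact this l hkl le_rfl

theorem IsCover.surjective (h : D.IsCover n P F) (hD : D.IsTimed n) (s : S) :
    ∃ k ≤ n, ∃ x, F k x = s := by
  have h1 := hD.lt s
  have h2 := hD.le s
  exact ⟨D.a s, by omega, ((h.coloring (D.a s) (by omega)).exists_iff s).2 ⟨le_rfl, h1⟩⟩

/-- Two diagrams of the same sequence of permutations are isomorphic. -/
theorem IsCover.exists_isIso (h : D.IsCover n P F) (hD : D.IsTimed n) (h' : D'.IsCover n P F')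
    (hD' : D'.IsTimed n) : ∃ φ : S ≃ S', D.IsIso D' φ ∧ ∀ k ≤ n, ∀ x, φ (F k x) = F' k x := by
  have hker : ∀ k ≤ n, ∀ l ≤ n, ∀ x y, F k x = F l y ↔ F' k x = F' l y := by
    intro k hk l hl x y
    rcases le_total k l with hkl | hkl
    · rw [h.eq_iff hkl hl, h'.eq_iff hkl hl]
    · rw [eq_comm, h.eq_iff hkl hk, eq_comm, h'.eq_iff hkl hk]
  obtain ⟨φ, hφ⟩ := exists_equiv_of_ker_eq (A := {k // k ≤ n} × Fin d)
    (G := fun p => F p.1.1 p.2) (G' := fun p => F' p.1.1 p.2)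
    (fun s => by
      obtain ⟨k, hk, x, hx⟩ := h.surjective hD s
      exact ⟨(⟨k, hk⟩, x), hx⟩)
    (fun s => by
      obtain ⟨k, hk, x, hx⟩ := h'.surjective hD' s
      exact ⟨(⟨k, hk⟩, x), hx⟩)
    (fun p q => hker _ p.1.2 _ q.1.2 _ _)
  have hφ' : ∀ k ≤ n, ∀ x, φ (F k x) = F' k x := fun k hk x => hφ (⟨k, hk⟩, x)
  have halive : ∀ s, ∀ k ≤ n, D'.Alive k (φ s) ↔ D.Alive k s := by
    intro s k hk
    rw [← (h.coloring k hk).exists_iff, ← (h'.coloring k hk).exists_iff]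
    simp only [← hφ' k hk, φ.injective.eq_iff]
  refine ⟨φ, ⟨fun s => ?_, fun s => ?_, fun s => ?_⟩, hφ'⟩
  · obtain ⟨k, hk, x, rfl⟩ := h.surjective hD s
    rw [hφ' k hk, ← (h.coloring k hk).card_fiber, ← (h'.coloring k hk).card_fiber]
    simp only [hker k hk k hk]
  · have h1 := hD.lt s
    have h2 := hD.le s
    have h3 := hD'.lt (φ s)
    have h4 := hD'.le (φ s)
    have h5 := (halive s (D.a s) (by omega)).2 ⟨le_rfl, h1⟩
    have h6 := (halive s (D'.a (φ s)) (by omega)).1 ⟨le_rfl, h3⟩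
    exact le_antisymm h5.1 h6.1
  · have h1 := hD.lt s
    have h2 := hD.le s
    have h3 := hD'.lt (φ s)
    have h4 := hD'.le (φ s)
    have h5 := (halive s (D.b s - 1) (by omega)).2 ⟨by omega, by omega⟩
    have h6 := (halive s (D'.b (φ s) - 1) (by omega)).1 ⟨by omega, by omega⟩
    have := h5.2
    have := h6.2
    omega

variable (D n P) in
/-- The colorings of a given sequence of permutations by the strands of a diagram. The times after
`n` carry no information. -/
abbrev Marking : Type := {F : ℕ → Fin d → S // D.IsCover n P F ∧ ∀ k, n ≤ k → F k = F n}

variable (D) in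
/-- The automorphisms of a diagram. -/
abbrev Aut : Type := {φ : S ≃ S // D.IsIso D φ}

/-- If there is a coloring, then the automorphisms act simply transitively on the colorings. -/
theorem card_marking (hD : D.IsTimed n) (h : Nonempty (D.Marking n P)) :
    Nat.card (D.Marking n P) = Nat.card D.Aut := by
  obtain ⟨F, hF, hF'⟩ := h
  symm
  refine Nat.card_eq_of_bijective (fun φ : D.Aut => (⟨fun k => φ.1 ∘ F k, hF.of_isIso φ.2,
    fun k hk => by simp only [hF' k hk]⟩ : D.Marking n P)) ⟨fun φ ψ he => ?_, fun G => ?_⟩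
  · refine Subtype.ext (Equiv.ext fun s => ?_)
    obtain ⟨k, hk, x, rfl⟩ := hF.surjective hD s
    exact congrFun (congrFun (congrArg Subtype.val he) k) x
  · obtain ⟨φ, h1, h2⟩ := hF.exists_isIso hD G.2.1 hD
    refine ⟨⟨φ, h1⟩, Subtype.ext (funext fun k => funext fun x => ?_)⟩
    change φ (F k x) = G.1 k x
    rcases le_total k n with hk | hk
    · exact h2 k hk x
    · rw [hF' k hk, G.2.2 k hk, h2 n le_rfl]

end Diagram

end TropicalHurwitz

namespace TropicalHurwitz

/-! ### Existence of the diagram of a sequence of permutations -/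

section Canonical

open Equiv Equiv.Perm Finset

variable {d : ℕ} (P : ℕ → Perm (Fin d)) (n : ℕ)

/-- The cycle of `x` at time `k` contains a point that is moved between the times `k` and `k + 1`. -/
def Touched (k : ℕ) (x : Fin d) : Prop :=
  ∃ z, (P k).SameCycle z x ∧ (P (k + 1) * (P k)⁻¹) z ≠ z

open scoped Classical in
/-- The first time at which the current cycle of `x` appeared. -/
def birth : ℕ → Fin d → ℕ
  | 0, _ => 0
  | k + 1, x => if Touched P k x then k + 1 else birth k x

/-- The strand of the point `x` at time `k`, given by its first time and its cycle. -/
def code (k : ℕ) (x : Fin d) : ℕ × Set (Fin d) := (birth P k x, {y | (P k).SameCycle x y})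

variable {P} {n}

theorem birth_le (k : ℕ) (x : Fin d) : birth P k x ≤ k := by
  induction k with
  | zero => exact le_rfl
  | succ k ih =>
    rw [birth]
    split_ifs <;> omega

theorem Touched.of_sameCycle {k : ℕ} {x y : Fin d} (h : Touched P k x)
    (hxy : (P k).SameCycle x y) : Touched P k y := by
  obtain ⟨z, h1, h2⟩ := h
  exact ⟨z, h1.trans hxy, h2⟩

theorem sameCycle_succ_iff {k : ℕ} {x : Fin d} (h : ¬ Touched P k x) (y : Fin d) :
    (P (k + 1)).SameCycle x y ↔ (P k).SameCycle x y := by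
  refine sameCycle_congr (fun u hu => ?_) y
  by_contra hne
  refine h ⟨P k u, sameCycle_apply_left.2 hu.symm, ?_⟩
  simpa using hne

theorem birth_eq_of_sameCycle {k : ℕ} {x y : Fin d} (h : (P k).SameCycle x y) :
    birth P k x = birth P k y := by
  induction k generalizing x y with
  | zero => rfl
  | succ k ih =>
    by_cases hx : Touched P k x
    · by_cases hy : Touched P k y
      · simp [birth, hx, hy]
      · exact absurd (hx.of_sameCycle ((sameCycle_succ_iff hy x).1 h.symm).symm) hy
    · have h' := (sameCycle_succ_iff hx y).1 h
      have hy : ¬ Touched P k y := fun hy => hx (hy.of_sameCycle h'.symm)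
      simp [birth, hx, hy, ih h']

theorem code_eq_iff {k : ℕ} {x y : Fin d} : code P k x = code P k y ↔ (P k).SameCycle x y := by
  constructor
  · intro h
    have h2 : {z | (P k).SameCycle x z} = {z | (P k).SameCycle y z} := (Prod.ext_iff.1 h).2
    have : y ∈ {z | (P k).SameCycle y z} := SameCycle.refl _ _
    rwa [← h2] at this
  · intro h
    refine Prod.ext (birth_eq_of_sameCycle h) (Set.ext fun z => ?_)
    exact ⟨fun hz => h.symm.trans hz, fun hz => h.trans hz⟩

theorem code_succ_of_not_touched {k : ℕ} {x : Fin d} (h : ¬ Touched P k x) :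
    code P (k + 1) x = code P k x := by
  refine Prod.ext (by simp [code, birth, h]) (Set.ext fun y => ?_)
  exact sameCycle_succ_iff h y

theorem code_eq_of_birth_le {j k : ℕ} (hjk : j ≤ k) {x : Fin d} (h : birth P k x ≤ j) :
    code P j x = code P k x := by
  induction k, hjk using Nat.le_induction with
  | base => rfl
  | succ k hjk ih =>
    by_cases hx : Touched P k x
    · simp only [birth, hx, if_true] at h
      omega
    · rw [code_succ_of_not_touched hx]
      refine ih ?_
      simpa only [birth, hx, if_false] using h

variable (P n) in
/-- The strands of a sequence of permutations. -/
abbrev CanonicalStrand : Type := {s : ℕ × Set (Fin d) // ∃ k ≤ n, ∃ x, code P k x = s}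

instance : Finite (CanonicalStrand P n) := by
  refine Finite.of_surjective (fun p : Fin (n + 1) × Fin d =>
    (⟨code P p.1 p.2, p.1, by omega, p.2, rfl⟩ : CanonicalStrand P n)) ?_
  rintro ⟨s, k, hk, x, rfl⟩
  exact ⟨(⟨k, by omega⟩, x), rfl⟩

open scoped Classical in
variable (P n) in
/-- The diagram of a sequence of permutations. -/
def canonicalDiagram : Diagram (CanonicalStrand P n) where
  w s := Nat.card s.1.2
  a s := s.1.1
  b s := ({k ∈ range (n + 1) | ∃ x, code P k x = s.1}).sup id + 1

variable (P n) in
/-- The strand of a point at a given time. -/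
def canonicalMark (k : ℕ) (x : Fin d) : CanonicalStrand P n :=
  ⟨code P (min k n) x, min k n, min_le_right _ _, x, rfl⟩

theorem canonicalMark_val {k : ℕ} (hk : k ≤ n) (x : Fin d) :
    (canonicalMark P n k x).1 = code P k x := by
  simp [canonicalMark, hk]

theorem canonicalMark_eq_iff {k : ℕ} (hk : k ≤ n) {x : Fin d} {s : CanonicalStrand P n} :
    canonicalMark P n k x = s ↔ code P k x = s.1 := by
  rw [Subtype.ext_iff, canonicalMark_val hk]

theorem canonicalMark_eq_canonicalMark {k : ℕ} (hk : k ≤ n) {x y : Fin d} :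
    canonicalMark P n k x = canonicalMark P n k y ↔ (P k).SameCycle x y := by
  rw [canonicalMark_eq_iff hk, ← code_eq_iff, canonicalMark_val hk]

theorem canonicalDiagram_alive_iff {k : ℕ} (hk : k ≤ n) (s : CanonicalStrand P n) :
    (canonicalDiagram P n).Alive k s ↔ ∃ x, code P k x = s.1 := by
  classical
  constructor
  · rintro ⟨h1, h2⟩
    obtain ⟨s, j, hj, y, rfl⟩ := s
    -- the last time at which the strand is alive
    obtain ⟨m, hm, hm'⟩ := exists_mem_eq_sup {k ∈ range (n + 1) | ∃ x, code P k x = code P j y}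
      ⟨j, by simp only [mem_filter, mem_range]; exact ⟨by omega, y, rfl⟩⟩ id
    simp only [canonicalDiagram] at h1 h2
    rw [hm', id] at h2
    simp only [mem_filter] at hm
    obtain ⟨-, x, hx⟩ := hm
    refine ⟨x, ?_⟩
    change _ = code P j y
    rw [← hx]
    refine code_eq_of_birth_le (by omega) ?_
    rw [← hx] at h1
    exact h1
  · rintro ⟨x, hx⟩
    refine ⟨?_, Nat.lt_succ_of_le (le_sup (f := id) ?_)⟩
    · change s.1.1 ≤ k
      rw [← hx]
      exact birth_le k x
    · simp only [mem_filter, mem_range]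
      exact ⟨by omega, x, hx⟩

theorem canonicalDiagram_isTimed : (canonicalDiagram P n).IsTimed n where
  lt s := by
    obtain ⟨k, hk, hx⟩ := s.2
    have := (canonicalDiagram_alive_iff hk s).2 hx
    exact lt_of_le_of_lt this.1 this.2
  le s := by
    refine Nat.succ_le_succ (Finset.sup_le fun k hk => ?_)
    simp only [mem_filter, mem_range] at hk
    exact Nat.lt_succ_iff.1 hk.1

theorem canonicalDiagram_isColoring {k : ℕ} (hk : k ≤ n) :
    (canonicalDiagram P n).IsColoring k (P k) (canonicalMark P n k) where
  eq_iff x y := canonicalMark_eq_canonicalMark hk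
  exists_iff s := by
    rw [canonicalDiagram_alive_iff hk]
    simp only [canonicalMark_eq_iff hk]
  card_fiber x := by
    simp only [canonicalMark_eq_canonicalMark hk]
    simp only [canonicalDiagram, canonicalMark_val hk, code]
    refine Nat.card_congr (Equiv.subtypeEquivRight fun y => ?_)
    exact sameCycle_comm

theorem canonicalDiagram_dying_iff {k : ℕ} (hk : k < n) (x : Fin d) :
    (canonicalDiagram P n).b (canonicalMark P n k x) = k + 1 ↔ Touched P k x := by
  have h0 := canonicalMark_val (P := P) hk.le x
  have h1 := (canonicalDiagram_alive_iff hk.le (canonicalMark P n k x)).2 ⟨x, h0.symm⟩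
  have h2 := canonicalDiagram_alive_iff (k := k + 1) hk (canonicalMark P n k x)
  rw [h0] at h2
  have h3 : (canonicalDiagram P n).b (canonicalMark P n k x) = k + 1 ↔
      ¬ ∃ y, code P (k + 1) y = code P k x := by
    rw [← h2]
    have := h1.1
    have := h1.2
    unfold Diagram.Alive
    omega
  rw [h3]
  constructor
  · intro h
    by_contra hx
    exact h ⟨x, code_succ_of_not_touched hx⟩
  · rintro hx ⟨y, hy⟩
    have hb : birth P (k + 1) y ≤ k := by
      rw [show birth P (k + 1) y = birth P k x from (Prod.ext_iff.1 hy).1]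
      exact birth_le k x
    have hc := code_eq_of_birth_le k.le_succ hb
    rw [hy, code_eq_iff] at hc
    simp only [birth, hx.of_sameCycle hc.symm, if_true] at hb
    omega

/-- A sequence of permutations that differ by transpositions is colored by its diagram. -/
theorem canonicalDiagram_isCover (h : ∀ k < n, (P (k + 1) * (P k)⁻¹).IsSwap) :
    (canonicalDiagram P n).IsCover n P (canonicalMark P n) where
  zero := canonicalDiagram_isColoring n.zero_le
  step k hk := by
    refine ⟨h k hk, fun x => ?_, fun x hx => ?_, fun x hx => ?_, canonicalDiagram_isColoring hk⟩
    · rw [canonicalDiagram_dying_iff hk]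
      simp only [canonicalMark_eq_canonicalMark hk.le]
      rfl
    · rw [Ne, canonicalDiagram_dying_iff hk] at hx
      rw [canonicalMark_eq_iff hk, code_succ_of_not_touched hx, canonicalMark_val hk.le]
    · rw [canonicalDiagram_dying_iff hk] at hx
      simp [canonicalDiagram, canonicalMark_val hk, code, birth, hx]

end Canonical

end TropicalHurwitz

namespace TropicalHurwitz

/-! ### Counting the covers of a diagram -/

theorem card_sigma_of_card_eq {A : Type*} {B : A → Type*} [∀ a, Finite (B a)] {m : ℕ}
    (h : ∀ a, Nat.card (B a) = m) : Nat.card (Σ a, B a) = Nat.card A * m := by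
  rw [Nat.card_congr ((Equiv.sigmaCongrRight fun a => Finite.equivFinOfCardEq (h a)).trans
    (Equiv.sigmaEquivProd A (Fin m))), Nat.card_prod, Nat.card_fin]

/-- If every state that can occur at time `k` has `m k` successors, then the number of paths up to
time `n` is the number of initial states times the product of the `m k`. Paths are constant after
time `n`. -/
theorem card_path {Y : Type*} [Finite Y] {G : ℕ → Y → Prop} {R : ℕ → Y → Y → Prop} {m : ℕ → ℕ}
    (hG : ∀ k y y', R k y y' → G (k + 1) y') (n : ℕ)
    (hm : ∀ k < n, ∀ y, G k y → Nat.card {y' // R k y y'} = m k) :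
    Nat.card {p : ℕ → Y // G 0 (p 0) ∧ (∀ k < n, R k (p k) (p (k + 1))) ∧
      ∀ k, n ≤ k → p k = p n} = Nat.card {y // G 0 y} * ∏ k ∈ Finset.range n, m k := by
  induction n with
  | zero =>
    rw [Finset.prod_range_zero, mul_one]
    refine Nat.card_congr ⟨fun p => ⟨p.1 0, p.2.1⟩, fun y => ⟨fun _ => y.1, y.2, by simp, by simp⟩,
      fun p => ?_, fun y => rfl⟩
    exact Subtype.ext (funext fun k => (p.2.2.2 k k.zero_le).symm)
  | succ n ih =>
    have hlast : ∀ p : {p : ℕ → Y // G 0 (p 0) ∧ (∀ k < n, R k (p k) (p (k + 1))) ∧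
        ∀ k, n ≤ k → p k = p n}, G n (p.1 n) := by
      rintro ⟨p, h0, h1, -⟩
      cases n with
      | zero => exact h0
      | succ n => exact hG n _ _ (h1 n n.lt_succ_self)
    rw [Finset.prod_range_succ, ← mul_assoc, ← ih fun k hk => hm k (by omega),
      ← card_sigma_of_card_eq fun p => hm n n.lt_succ_self _ (hlast p)]
    refine Nat.card_congr
      ⟨fun p => ⟨⟨fun k => p.1 (min k n), ?_, fun k hk => ?_, fun k hk => ?_⟩, p.1 (n + 1), ?_⟩,
      fun q => ⟨fun k => if k ≤ n then q.1.1 k else q.2.1, ?_, fun k hk => ?_, fun k hk => ?_⟩,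
      fun p => ?_, fun q => ?_⟩
    · simpa using p.2.1
    · simp only [min_eq_left hk.le, min_eq_left (show k + 1 ≤ n from hk)]
      exact p.2.2.1 k (by omega)
    · simp only [min_eq_right hk, min_self]
    · simp only [min_self]
      exact p.2.2.1 n n.lt_succ_self
    · simpa using q.1.2.1
    · rcases Nat.lt_succ_iff_lt_or_eq.1 hk with hk' | rfl
      · simp only [hk'.le, show k + 1 ≤ n from hk', if_true]
        exact q.1.2.2.1 k hk'
      · simpa using q.2.2
    · simp only [show ¬ k ≤ n by omega, show ¬ n + 1 ≤ n by omega, if_false]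
    · refine Subtype.ext (funext fun k => ?_)
      simp only
      split_ifs with hk
      · rw [min_eq_left hk]
      · exact (p.2.2.2 k (by omega)).symm
    · obtain ⟨⟨p, h0, h1, h2⟩, y, hy⟩ := q
      have hp : (fun k => if min k n ≤ n then p (min k n) else y) = p := by
        funext k
        rw [if_pos (min_le_right _ _)]
        rcases le_total k n with hk | hk
        · rw [min_eq_left hk]
        · rw [min_eq_right hk, h2 k hk]
      have hy' : (if n + 1 ≤ n then p (n + 1) else y) = y := if_neg (by omega)
      refine Sigma.ext (Subtype.ext hp) ?_
      refine (Subtype.heq_iff_coe_eq fun z => ?_).2 hy'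
      simp

open Equiv Equiv.Perm Finset

/-- The cycle of a point that returns for the first time after `j` steps has `j` points. -/
theorem card_first_pow {X : Type*} [DecidableEq X] {σ : Perm X} {x : X} {j : ℕ}
    (h : ∀ i, 0 < i → i < j → (σ ^ i) x ≠ x) : #((range j).image fun i => (σ ^ i) x) = j := by
  rw [card_image_of_injOn, card_range]
  have key : ∀ i i', i < i' → i' < j → (σ ^ i) x ≠ (σ ^ i') x := by
    intro i i' hi hi' he
    refine h (i' - i) (by omega) (by omega) ?_
    rw [show i' = i + (i' - i) by omega, pow_add, Perm.mul_apply] at he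
    exact ((σ ^ i).injective he).symm
  intro i hi i' hi' he
  simp only [coe_range, Set.mem_Iio] at hi hi'
  rcases lt_trichotomy i i' with hlt | heq | hlt
  · exact absurd he (key i i' hlt hi')
  · exact heq
  · exact absurd he.symm (key i' i hlt hi)

namespace Diagram

variable {S : Type} {D : Diagram S} {d n k : ℕ} {σ σ' : Perm (Fin d)} {f f' : Fin d → S}

theorem IsColoring.card_sameCycle (h : D.IsColoring k σ f) (x : Fin d) :
    Nat.card {y // σ.SameCycle x y} = D.w (f x) := by
  rw [← h.card_fiber]
  refine Nat.card_congr (Equiv.subtypeEquivRight fun y => ?_)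
  rw [h.eq_iff, sameCycle_comm]

theorem card_sameCycle_of_iff {x : Fin d} {j : ℕ} {τ : Perm (Fin d)}
    (h : ∀ i, 0 < i → i < j → (σ ^ i) x ≠ x)
    (h' : ∀ u, τ.SameCycle x u ↔ ∃ i < j, (σ ^ i) x = u) : Nat.card {y // τ.SameCycle x y} = j := by
  classical
  rw [← card_first_pow h, Nat.card_eq_fintype_card, Fintype.card_subtype]
  congr 1
  ext u
  simp [h']

/-- A point returns for the first time after as many steps as the weight of its strand. -/
theorem IsColoring.pow_w (h : D.IsColoring k σ f) (x : Fin d) :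
    (σ ^ D.w (f x)) x = x ∧ (∀ i, 0 < i → i < D.w (f x) → (σ ^ i) x ≠ x) ∧
      ∀ u, σ.SameCycle x u ↔ ∃ i < D.w (f x), (σ ^ i) x = u := by
  obtain ⟨j, hj, hx, hmin⟩ := exists_first_pow (SameCycle.refl σ x)
  have h1 := sameCycle_iff_of_pow_eq hj hx
  have h2 := card_sameCycle_of_iff hmin h1
  rw [h.card_sameCycle] at h2
  subst h2
  exact ⟨hx, hmin, h1⟩

/-- A criterion for steps in which only the strands through the exchanged points are considered. -/
theorem IsColoring.isStep (h : D.IsColoring k σ f) (hD : D.IsTimed n) {x y : Fin d} (hne : x ≠ y)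
    (hσ : σ' = swap x y * σ) (hb : ∀ s, D.b s = k + 1 ↔ s = f x ∨ s = f y)
    (hp : ∀ z, D.b (f z) ≠ k + 1 → f' z = f z) (hborn : ∀ z, D.b (f z) = k + 1 → D.a (f' z) = k + 1)
    (heq : ∀ z z', D.b (f z) = k + 1 → D.b (f z') = k + 1 → (f' z = f' z' ↔ σ'.SameCycle z z'))
    (hsurj : ∀ s, D.a s = k + 1 → ∃ z, f' z = s)
    (hcard : ∀ z, D.b (f z) = k + 1 → Nat.card {y // σ'.SameCycle z y} = D.w (f' z)) :
    D.IsStep k σ f σ' f' := by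
  have hτ : σ' * σ⁻¹ = swap x y := by rw [hσ, mul_inv_cancel_right]
  have hdie : ∀ z, D.b (f z) = k + 1 ↔ σ.SameCycle z x ∨ σ.SameCycle z y := by
    intro z
    rw [hb, h.eq_iff, h.eq_iff]
  have hnot : ∀ z, D.b (f z) ≠ k + 1 → ∀ u, σ'.SameCycle z u ↔ σ.SameCycle z u := by
    intro z hz u
    rw [Ne, hdie, not_or] at hz
    rw [hσ]
    exact sameCycle_swap_mul_of_not hz.1 hz.2 u
  have heq' : ∀ z z', f' z = f' z' ↔ σ'.SameCycle z z' := by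
    intro z z'
    by_cases hz : D.b (f z) = k + 1
    · by_cases hz' : D.b (f z') = k + 1
      · exact heq z z' hz hz'
      · rw [hp z' hz', sameCycle_comm, hnot z' hz', ← h.eq_iff]
        constructor
        · intro he
          have h1 := hborn z hz
          rw [he] at h1
          have := (h.alive z').1
          omega
        · intro he
          rw [he] at hz'
          exact absurd hz hz'
    · rw [hp z hz, hnot z hz, ← h.eq_iff]
      by_cases hz' : D.b (f z') = k + 1
      · constructor
        · intro he
          have h1 := hborn z' hz'
          rw [← he] at h1
          have := (h.alive z).1
          omega
        · intro he
          rw [he] at hz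
          exact absurd hz' hz
      · rw [hp z' hz']
  refine ⟨⟨x, y, hne, hτ⟩, fun z => ?_, hp, hborn, heq', fun s => ?_, fun z => ?_⟩
  · rw [hτ, hb]
    constructor
    · rintro (h1 | h1)
      · exact ⟨x, h1.symm, by rw [swap_apply_left]; exact hne.symm⟩
      · exact ⟨y, h1.symm, by rw [swap_apply_right]; exact hne⟩
    · rintro ⟨u, h1, h2⟩
      rw [swap_apply_ne_self_iff] at h2
      rcases h2.2 with rfl | rfl
      · exact Or.inl h1.symm
      · exact Or.inr h1.symm
  · have hlt := hD.lt s
    constructor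
    · rintro ⟨z, rfl⟩
      by_cases hz : D.b (f z) = k + 1
      · have := hborn z hz
        exact ⟨by omega, by omega⟩
      · rw [hp z hz]
        obtain ⟨h1, h2⟩ := h.alive z
        exact ⟨by omega, by omega⟩
    · rintro ⟨h1, h2⟩
      by_cases ha : D.a s = k + 1
      · exact hsurj s ha
      · obtain ⟨z, rfl⟩ := (h.exists_iff s).2 ⟨by omega, by omega⟩
        exact ⟨z, hp z (by omega)⟩
  · have h1 : Nat.card {y // f' y = f' z} = Nat.card {y // σ'.SameCycle z y} :=
      Nat.card_congr (Equiv.subtypeEquivRight fun y => by rw [heq', sameCycle_comm])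
    rw [h1]
    by_cases hz : D.b (f z) = k + 1
    · exact hcard z hz
    · rw [hp z hz, ← h.card_sameCycle]
      exact Nat.card_congr (Equiv.subtypeEquivRight fun y => hnot z hz y)

/-- Two strands of weights `w₁` and `w₂` can be joined in `w₁ w₂` ways. -/
theorem IsColoring.card_isStep_of_join (h : D.IsColoring k σ f) (hD : D.IsTimed n)
    {s₁ s₂ s₃ : S} (hne : s₁ ≠ s₂) (hw : D.w s₃ = D.w s₁ + D.w s₂)
    (hb : ∀ s, D.b s = k + 1 ↔ s = s₁ ∨ s = s₂) (ha : ∀ s, D.a s = k + 1 ↔ s = s₃) :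
    Nat.card {y : Perm (Fin d) × (Fin d → S) // D.IsStep k σ f y.1 y.2} = D.w s₁ * D.w s₂ := by
  classical
  have hal : ∀ s, D.b s = k + 1 → ∃ x, f x = s := by
    intro s hs
    have := hD.lt s
    exact (h.exists_iff s).2 ⟨by omega, by omega⟩
  have hc : ∀ s, D.b s = k + 1 → Nat.card {x // f x = s} = D.w s := by
    intro s hs
    obtain ⟨x, rfl⟩ := hal s hs
    exact h.card_fiber x
  set g : Fin d → S := fun z => if D.b (f z) = k + 1 then s₃ else f z with hg
  have hstep : ∀ p : {x // f x = s₁} × {y // f y = s₂},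
      D.IsStep k σ f (swap p.1.1 p.2.1 * σ) g := by
    rintro ⟨⟨x, hx⟩, ⟨y, hy⟩⟩
    have hxy : ¬ σ.SameCycle x y := by
      rw [← h.eq_iff, hx, hy]
      exact hne
    have hdie : ∀ z, D.b (f z) = k + 1 ↔ (swap x y * σ).SameCycle x z := by
      intro z
      rw [sameCycle_swap_mul_iff hxy, hb, ← hx, ← hy, h.eq_iff, h.eq_iff, sameCycle_comm,
        σ.sameCycle_comm (x := z)]
    refine h.isStep hD (fun he : x = y => hxy (by rw [he])) rfl (by rw [hx, hy]; exact hb)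
      (fun z hz => if_neg hz) (fun z hz => ?_) (fun z z' hz hz' => ?_) (fun s hs => ⟨x, ?_⟩)
      (fun z hz => ?_)
    · simp only [hg, hz, if_true]
      exact (ha s₃).2 rfl
    · simp only [hg, hz, hz', if_true, true_iff]
      exact ((hdie z).1 hz).symm.trans ((hdie z').1 hz')
    · rw [(ha s).1 hs]
      exact if_pos ((hb _).2 (Or.inl hx))
    · simp only [hg, hz, if_true]
      have h1 : ∀ u, (swap x y * σ).SameCycle z u ↔ f u ∈ ({s₁, s₂} : Finset S) := by
        intro u
        rw [mem_insert, mem_singleton, ← hb, hdie]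
        have := (hdie z).1 hz
        exact ⟨fun h' => this.trans h', fun h' => this.symm.trans h'⟩
      rw [hw, ← sum_pair hne, h.sum_w {s₁, s₂}, Nat.card_eq_fintype_card, Fintype.card_subtype]
      · simp only [h1]
      · intro s hs
        have := hD.lt s
        rw [mem_insert, mem_singleton, ← hb] at hs
        exact ⟨by omega, by omega⟩
  rw [← hc s₁ ((hb _).2 (Or.inl rfl)), ← hc s₂ ((hb _).2 (Or.inr rfl)), ← Nat.card_prod]
  symm
  refine Nat.card_eq_of_bijective (fun p => ⟨(swap p.1.1 p.2.1 * σ, g), hstep p⟩)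
    ⟨fun p q he => ?_, fun ⟨⟨τ, g'⟩, hst⟩ => ?_⟩
  · obtain ⟨⟨x, hx⟩, ⟨y, hy⟩⟩ := p
    obtain ⟨⟨x', hx'⟩, ⟨y', hy'⟩⟩ := q
    have he' := mul_right_cancel (Prod.ext_iff.1 (Subtype.ext_iff.1 he)).1
    simp only at he'
    have hxy : x ≠ y := by rintro rfl; exact hne (hx.symm.trans hy)
    have h1 : swap x' y' x ≠ x := by rw [← he', swap_apply_left]; exact hxy.symm
    have h2 : swap x' y' y ≠ y := by rw [← he', swap_apply_right]; exact hxy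
    rw [swap_apply_ne_self_iff] at h1 h2
    have h3 : x = x' := by
      rcases h1.2 with h3 | rfl
      · exact h3
      · exact absurd (hx.symm.trans hy') hne
    have h4 : y = y' := by
      rcases h2.2 with rfl | h4
      · exact absurd (hx'.symm.trans hy) hne
      · exact h4
    subst h3 h4
    rfl
  · simp only at hst
    obtain ⟨x, y, hxy, hτ, hb', ha', hiff⟩ := hst.exists_swap h hD
    have hg' : g' = g := by
      funext z
      by_cases hz : D.b (f z) = k + 1
      · simp only [hg, hz, if_true]
        exact (ha _).1 (hst.born z hz)
      · simp only [hg, hz, if_false]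
        exact hst.persist z hz
    have h1 := (hb' s₁).1 ((hb _).2 (Or.inl rfl))
    have h2 := (hb' s₂).1 ((hb _).2 (Or.inr rfl))
    rcases h1 with h1 | h1
    · rcases h2 with h2 | h2
      · exact absurd (h1.trans h2.symm) hne
      · exact ⟨(⟨x, h1.symm⟩, ⟨y, h2.symm⟩), Subtype.ext (Prod.ext hτ.symm hg'.symm)⟩
    · rcases h2 with h2 | h2
      · refine ⟨(⟨y, h1.symm⟩, ⟨x, h2.symm⟩), Subtype.ext (Prod.ext ?_ hg'.symm)⟩
        simp only
        rw [hτ, swap_comm]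
      · exact absurd (h1.trans h2.symm) hne

/-- A strand of weight `w₃ = w₁ + w₂` can be split into two given strands of weights `w₁` and `w₂`
in `w₃` ways: the first exchanged point `x` on the new strand of weight `w₁` is arbitrary, and the
other one is `σ ^ w₁` applied to `x`. -/
theorem IsColoring.card_isStep_of_cut (h : D.IsColoring k σ f) (hD : D.IsTimed n)
    {s₁ s₂ s₃ : S} (hne : s₁ ≠ s₂) (hw : D.w s₃ = D.w s₁ + D.w s₂) (hw₁ : 0 < D.w s₁)
    (hw₂ : 0 < D.w s₂) (hb : ∀ s, D.b s = k + 1 ↔ s = s₃)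
    (ha : ∀ s, D.a s = k + 1 ↔ s = s₁ ∨ s = s₂) :
    Nat.card {y : Perm (Fin d) × (Fin d → S) // D.IsStep k σ f y.1 y.2} = D.w s₃ := by
  classical
  have hc : Nat.card {x // f x = s₃} = D.w s₃ := by
    have hs := (hb s₃).2 rfl
    have := hD.lt s₃
    obtain ⟨x, hx⟩ := (h.exists_iff s₃).2 ⟨by omega, by omega⟩
    rw [← hx]
    exact h.card_fiber x
  set y : Fin d → Fin d := fun x => (σ ^ D.w s₁) x with hy
  set g : Fin d → Fin d → S := fun x z => if D.b (f z) = k + 1 then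
    if (swap x (y x) * σ).SameCycle x z then s₁ else s₂ else f z with hg
  -- the data of a splitting at `x`
  have hx : ∀ x, f x = s₃ → x ≠ y x ∧ (∀ i, 0 < i → i < D.w s₁ → (σ ^ i) x ≠ x) ∧
      ∀ u, (swap x (y x) * σ).SameCycle x u ↔ ∃ i < D.w s₁, (σ ^ i) x = u := by
    intro x hx
    obtain ⟨-, h2, -⟩ := h.pow_w x
    rw [hx, hw] at h2
    refine ⟨(h2 _ hw₁ (by omega)).symm, fun i h3 h4 => h2 i h3 (by omega), ?_⟩
    refine sameCycle_swap_mul_of_pow hw₁ rfl fun i h3 h4 => ⟨h2 i h3 (by omega), fun he => ?_⟩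
    refine h2 (D.w s₁ - i) (by omega) (by omega) ((σ ^ i).injective ?_)
    rw [← Perm.mul_apply, ← pow_add, he, hy]
    congr 2
    omega
  have hcyc : ∀ x, σ.SameCycle x (y x) := fun x => ⟨D.w s₁, by simp [hy]⟩
  have hfy : ∀ x, f (y x) = f x := fun x => (h.eq_iff _ _).2 (hcyc x).symm
  have hstep : ∀ x : {x // f x = s₃}, D.IsStep k σ f (swap x.1 (y x.1) * σ) (g x.1) := by
    rintro ⟨x, hx3⟩
    obtain ⟨hxy, hret, hx'⟩ := hx x hx3
    have hnot := not_sameCycle_swap_mul (hcyc x) hxy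
    have hdie : ∀ z, D.b (f z) = k + 1 ↔ (swap x (y x) * σ).SameCycle x z ∨
        (swap x (y x) * σ).SameCycle (y x) z := by
      intro z
      rw [← sameCycle_iff_swap_mul (hcyc x) hxy, hb, ← hx3, h.eq_iff, sameCycle_comm]
    have hcard₁ : Nat.card {u // (swap x (y x) * σ).SameCycle x u} = D.w s₁ :=
      card_sameCycle_of_iff hret hx'
    have hcard₂ : Nat.card {u // (swap x (y x) * σ).SameCycle (y x) u} = D.w s₂ := by
      have h1 : Nat.card {u // (swap x (y x) * σ).SameCycle x u} +
          Nat.card {u // (swap x (y x) * σ).SameCycle (y x) u} = Nat.card {u // f u = s₃} := by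
        simp only [Nat.card_eq_fintype_card, Fintype.card_subtype]
        rw [← card_union_of_disjoint]
        · congr 1
          ext u
          simp only [mem_union, mem_filter, mem_univ, true_and]
          rw [← hdie, hb]
        · rw [disjoint_filter]
          intro u _ h1 h2
          exact hnot (h1.trans h2.symm)
      omega
    refine h.isStep hD hxy rfl (fun s => by rw [hfy, hx3, or_self, hb]) (fun z hz => if_neg hz)
      (fun z hz => ?_) (fun z z' hz hz' => ?_) (fun s hs => ?_) (fun z hz => ?_)
    · simp only [hg, hz, if_true]
      rw [ha]
      split_ifs
      · exact Or.inl rfl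
      · exact Or.inr rfl
    · simp only [hg, hz, hz', if_true]
      rcases (hdie z).1 hz with h1 | h1
      · rw [if_pos h1]
        split_ifs with h2
        · simp only [true_iff]
          exact h1.symm.trans h2
        · refine ⟨fun he => absurd he hne, fun he => absurd (h1.trans he) h2⟩
      · have h1' : ¬ (swap x (y x) * σ).SameCycle x z := fun h' => hnot (h'.trans h1.symm)
        rw [if_neg h1']
        split_ifs with h2
        · refine ⟨fun he => absurd he hne.symm, fun he => absurd (h2.trans he.symm) h1'⟩
        · simp only [true_iff]
          exact h1.symm.trans (((hdie z').1 hz').resolve_left h2)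
    · rcases (ha s).1 hs with rfl | rfl
      · refine ⟨x, ?_⟩
        simp only [hg]
        rw [if_pos ((hb _).2 hx3), if_pos (SameCycle.refl _ _)]
      · refine ⟨y x, ?_⟩
        simp only [hg]
        rw [if_pos ((hb _).2 ((hfy x).trans hx3)), if_neg hnot]
    · simp only [hg, hz, if_true]
      split_ifs with h1
      · rw [← hcard₁]
        refine Nat.card_congr (Equiv.subtypeEquivRight fun u => ?_)
        exact ⟨fun h' => h1.trans h', fun h' => h1.symm.trans h'⟩
      · have h2 := ((hdie z).1 hz).resolve_left h1
        rw [← hcard₂]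
        refine Nat.card_congr (Equiv.subtypeEquivRight fun u => ?_)
        exact ⟨fun h' => h2.trans h', fun h' => h2.symm.trans h'⟩
  rw [← hc]
  symm
  refine Nat.card_eq_of_bijective (fun x => ⟨(swap x.1 (y x.1) * σ, g x.1), hstep x⟩)
    ⟨fun p q he => ?_, fun ⟨⟨τ, g'⟩, hst⟩ => ?_⟩
  · obtain ⟨x, hx3⟩ := p
    obtain ⟨x', hx3'⟩ := q
    obtain ⟨hxy, -, -⟩ := hx x hx3
    obtain ⟨hxy', -, -⟩ := hx x' hx3'
    have he1 := mul_right_cancel (Prod.ext_iff.1 (Subtype.ext_iff.1 he)).1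
    have he2 : g x = g x' := (Prod.ext_iff.1 (Subtype.ext_iff.1 he)).2
    simp only at he1
    have h1 : swap x' (y x') x ≠ x := by rw [← he1, swap_apply_left]; exact hxy.symm
    rw [swap_apply_ne_self_iff] at h1
    rcases h1.2 with rfl | h1
    · rfl
    · -- the two points of a transposition are told apart by the new strands
      have h2 : g x x = s₁ := by
        simp only [hg]
        rw [if_pos ((hb _).2 hx3), if_pos (SameCycle.refl _ _)]
      have h3 : g x' (y x') = s₂ := by
        simp only [hg]
        rw [if_pos ((hb _).2 ((hfy x').trans hx3')),
          if_neg (not_sameCycle_swap_mul (hcyc x') hxy')]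
      rw [← h1, ← he2, h2] at h3
      exact absurd h3 hne
  · simp only at hst
    have hmain : ∀ x y', x ≠ y' → τ = swap x y' * σ → f x = s₃ → f y' = s₃ → g' x = s₁ →
        ∃ x : {x // f x = s₃}, (⟨(swap x.1 (y x.1) * σ, g x.1), hstep x⟩ :
          {y : Perm (Fin d) × (Fin d → S) // D.IsStep k σ f y.1 y.2}) = ⟨(τ, g'), hst⟩ := by
      intro x y' hxy hτ hfx hfy' hgx
      obtain ⟨j, hj, hjy, hmin⟩ := exists_first_pow' ((h.eq_iff x y').1 (hfx.trans hfy'.symm))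
      have hjw : j = D.w s₁ := by
        rw [← hgx, ← hst.coloring.card_sameCycle x, hτ]
        exact (card_sameCycle_of_iff (fun i h1 h2 => (hmin i h1 h2).1)
          (sameCycle_swap_mul_of_pow hj hjy hmin)).symm
      have hyy : y x = y' := by simp only [hy]; rw [← hjw, hjy]
      refine ⟨⟨x, hfx⟩, Subtype.ext (Prod.ext ?_ (funext fun z => ?_))⟩
      · simp only
        rw [hyy, hτ]
      · simp only [hg]
        rw [hyy, ← hτ]
        split_ifs with h1 h2
        · rw [← hgx]
          exact (hst.coloring.eq_iff x z).2 h2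
        · refine (((ha _).1 (hst.born z h1)).resolve_left fun h3 => h2 ?_).symm
          rw [← hst.coloring.eq_iff, h3, hgx]
        · exact (hst.persist z h1).symm
    obtain ⟨x, y', hxy, hτ, hb', ha', hiff⟩ := hst.exists_swap h hD
    have hfx : f x = s₃ := (hb _).1 ((hb' _).2 (Or.inl rfl))
    have hfy' : f y' = s₃ := (hb _).1 ((hb' _).2 (Or.inr rfl))
    rcases (ha' s₁).1 ((ha _).2 (Or.inl rfl)) with h1 | h1
    · exact hmain x y' hxy hτ hfx hfy' h1.symm
    · exact hmain y' x hxy.symm (by rw [hτ, swap_comm]) hfy' hfx h1.symm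

variable [Fintype S]

/-- At a trivalent branch point, either two strands join or one strand splits. -/
theorem IsTrivalent.cases (hD : D.IsTrivalent n) (hk : k < n) : ∃ s₁ s₂ s₃, s₁ ≠ s₂ ∧
    D.w s₃ = D.w s₁ + D.w s₂ ∧
    (((∀ s, D.b s = k + 1 ↔ s = s₁ ∨ s = s₂) ∧ (∀ s, D.a s = k + 1 ↔ s = s₃)) ∨
      ((∀ s, D.b s = k + 1 ↔ s = s₃) ∧ (∀ s, D.a s = k + 1 ↔ s = s₁ ∨ s = s₂))) := by
  classical
  have h1 := hD.card_eq k hk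
  have h2 := hD.balanced k hk
  have hpos : ∀ A : Finset S, ∑ s ∈ A, D.w s = 0 → A = ∅ := by
    intro A hA
    by_contra hne
    obtain ⟨s, hs⟩ := nonempty_iff_ne_empty.2 hne
    have := sum_eq_zero_iff.1 hA s hs
    have := hD.w_pos s
    omega
  generalize hB : ({s | D.b s = k + 1} : Finset S) = B at h1 h2
  generalize hA : ({s | D.a s = k + 1} : Finset S) = A at h1 h2
  have hB' : ∀ s, D.b s = k + 1 ↔ s ∈ B := by intro s; rw [← hB]; simp
  have hA' : ∀ s, D.a s = k + 1 ↔ s ∈ A := by intro s; rw [← hA]; simp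
  have hcases : #B = 0 ∨ #B = 1 ∨ #B = 2 ∨ #B = 3 := by omega
  rcases hcases with h | h | h | h
  · rw [card_eq_zero] at h
    rw [h, sum_empty] at h2
    rw [h, hpos A h2.symm] at h1
    simp at h1
  · obtain ⟨s₃, rfl⟩ := card_eq_one.1 h
    obtain ⟨s₁, s₂, hne, rfl⟩ := card_eq_two.1 (show #A = 2 by omega)
    rw [sum_singleton, sum_pair hne] at h2
    exact ⟨s₁, s₂, s₃, hne, h2, Or.inr ⟨by simpa using hB', by simpa using hA'⟩⟩
  · obtain ⟨s₁, s₂, hne, rfl⟩ := card_eq_two.1 h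
    obtain ⟨s₃, rfl⟩ := card_eq_one.1 (show #A = 1 by omega)
    rw [sum_singleton, sum_pair hne] at h2
    exact ⟨s₁, s₂, s₃, hne, h2.symm, Or.inl ⟨by simpa using hB', by simpa using hA'⟩⟩
  · have h' : A = ∅ := by rw [← card_eq_zero]; omega
    rw [h', sum_empty] at h2
    rw [h', hpos B h2] at h1
    simp at h1

/-- The number of ways to continue a colored permutation through a branch point. -/
theorem IsTrivalent.card_isStep (hD : D.IsTrivalent n) (hk : k < n) (h : D.IsColoring k σ f) :
    Nat.card {y : Perm (Fin d) × (Fin d → S) // D.IsStep k σ f y.1 y.2} =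
      ∏ s with D.b s = k + 1, D.w s := by
  classical
  obtain ⟨s₁, s₂, s₃, hne, hw, ⟨hb, ha⟩ | ⟨hb, ha⟩⟩ := hD.cases hk
  · rw [h.card_isStep_of_join hD.toIsTimed hne hw hb ha, ← prod_pair hne]
    congr 1
    ext s
    simp [hb]
  · rw [h.card_isStep_of_cut hD.toIsTimed hne hw (hD.w_pos _) (hD.w_pos _) hb ha,
      ← prod_singleton D.w s₃]
    congr 1
    ext s
    simp [hb]

end Diagram

end TropicalHurwitz

namespace TropicalHurwitz

/-! ### The number of covers of a trivalent diagram -/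

open Equiv Equiv.Perm Finset

namespace Diagram

variable {S : Type} {D : Diagram S} {d n : ℕ}

/-- The permutation that moves every point of a family of cyclic groups to its successor. -/
def rotation {A : Type*} {m : A → ℕ} (e : (Σ s, ZMod (m s)) ≃ Fin d) : Perm (Fin d) :=
  (e.symm.trans (Equiv.sigmaCongrRight fun s => Equiv.addRight (1 : ZMod (m s)))).trans e

theorem rotation_pow {A : Type*} {m : A → ℕ} (e : (Σ s, ZMod (m s)) ≃ Fin d) (s : A)
    (z : ZMod (m s)) (i : ℕ) : (rotation e ^ i) (e ⟨s, z⟩) = e ⟨s, z + i⟩ := by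
  induction i with
  | zero => simp
  | succ i ih =>
    rw [pow_succ', Perm.mul_apply, ih]
    simp [rotation, add_assoc]

variable (D) in
/-- The left ends of a diagram. -/
abbrev LeftEnd : Type := {s : S // D.a s = 0}

/-- If the cyclic groups are indexed by the left ends and have their weights as orders, then the
assignment of each point to its left end is a coloring at time `0`. -/
theorem isColoring_rotation (hD : D.IsTimed n) (hpos : ∀ s, 0 < D.w s)
    (e : (Σ s : D.LeftEnd, ZMod (D.w s.1)) ≃ Fin d) :
    D.IsColoring 0 (rotation e) (fun x => (e.symm x).1.1) where
  eq_iff x y := by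
    obtain ⟨⟨s, z⟩, rfl⟩ := e.surjective x
    obtain ⟨⟨s', z'⟩, rfl⟩ := e.surjective y
    simp only [symm_apply_apply]
    constructor
    · intro he
      obtain rfl : s = s' := Subtype.ext he
      have : NeZero (D.w s.1) := ⟨(hpos _).ne'⟩
      refine ⟨(z' - z).val, ?_⟩
      rw [zpow_natCast, rotation_pow, ZMod.natCast_val, ZMod.cast_id, add_sub_cancel]
    · intro he
      obtain ⟨i, hi⟩ := he.exists_nat_pow_eq
      rw [rotation_pow, e.injective.eq_iff] at hi
      exact congrArg Subtype.val (Sigma.ext_iff.1 hi).1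
  exists_iff s := by
    constructor
    · rintro ⟨x, rfl⟩
      have := (e.symm x).1.2
      have := hD.lt (e.symm x).1.1
      exact ⟨by omega, by omega⟩
    · rintro ⟨h1, -⟩
      exact ⟨e ⟨⟨s, Nat.le_zero.1 h1⟩, 0⟩, by simp⟩
  card_fiber x := by
    obtain ⟨⟨s, z⟩, rfl⟩ := e.surjective x
    simp only [symm_apply_apply]
    conv_rhs => rw [← Nat.card_zmod (D.w s.1)]
    symm
    refine Nat.card_eq_of_bijective (fun z' => ⟨e ⟨s, z'⟩, by simp⟩)
      ⟨fun z' z'' h => ?_, fun ⟨y, hy⟩ => ?_⟩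
    · have := e.injective (Subtype.ext_iff.1 h)
      exact eq_of_heq (Sigma.ext_iff.1 this).2
    · obtain ⟨⟨s', z'⟩, rfl⟩ := e.surjective y
      simp only [symm_apply_apply] at hy
      obtain rfl : s' = s := Subtype.ext hy
      exact ⟨z', rfl⟩

variable [Fintype S]

/-- The initial colored permutations together with a point on each cycle correspond to the
arrangements of the cyclic groups of the left ends. -/
theorem card_isColoring_zero (hD : D.IsTimed n) (hpos : ∀ s, 0 < D.w s)
    (hsum : ∑ s with D.a s = 0, D.w s = d) :
    Nat.card {y : Perm (Fin d) × (Fin d → S) // D.IsColoring 0 y.1 y.2} *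
      ∏ s with D.a s = 0, D.w s = d.factorial := by
  classical
  have hne : ∀ s, NeZero (D.w s) := fun s => ⟨(hpos s).ne'⟩
  have hcard : Fintype.card (Σ s : D.LeftEnd, ZMod (D.w s.1)) = d := by
    rw [Fintype.card_sigma]
    simp only [ZMod.card]
    rw [← hsum]
    exact (sum_subtype _ (by simp) _).symm
  have hequiv : Nat.card ((Σ s : D.LeftEnd, ZMod (D.w s.1)) ≃ Fin d) = d.factorial := by
    rw [Nat.card_eq_fintype_card, Fintype.card_equiv (Fintype.equivFinOfCardEq hcard), hcard]
  have hbase : ∀ c : {y : Perm (Fin d) × (Fin d → S) // D.IsColoring 0 y.1 y.2},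
      Nat.card (∀ s : D.LeftEnd, {x // c.1.2 x = s.1}) = ∏ s with D.a s = 0, D.w s := by
    intro c
    rw [Nat.card_pi, prod_subtype (p := fun s => D.a s = 0) _ (by simp)]
    refine prod_congr rfl fun s _ => ?_
    have hlt := hD.lt s.1
    obtain ⟨x, hx⟩ := (c.2.exists_iff s.1).2 ⟨s.2.le, by omega⟩
    rw [← hx]
    exact c.2.card_fiber x
  rw [← card_sigma_of_card_eq hbase, ← hequiv]
  symm
  refine Nat.card_eq_of_bijective (fun e => ⟨⟨(rotation e, fun x => (e.symm x).1.1),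
    isColoring_rotation hD hpos e⟩, fun s => ⟨e ⟨s, 0⟩, by simp⟩⟩) ⟨fun e e' h => ?_, ?_⟩
  · obtain ⟨h1, h2⟩ := Sigma.ext_iff.1 h
    have hrot : rotation e = rotation e' := (Prod.ext_iff.1 (Subtype.ext_iff.1 h1)).1
    have hcol : (fun x => (e.symm x).1.1) = fun x => (e'.symm x).1.1 :=
      (Prod.ext_iff.1 (Subtype.ext_iff.1 h1)).2
    have hpt : ∀ s, e ⟨s, 0⟩ = e' ⟨s, 0⟩ := by
      intro s
      simp only at h2
      have hT : ∀ c c' : {y : Perm (Fin d) × (Fin d → S) // D.IsColoring 0 y.1 y.2}, c = c' →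
          ∀ (b : ∀ s : D.LeftEnd, {x // c.1.2 x = s.1}) (b' : ∀ s : D.LeftEnd,
            {x // c'.1.2 x = s.1}), HEq b b' → (b s).1 = (b' s).1 := by
        rintro c c' rfl b b' hb
        rw [eq_of_heq hb]
      exact hT _ _ h1 _ _ h2
    refine Equiv.ext fun ⟨s, z⟩ => ?_
    have h3 := rotation_pow e s 0 z.val
    have h4 := rotation_pow e' s 0 z.val
    rw [ZMod.natCast_val, ZMod.cast_id, zero_add] at h3 h4
    rw [← h3, ← h4, hrot, hpt]
  · rintro ⟨⟨⟨σ, f⟩, hc⟩, b⟩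
    simp only at hc b
    have hw : ∀ s : D.LeftEnd, (σ ^ D.w s.1) (b s).1 = (b s).1 := by
      intro s
      have := (hc.pow_w (b s).1).1
      rwa [(b s).2] at this
    set g : (Σ s : D.LeftEnd, ZMod (D.w s.1)) → Fin d := fun p => (σ ^ p.2.val) (b p.1).1 with hg
    have hfg : ∀ p, f (g p) = p.1.1 := by
      intro p
      rw [← (b p.1).2, hc.eq_iff]
      exact SameCycle.symm ⟨p.2.val, by rw [zpow_natCast]⟩
    have hmod : ∀ (s : D.LeftEnd) (m : ℕ), g ⟨s, (m : ZMod (D.w s.1))⟩ = (σ ^ m) (b s).1 := by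
      intro s m
      simp only [hg, ZMod.val_natCast]
      conv_rhs => rw [← Nat.mod_add_div m (D.w s.1), pow_add, pow_mul, Perm.mul_apply,
        pow_apply_eq_self_of_apply_eq_self (hw s)]
    have hsurj : Function.Surjective g := by
      intro x
      have ha := Nat.le_zero.1 (hc.alive x).1
      have h1 := (hc.eq_iff _ x).1 (b ⟨f x, ha⟩).2
      obtain ⟨i, hi⟩ := h1.exists_nat_pow_eq
      exact ⟨⟨⟨f x, ha⟩, (i : ZMod (D.w (f x)))⟩, by rw [hmod, hi]⟩
    have hbij : Function.Bijective g :=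
      (Fintype.bijective_iff_surjective_and_card g).2 ⟨hsurj, by rw [hcard, Fintype.card_fin]⟩
    refine ⟨Equiv.ofBijective g hbij, ?_⟩
    have h1 : rotation (Equiv.ofBijective g hbij) = σ := by
      refine Equiv.ext fun x => ?_
      obtain ⟨⟨s, z⟩, rfl⟩ := (Equiv.ofBijective g hbij).surjective x
      have := rotation_pow (Equiv.ofBijective g hbij) s z 1
      rw [pow_one] at this
      rw [this, ofBijective_apply, ofBijective_apply]
      have h2 := hmod s (z.val + 1)
      rw [Nat.cast_add, ZMod.natCast_val, ZMod.cast_id] at h2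
      rw [h2, pow_succ', Perm.mul_apply]
    have h2 : (fun x => ((Equiv.ofBijective g hbij).symm x).1.1) = f := by
      funext x
      obtain ⟨p, rfl⟩ := (Equiv.ofBijective g hbij).surjective x
      rw [symm_apply_apply, ofBijective_apply, hfg]
    have h3 : ∀ s, Equiv.ofBijective g hbij ⟨s, 0⟩ = (b s).1 := by
      intro s
      have := hmod s 0
      rw [Nat.cast_zero] at this
      rw [ofBijective_apply, this, pow_zero, Perm.one_apply]
    have hT : ∀ c c' : {y : Perm (Fin d) × (Fin d → S) // D.IsColoring 0 y.1 y.2}, c = c' →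
        ∀ (b : ∀ s : D.LeftEnd, {x // c.1.2 x = s.1}) (b' : ∀ s : D.LeftEnd,
          {x // c'.1.2 x = s.1}), (∀ s, (b s).1 = (b' s).1) → HEq b b' := by
      rintro c c' rfl b b' hb
      exact heq_of_eq (funext fun s => Subtype.ext (hb s))
    have h4 : (⟨(rotation (Equiv.ofBijective g hbij),
        fun x => ((Equiv.ofBijective g hbij).symm x).1.1), isColoring_rotation hD hpos _⟩ :
        {y : Perm (Fin d) × (Fin d → S) // D.IsColoring 0 y.1 y.2}) = ⟨(σ, f), hc⟩ :=
      Subtype.ext (Prod.ext h1 h2)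
    exact Sigma.ext h4 (hT _ _ h4 _ _ h3)

variable (D n d) in
/-- The colored sequences of permutations of `Fin d`; the times after `n` carry no information. -/
abbrev Cover : Type := {p : ℕ → Perm (Fin d) × (Fin d → S) //
  D.IsCover n (fun k => (p k).1) (fun k => (p k).2) ∧ ∀ k, n ≤ k → p k = p n}

/-- The weights of the strands that end at some branch point are those of the left ends and those of
the bounded strands. -/
theorem IsTrivalent.prod_w (hD : D.IsTrivalent n) :
    ∏ k ∈ range n, ∏ s with D.b s = k + 1, D.w s =
      (∏ s with D.a s = 0, D.w s) * ∏ s with 0 < D.a s ∧ D.b s ≤ n, D.w s := by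
  classical
  have h1 : ∏ k ∈ range n, ∏ s with D.b s = k + 1, D.w s = ∏ s with D.b s ≤ n, D.w s := by
    rw [← prod_fiberwise_of_maps_to (s := {s | D.b s ≤ n}) (t := range n)
      (g := fun s => D.b s - 1)]
    · refine prod_congr rfl fun k hk => prod_congr ?_ fun _ _ => rfl
      ext s
      have := hD.lt s
      rw [mem_range] at hk
      simp only [mem_filter, mem_univ, true_and]
      omega
    · intro s hs
      have := hD.lt s
      simp only [mem_filter, mem_univ, true_and] at hs
      rw [mem_range]
      omega
  rw [h1, ← prod_filter_mul_prod_filter_not {s | D.b s ≤ n} (fun s => D.a s = 0), filter_filter,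
    filter_filter]
  congr 1
  · refine prod_congr ?_ fun _ _ => rfl
    ext s
    simp only [mem_filter, mem_univ, true_and]
    exact ⟨fun h => h.2, fun h => ⟨hD.no_line s h, h⟩⟩
  · refine prod_congr ?_ fun _ _ => rfl
    ext s
    simp only [mem_filter, mem_univ, true_and]
    omega

/-- The number of covers of a trivalent diagram. -/
theorem IsTrivalent.card_cover (hD : D.IsTrivalent n) (hsum : ∑ s with D.a s = 0, D.w s = d) :
    Nat.card (D.Cover d n) = d.factorial * ∏ s with 0 < D.a s ∧ D.b s ≤ n, D.w s := by
  have h1 := card_path (Y := Perm (Fin d) × (Fin d → S))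
    (G := fun k y => D.IsColoring k y.1 y.2) (R := fun k y y' => D.IsStep k y.1 y.2 y'.1 y'.2)
    (m := fun k => ∏ s with D.b s = k + 1, D.w s) (fun k y y' h => h.coloring) n
    (fun k hk y hy => hD.card_isStep hk hy)
  rw [hD.prod_w, ← mul_assoc, card_isColoring_zero hD.toIsTimed hD.w_pos hsum] at h1
  rw [← h1]
  refine Nat.card_congr (Equiv.subtypeEquivRight fun p => ?_)
  exact ⟨fun h => ⟨h.1.zero, h.1.step, h.2⟩, fun h => ⟨⟨h.1, h.2.1⟩, h.2.2⟩⟩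

end Diagram

end TropicalHurwitz

namespace TropicalHurwitz

/-! ### The multiplicity of a type without edges of weight zero -/

namespace CombType

open Finset

variable {g : ℕ} {Δ : Multiset ℤ} (α : CombType g Δ)

/-- The differences of a function on the vertices along the edges. -/
def grad : (α.V → ℤ) →ₗ[ℤ] (α.E → ℤ) where
  toFun h e := h (α.tgt e) - h (α.src e)
  map_add' a b := by funext e; simp only [Pi.add_apply]; ring
  map_smul' c a := by funext e; simp only [Pi.smul_apply, smul_eq_mul, RingHom.id_apply]; ring

open scoped Classical in
/-- The boundary of a chain, oriented such that an edge has its source as the positive part. -/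
def boundary : (α.E → ℤ) →ₗ[ℤ] (α.V → ℤ) where
  toFun c v := ∑ e with α.src e = v, c e - ∑ e with α.tgt e = v, c e
  map_add' a b := by funext v; simp only [Pi.add_apply, sum_add_distrib]; ring
  map_smul' c a := by
    funext v
    simp only [Pi.smul_apply, smul_eq_mul, ← mul_sum, RingHom.id_apply]
    ring

theorem mem_cycles_iff (c : α.E → ℤ) : c ∈ α.cycles ↔ α.boundary c = 0 := by
  rw [funext_iff]
  exact forall_congr' fun v => sub_eq_zero.symm

theorem boundary_single [DecidableEq α.E] [DecidableEq α.V] (e : α.E) :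
    α.boundary (Pi.single e 1) = Pi.single (α.src e) 1 - Pi.single (α.tgt e) 1 := by
  classical
  funext v
  simp only [boundary, LinearMap.coe_mk, AddHom.coe_mk, Pi.sub_apply, Pi.single_apply]
  simp only [sum_filter, ← ite_and]
  congr 1
  · rw [sum_eq_single e (fun b _ hb => by simp [hb]) (by simp)]
    simp [eq_comm]
  · rw [sum_eq_single e (fun b _ hb => by simp [hb]) (by simp)]
    simp [eq_comm]

/-- The pairing of the functions on the edges with the cycles. -/
def cyclePairing : (α.E → ℤ) →ₗ[ℤ] (α.cycles →ₗ[ℤ] ℤ) :=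
  LinearMap.mk₂ ℤ (fun f c => ∑ e, c.1 e * f e)
    (by intro a b c; simp only [Pi.add_apply, mul_add, sum_add_distrib])
    (by
      intro a b c
      simp only [Pi.smul_apply, smul_eq_mul, mul_sum]
      exact sum_congr rfl fun e _ => by ring)
    (by intro a b c; simp only [Submodule.coe_add, Pi.add_apply, add_mul, sum_add_distrib])
    (by
      intro a b c
      simp only [Submodule.coe_smul, Pi.smul_apply, smul_eq_mul, mul_sum]
      exact sum_congr rfl fun e _ => by ring)

theorem cyclePairing_apply (f : α.E → ℤ) (c : α.cycles) :
    α.cyclePairing f c = ∑ e, c.1 e * f e := rfl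

theorem loopMap_eq (l : α.E → ℤ) : α.loopMap l = α.cyclePairing fun e => α.wt e * l e := rfl

theorem sum_mul_grad (c : α.E → ℤ) (h : α.V → ℤ) :
    ∑ e, c e * α.grad h e = - ∑ v, α.boundary c v * h v := by
  classical
  have key : ∀ t : α.E → α.V, ∑ v, (∑ e with t e = v, c e) * h v = ∑ e, c e * h (t e) := by
    intro t
    simp only [sum_mul, sum_filter, ite_mul, zero_mul]
    rw [sum_comm]
    refine sum_congr rfl fun e _ => ?_
    rw [sum_ite_eq]
    simp
  have h1 : ∑ v, α.boundary c v * h v = ∑ e, c e * h (α.src e) - ∑ e, c e * h (α.tgt e) := by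
    rw [← key, ← key, ← sum_sub_distrib]
    exact sum_congr rfl fun v _ => sub_mul _ _ _
  rw [h1, neg_sub, ← sum_sub_distrib]
  exact sum_congr rfl fun e _ => mul_sub _ _ _

/-- Since the graph is connected, the difference of any two vertices is a boundary. -/
theorem exists_boundary_eq [DecidableEq α.V] (u v : α.V) :
    ∃ c, α.boundary c = Pi.single u 1 - Pi.single v 1 := by
  classical
  induction α.connected u v with
  | rel a b h =>
    obtain ⟨e, rfl, rfl⟩ := h
    exact ⟨_, α.boundary_single e⟩
  | refl a => exact ⟨0, by simp⟩
  | symm a b _ ih =>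
    obtain ⟨c, hc⟩ := ih
    exact ⟨-c, by rw [map_neg, hc, neg_sub]⟩
  | trans a b c _ _ ih ih' =>
    obtain ⟨x, hx⟩ := ih
    obtain ⟨y, hy⟩ := ih'
    exact ⟨x + y, by rw [map_add, hx, hy, sub_add_sub_cancel]⟩

/-- A function on the edges is a gradient if and only if it vanishes on all cycles. -/
theorem cyclePairing_eq_zero_iff (f : α.E → ℤ) :
    α.cyclePairing f = 0 ↔ ∃ h, f = α.grad h := by
  classical
  constructor
  · intro hf
    have hf' : ∀ c, α.boundary c = 0 → ∑ e, c e * f e = 0 := fun c hc =>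
      LinearMap.congr_fun hf ⟨c, (α.mem_cycles_iff c).2 hc⟩
    obtain ⟨v₀⟩ := α.nonemptyV
    -- integrate along chains from a base point
    choose c hc using α.exists_boundary_eq v₀
    refine ⟨fun v => ∑ e, c v e * f e, funext fun e => ?_⟩
    have h1 := hf' (c (α.src e) + Pi.single e 1 - c (α.tgt e)) (by
      rw [map_sub, map_add, hc, hc, α.boundary_single]
      abel)
    have h2 : ∑ e', (Pi.single e 1 : α.E → ℤ) e' * f e' = f e := by
      simp [Pi.single_apply]
    simp only [Pi.sub_apply, Pi.add_apply, sub_mul, add_mul, sum_sub_distrib, sum_add_distrib,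
      h2] at h1
    simp only [grad, LinearMap.coe_mk, AddHom.coe_mk]
    linarith
  · rintro ⟨h, rfl⟩
    refine LinearMap.ext fun c => ?_
    rw [cyclePairing_apply, sum_mul_grad, (α.mem_cycles_iff c.1).1 c.2]
    simp

/-- The cycles are a direct summand, since the boundaries form a free module. Hence every functional
on them is given by a function on the edges. -/
theorem cyclePairing_surjective : Function.Surjective α.cyclePairing := by
  classical
  intro φ
  obtain ⟨s, hs⟩ := Module.projective_lifting_property α.boundary.rangeRestrict LinearMap.id
    α.boundary.surjective_rangeRestrict
  have hs' : ∀ x, α.boundary (s x) = x.1 := fun x => congrArg Subtype.val (LinearMap.congr_fun hs x)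
  have hmem : ∀ f, f - s (α.boundary.rangeRestrict f) ∈ α.cycles := by
    intro f
    rw [mem_cycles_iff, map_sub, hs']
    exact sub_self _
  set p : (α.E → ℤ) →ₗ[ℤ] α.cycles :=
    (LinearMap.id - s ∘ₗ α.boundary.rangeRestrict).codRestrict α.cycles hmem with hp
  have hpc : ∀ c : α.cycles, p c.1 = c := by
    intro c
    refine Subtype.ext ?_
    have h1 : α.boundary.rangeRestrict c.1 = 0 := Subtype.ext ((α.mem_cycles_iff c.1).1 c.2)
    change c.1 - s (α.boundary.rangeRestrict c.1) = c.1
    rw [h1, map_zero, sub_zero]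
  refine ⟨fun e => φ (p (Pi.single e 1)), LinearMap.ext fun c => ?_⟩
  rw [cyclePairing_apply]
  conv_rhs => rw [← hpc c]
  have h2 : c.1 = ∑ e, c.1 e • (Pi.single e 1 : α.E → ℤ) := by
    funext e'
    simp [Finset.sum_apply, Pi.single_apply]
  conv_rhs => rw [h2, map_sum, map_sum]
  exact sum_congr rfl fun e _ => by rw [map_smul, map_smul, smul_eq_mul]

/-- The differences along the edges modulo the weights. -/
def gradMod : (α.V → ℤ) →+ ∀ e, ZMod (α.wt e) where
  toFun h e := ((α.grad h e : ℤ) : ZMod (α.wt e))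
  map_zero' := by funext e; simp
  map_add' a b := by funext e; simp

/-- The index of the loop equations is the index of the image of `gradMod`: both count the functions
on the edges modulo the gradients and the multiples of the weights. -/
theorem loopIndex_eq : α.loopIndex = α.gradMod.range.index := by
  set red : (α.E → ℤ) →+ ∀ e, ZMod (α.wt e) :=
    { toFun := fun f e => (f e : ZMod (α.wt e))
      map_zero' := by funext e; simp
      map_add' := by intro a b; funext e; simp } with hred
  have hsurj : Function.Surjective red := by
    intro x
    exact ⟨fun e => (ZMod.intCast_surjective (x e)).choose,
      funext fun e => (ZMod.intCast_surjective (x e)).choose_spec⟩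
  rw [← AddSubgroup.index_comap_of_surjective _ hsurj, loopIndex,
    ← AddSubgroup.index_comap_of_surjective (f := α.cyclePairing.toAddMonoidHom) _
      α.cyclePairing_surjective]
  congr 1
  ext f
  simp only [AddSubgroup.mem_comap, Submodule.mem_toAddSubgroup, LinearMap.mem_range,
    AddMonoidHom.mem_range, LinearMap.toAddMonoidHom_coe]
  constructor
  · rintro ⟨l, hl⟩
    rw [loopMap_eq, ← sub_eq_zero, ← map_sub, cyclePairing_eq_zero_iff] at hl
    obtain ⟨h, hh⟩ := hl
    refine ⟨-h, funext fun e => ?_⟩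
    have := congrFun hh e
    simp only [Pi.sub_apply] at this
    change ((α.grad (-h) e : ℤ) : ZMod (α.wt e)) = (f e : ZMod (α.wt e))
    rw [map_neg, Pi.neg_apply, ← this]
    simp
  · rintro ⟨h, hh⟩
    have h1 : ∀ e, ∃ l, f e - α.grad h e = α.wt e * l := by
      intro e
      have := congrFun hh e
      change ((α.grad h e : ℤ) : ZMod (α.wt e)) = (f e : ZMod (α.wt e)) at this
      rw [ZMod.intCast_eq_intCast_iff_dvd_sub] at this
      exact this
    choose l hl using h1
    refine ⟨l, ?_⟩
    rw [loopMap_eq, ← sub_eq_zero, ← map_sub, cyclePairing_eq_zero_iff]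
    refine ⟨-h, funext fun e => ?_⟩
    rw [map_neg, Pi.neg_apply, Pi.sub_apply, ← hl]
    ring

theorem loopIndex_mul_index_ker : α.loopIndex * α.gradMod.ker.index = ∏ e, α.wt e := by
  rw [loopIndex_eq, AddSubgroup.index_ker, mul_comm, AddSubgroup.card_mul_index, Nat.card_pi]
  simp

theorem mem_ker_gradMod_iff (h : α.V → ℤ) :
    h ∈ α.gradMod.ker ↔ ∀ e, (α.wt e : ℤ) ∣ h (α.tgt e) - h (α.src e) := by
  rw [AddMonoidHom.mem_ker, funext_iff]
  exact forall_congr' fun e => ZMod.intCast_zmod_eq_zero_iff_dvd _ _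

variable {α}

/-- If no weight vanishes, then the lengths are determined by the positions, and an integral point
of the space of solutions is a function whose differences are divisible by the weights. -/
def solutionsEquiv (hwt : ∀ e, α.wt e ≠ 0) : α.solutions ℤ ≃+ α.gradMod.ker where
  toFun z := ⟨z.1.1, (α.mem_ker_gradMod_iff _).2 fun e => ⟨z.1.2 e, z.2 e⟩⟩
  invFun h := ⟨(h.1, fun e => (h.1 (α.tgt e) - h.1 (α.src e)) / α.wt e), fun e =>
    (Int.mul_ediv_cancel' ((α.mem_ker_gradMod_iff _).1 h.2 e)).symm⟩
  left_inv z := by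
    refine Subtype.ext (Prod.ext rfl (funext fun e => ?_))
    have h1 : (α.wt e : ℤ) ≠ 0 := by exact_mod_cast hwt e
    change (z.1.1 (α.tgt e) - z.1.1 (α.src e)) / (α.wt e : ℤ) = z.1.2 e
    rw [z.2 e]
    exact Int.mul_ediv_cancel_left _ h1
  right_inv h := rfl
  map_add' a b := rfl

/-- The determinant of the branch map is the index of the lattice of the positions of the integral
points. -/
theorem brDet_eq (hwt : ∀ e, α.wt e ≠ 0) (hl : Function.Bijective α.label) :
    α.brDet = α.gradMod.ker.index := by
  classical
  set ℓ : Fin (numLabels g Δ) ≃ α.V := Equiv.ofBijective _ hl with hℓ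
  have hfi : α.gradMod.ker.FiniteIndex := ⟨fun h => by
    have := α.loopIndex_mul_index_ker
    rw [h, mul_zero] at this
    exact prod_ne_zero_iff.2 (fun e _ => hwt e) this.symm⟩
  have hrank : Module.finrank ℤ α.gradMod.ker = numLabels g Δ := by
    rw [AddSubgroup.finrank_eq_of_finiteIndex, Module.finrank_fintype_fun_eq_card,
      ← Fintype.card_congr ℓ, Fintype.card_fin]
  have hne : Nonempty (Module.Basis (Fin (numLabels g Δ)) ℤ (α.solutions ℤ)) := by
    have hfree : Module.Free ℤ α.gradMod.ker.toIntSubmodule := inferInstance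
    have hfin : Module.Finite ℤ α.gradMod.ker.toIntSubmodule := inferInstance
    have b : Module.Basis (Fin (numLabels g Δ)) ℤ α.gradMod.ker.toIntSubmodule :=
      Module.finBasisOfFinrankEq ℤ _ hrank
    exact ⟨b.map (α.solutionsEquiv hwt).symm.toIntLinearEquiv⟩
  rw [brDet, dif_pos hne, AddSubgroup.index_eq_natAbs_det ((Pi.basisFun ℤ α.V).reindex ℓ.symm) _
    (hne.some.map (α.solutionsEquiv hwt).toIntLinearEquiv), Module.Basis.det_apply]
  congr 2

theorem loopIndex_mul_brDet (hwt : ∀ e, α.wt e ≠ 0) (hl : Function.Bijective α.label) :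
    α.loopIndex * α.brDet = ∏ e, α.wt e := by
  rw [brDet_eq hwt hl, loopIndex_mul_index_ker]

/-- If no weight vanishes, then the cell has one dimension for each vertex. -/
theorem dim_eq (hwt : ∀ e, α.wt e ≠ 0) : α.dim = Fintype.card α.V := by
  have e : α.solutions ℝ ≃ₗ[ℝ] (α.V → ℝ) :=
    { toFun := fun z => z.1.1
      map_add' := fun _ _ => rfl
      map_smul' := fun _ _ => rfl
      invFun := fun h => ⟨(h, fun e => (h (α.tgt e) - h (α.src e)) / α.wt e), fun e => by
        have h1 : (α.wt e : ℝ) ≠ 0 := by exact_mod_cast hwt e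
        exact (mul_div_cancel₀ _ h1).symm⟩
      left_inv := fun z => by
        refine Subtype.ext (Prod.ext rfl (funext fun e => ?_))
        have h1 : (α.wt e : ℝ) ≠ 0 := by exact_mod_cast hwt e
        change (z.1.1 (α.tgt e) - z.1.1 (α.src e)) / (α.wt e : ℝ) = z.1.2 e
        rw [z.2 e]
        exact mul_div_cancel_left₀ _ h1
      right_inv := fun _ => rfl }
  rw [dim, e.finrank_eq, Module.finrank_fintype_fun_eq_card]

end CombType

end TropicalHurwitz

namespace TropicalHurwitz

/-! ### The diagram of a tropical curve with distinct branch points -/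

open Finset

section Rank

variable {n : ℕ} (p : Fin n → ℝ)

/-- The number of coordinates of `p` below `x`. -/
def rank (x : ℝ) : ℕ := #{j | p j < x}

variable {p}

theorem rank_lt_rank_iff {i : Fin n} {x : ℝ} : rank p (p i) < rank p x ↔ p i < x := by
  constructor
  · intro h
    by_contra hx
    refine absurd h (not_lt.2 (card_le_card fun j hj => ?_))
    simp only [mem_filter, mem_univ, true_and] at hj ⊢
    exact lt_of_lt_of_le hj (not_lt.1 hx)
  · intro h
    refine card_lt_card (Finset.ssubset_iff_subset_ne.2 ⟨fun j hj => ?_, fun he => ?_⟩)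
    · simp only [mem_filter, mem_univ, true_and] at hj ⊢
      exact hj.trans h
    · have : i ∈ ({j | p j < x} : Finset (Fin n)) := by simpa using h
      rw [← he] at this
      simp at this

theorem rank_lt (i : Fin n) : rank p (p i) < n := by
  have : #{j | p j < p i} < #(univ : Finset (Fin n)) :=
    card_lt_card (Finset.ssubset_iff_subset_ne.2 ⟨subset_univ _, fun he => by
      have : i ∈ ({j | p j < p i} : Finset (Fin n)) := by rw [he]; exact mem_univ _
      simp at this⟩)
  simpa [rank] using this

theorem rank_injective (hp : Function.Injective p) {i j : Fin n}
    (h : rank p (p i) = rank p (p j)) : i = j := by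
  refine hp (le_antisymm ?_ ?_) <;> rw [← not_lt, ← rank_lt_rank_iff] <;> omega

theorem exists_rank_eq (hp : Function.Injective p) {k : ℕ} (hk : k < n) :
    ∃ i, rank p (p i) = k := by
  have : Function.Injective fun i => (⟨rank p (p i), rank_lt i⟩ : Fin n) := fun i j h =>
    rank_injective hp (Fin.mk.inj_iff.1 h)
  obtain ⟨i, hi⟩ := (Finite.injective_iff_surjective.1 this) ⟨k, hk⟩
  exact ⟨i, Fin.mk.inj_iff.1 hi⟩

end Rank

namespace TropCurve

variable {g : ℕ} {Δ : Multiset ℤ}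

/-- The labelled vertices of the curve lie at the coordinates of `p`. -/
def IsOver (C : TropCurve g Δ) (p : Fin (numLabels g Δ) → ℝ) : Prop :=
  ∀ i, C.pos (C.type.label i) = p i

variable {C C' : TropCurve g Δ} {p : Fin (numLabels g Δ) → ℝ}

theorem IsOver.label_injective (h : C.IsOver p) (hp : Function.Injective p) :
    Function.Injective C.type.label := by
  intro i j hij
  exact hp (by rw [← h, ← h, hij])

open scoped Classical in
/-- Vertices with at most one label are trivalent and have exactly one label. -/
theorem IsOver.valency (h : C.IsOver p) (hp : Function.Injective p) (v : C.type.V) :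
    (∃ i, C.type.label i = v) ∧
      #{e | C.type.src e = v} + #{e | C.type.tgt e = v} + #{l | C.type.base l = v} = 3 := by
  have h1 : Nat.card {i // C.type.label i = v} ≤ 1 := by
    have : Subsingleton {i // C.type.label i = v} :=
      ⟨fun a b => Subtype.ext (h.label_injective hp (a.2.trans b.2.symm))⟩
    exact Finite.card_le_one_iff_subsingleton.2 this
  have h2 := C.type.two_le_val v
  have h3 := C.type.label_of_val_two v
  obtain ⟨k, h4⟩ := C.type.label_count v
  have h5 : (∃ i, C.type.label i = v) ↔ 0 < Nat.card {i // C.type.label i = v} := by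
    rw [Nat.card_pos_iff]
    simp only [nonempty_subtype]
    exact ⟨fun h => ⟨h, inferInstance⟩, fun h => h.1⟩
  simp only [Nat.card_eq_fintype_card, Fintype.card_subtype] at h1 h2 h3 h4 h5
  rw [h5] at h3 ⊢
  constructor
  · by_contra hcon
    refine hcon (h3 ?_)
    omega
  · by_contra hcon
    have h6 : #{e | C.type.src e = v} + #{e | C.type.tgt e = v} + #{l | C.type.base l = v} = 2 := by
      omega
    have := h3 h6
    omega

theorem IsOver.label_bijective (h : C.IsOver p) (hp : Function.Injective p) :
    Function.Bijective C.type.label :=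
  ⟨h.label_injective hp, fun v => (h.valency hp v).1⟩

theorem IsOver.pos_injective (h : C.IsOver p) (hp : Function.Injective p) :
    Function.Injective C.pos := by
  intro u v huv
  obtain ⟨i, rfl⟩ := (h.valency hp u).1
  obtain ⟨j, rfl⟩ := (h.valency hp v).1
  rw [h, h] at huv
  rw [hp huv]

theorem dir_ne_zero (h0 : (0 : ℤ) ∉ Δ) (l : C.type.L) : C.type.dir l ≠ 0 := by
  intro hl
  refine h0 ?_
  rw [← C.type.dir_ends, Multiset.mem_map]
  exact ⟨l, mem_univ l, hl⟩

theorem pos_sub_pos (e : C.type.E) :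
    C.pos (C.type.tgt e) - C.pos (C.type.src e) = C.type.wt e * C.len e :=
  C.mem_cell.1 e

/-- An edge of weight zero would be a loop at a trivalent vertex, and then the third flag at this
vertex would have direction zero. -/
theorem IsOver.wt_ne_zero (h : C.IsOver p) (hp : Function.Injective p) (h0 : (0 : ℤ) ∉ Δ)
    (e : C.type.E) : C.type.wt e ≠ 0 := by
  classical
  have hloop : ∀ e, C.type.wt e = 0 → C.type.tgt e = C.type.src e := by
    intro e he
    refine h.pos_injective hp (sub_eq_zero.1 ?_)
    rw [pos_sub_pos, he, Nat.cast_zero, zero_mul]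
  intro he
  obtain ⟨v, hv⟩ : ∃ v, C.type.src e = v := ⟨_, rfl⟩
  have hval := (h.valency hp v).2
  have hbal := C.type.balanced v
  generalize hA : ({e | C.type.src e = v} : Finset C.type.E) = A at hval hbal
  generalize hB : ({e | C.type.tgt e = v} : Finset C.type.E) = B at hval hbal
  generalize hL : ({l | C.type.base l = v} : Finset C.type.L) = L at hval hbal
  have hA' : ∀ e, e ∈ A ↔ C.type.src e = v := fun e => by rw [← hA]; simp
  have hB' : ∀ e, e ∈ B ↔ C.type.tgt e = v := fun e => by rw [← hB]; simp
  have heA : e ∈ A := (hA' e).2 hv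
  have heB : e ∈ B := (hB' e).2 ((hloop e he).trans hv)
  have hA1 : 1 ≤ #A := card_pos.2 ⟨e, heA⟩
  have hB1 : 1 ≤ #B := card_pos.2 ⟨e, heB⟩
  have hsingle : ∀ {T : Finset C.type.E}, e ∈ T → #T = 1 → T = {e} := by
    intro T hT h1
    obtain ⟨x, rfl⟩ := card_eq_one.1 h1
    rw [mem_singleton.1 hT]
  have hpair : ∀ {T : Finset C.type.E}, e ∈ T → #T = 2 → ∃ x, x ≠ e ∧ T = {e, x} := by
    intro T hT h1
    obtain ⟨x, hx⟩ := card_eq_one.1 (show #(T.erase e) = 1 by rw [card_erase_of_mem hT, h1])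
    refine ⟨x, (mem_erase.1 (hx ▸ mem_singleton_self x : x ∈ T.erase e)).1, ?_⟩
    rw [← insert_erase hT, hx]
  rcases (by omega : #L = 1 ∧ #A = 1 ∧ #B = 1 ∨ #L = 0 ∧ #A = 2 ∧ #B = 1 ∨
    #L = 0 ∧ #A = 1 ∧ #B = 2) with ⟨h1, h2, h3⟩ | ⟨h1, h2, h3⟩ | ⟨h1, h2, h3⟩
  · obtain ⟨l, rfl⟩ := card_eq_one.1 h1
    rw [hsingle heA h2, hsingle heB h3] at hbal
    simp only [sum_singleton, sub_self, zero_add] at hbal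
    exact dir_ne_zero h0 l hbal
  · obtain ⟨x, hx, hAx⟩ := hpair heA h2
    have hBe := hsingle heB h3
    rw [card_eq_zero.1 h1, hAx, hBe, sum_pair hx.symm, he] at hbal
    simp [he] at hbal
    have : x ∈ B := (hB' x).2 ((hloop x hbal).trans ((hA' x).1 (by rw [hAx]; simp)))
    rw [hBe, mem_singleton] at this
    exact hx this
  · obtain ⟨x, hx, hBx⟩ := hpair heB h3
    have hAe := hsingle heA h2
    rw [card_eq_zero.1 h1, hBx, hAe, sum_pair hx.symm, he] at hbal
    simp [he] at hbal
    have : x ∈ A := (hA' x).2 ((hloop x hbal).symm.trans ((hB' x).1 (by rw [hBx]; simp)))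
    rw [hAe, mem_singleton] at this
    exact hx this

theorem IsOver.pos_lt (h : C.IsOver p) (hp : Function.Injective p) (h0 : (0 : ℤ) ∉ Δ)
    (e : C.type.E) : C.pos (C.type.src e) < C.pos (C.type.tgt e) := by
  have h1 := pos_sub_pos e
  have h2 := C.mem_cell.2 e
  have h3 : (0 : ℝ) < C.type.wt e := by
    exact_mod_cast Nat.pos_of_ne_zero (h.wt_ne_zero hp h0 e)
  have := mul_pos h3 h2
  simp only at this
  linarith

/-- Curves over a point with distinct coordinates have a regular type of top dimension. -/
theorem IsOver.isTop (h : C.IsOver p) (hp : Function.Injective p) (h0 : (0 : ℤ) ∉ Δ) :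
    C.type.IsTop := by
  have hdim := CombType.dim_eq (h.wt_ne_zero hp h0)
  refine ⟨⟨_, C.mem_cell⟩, ?_, ?_⟩
  · rw [CombType.IsRegular, hdim, CombType.genus]
    ring
  · rw [hdim, ← Fintype.card_congr (Equiv.ofBijective _ (h.label_bijective hp)), Fintype.card_fin]

/-- The edges and ends of a curve as strands between the branch points, which are numbered in the
order of their positions. -/
def diagram (C : TropCurve g Δ) (p : Fin (numLabels g Δ) → ℝ) :
    Diagram (C.type.E ⊕ C.type.L) where
  w := Sum.elim C.type.wt fun l => (C.type.dir l).natAbs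
  a := Sum.elim (fun e => rank p (C.pos (C.type.src e)) + 1)
    fun l => if C.type.dir l < 0 then 0 else rank p (C.pos (C.type.base l)) + 1
  b := Sum.elim (fun e => rank p (C.pos (C.type.tgt e)) + 1)
    fun l => if C.type.dir l < 0 then rank p (C.pos (C.type.base l)) + 1 else numLabels g Δ + 1

theorem IsOver.rank_lt (h : C.IsOver p) (hp : Function.Injective p) (v : C.type.V) :
    rank p (C.pos v) < numLabels g Δ := by
  obtain ⟨i, rfl⟩ := (h.valency hp v).1
  rw [h]
  exact TropicalHurwitz.rank_lt i

theorem IsOver.rank_inj (h : C.IsOver p) (hp : Function.Injective p) {u v : C.type.V} :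
    rank p (C.pos u) = rank p (C.pos v) ↔ u = v := by
  refine ⟨fun he => ?_, fun he => by rw [he]⟩
  obtain ⟨i, rfl⟩ := (h.valency hp u).1
  obtain ⟨j, rfl⟩ := (h.valency hp v).1
  rw [h, h] at he
  rw [rank_injective hp he]

theorem IsOver.exists_rank_eq (h : C.IsOver p) (hp : Function.Injective p) {k : ℕ}
    (hk : k < numLabels g Δ) : ∃ v, rank p (C.pos v) = k := by
  obtain ⟨i, hi⟩ := TropicalHurwitz.exists_rank_eq hp hk
  exact ⟨C.type.label i, by rw [h, hi]⟩

theorem IsOver.diagram_isTimed (h : C.IsOver p) (hp : Function.Injective p) (h0 : (0 : ℤ) ∉ Δ) :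
    (C.diagram p).IsTimed (numLabels g Δ) where
  lt s := by
    rcases s with e | l
    · have h1 := h.pos_lt hp h0 e
      obtain ⟨i, hi⟩ := (h.valency hp (C.type.src e)).1
      simp only [diagram, Sum.elim_inl]
      rw [← hi, h] at h1 ⊢
      exact Nat.succ_lt_succ (rank_lt_rank_iff.2 h1)
    · have := h.rank_lt hp (C.type.base l)
      simp only [diagram, Sum.elim_inr]
      split_ifs <;> omega
  le s := by
    rcases s with e | l
    · have := h.rank_lt hp (C.type.tgt e)
      simp only [diagram, Sum.elim_inl]
      omega
    · have := h.rank_lt hp (C.type.base l)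
      simp only [diagram, Sum.elim_inr]
      split_ifs <;> omega

open scoped Classical in
theorem IsOver.sum_dying (h : C.IsOver p) (hp : Function.Injective p) (v : C.type.V)
    (φ : C.type.E ⊕ C.type.L → ℕ) :
    ∑ s with (C.diagram p).b s = rank p (C.pos v) + 1, φ s =
      ∑ e with C.type.tgt e = v, φ (Sum.inl e) +
        ∑ l with C.type.base l = v ∧ C.type.dir l < 0, φ (Sum.inr l) := by
  have hlt := h.rank_lt hp v
  simp only [sum_filter, Fintype.sum_sum_type]
  congr 1
  · refine sum_congr rfl fun e _ => ?_
    refine if_congr ?_ rfl rfl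
    rw [← h.rank_inj hp]
    simp [diagram]
  · refine sum_congr rfl fun l _ => ?_
    refine if_congr ?_ rfl rfl
    rw [← h.rank_inj hp]
    simp only [diagram, Sum.elim_inr]
    split_ifs with hl
    · simp [hl]
    · simp only [hl, and_false, iff_false]
      omega

open scoped Classical in
theorem IsOver.sum_born (h : C.IsOver p) (hp : Function.Injective p) (v : C.type.V)
    (φ : C.type.E ⊕ C.type.L → ℕ) :
    ∑ s with (C.diagram p).a s = rank p (C.pos v) + 1, φ s =
      ∑ e with C.type.src e = v, φ (Sum.inl e) +
        ∑ l with C.type.base l = v ∧ ¬ C.type.dir l < 0, φ (Sum.inr l) := by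
  simp only [sum_filter, Fintype.sum_sum_type]
  congr 1
  · refine sum_congr rfl fun e _ => ?_
    refine if_congr ?_ rfl rfl
    rw [← h.rank_inj hp]
    simp [diagram]
  · refine sum_congr rfl fun l _ => ?_
    refine if_congr ?_ rfl rfl
    rw [← h.rank_inj hp]
    simp only [diagram, Sum.elim_inr]
    split_ifs with hl
    · simp [hl]
    · simp [hl]

/-- The strands at a branch point are the flags at the vertex there, those on the left having negative
directions. So the valency and the balancing condition give the two local conditions. -/
theorem IsOver.diagram_isTrivalent (h : C.IsOver p) (hp : Function.Injective p)
    (h0 : (0 : ℤ) ∉ Δ) : (C.diagram p).IsTrivalent (numLabels g Δ) where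
  toIsTimed := h.diagram_isTimed hp h0
  w_pos s := by
    rcases s with e | l
    · exact Nat.pos_of_ne_zero (h.wt_ne_zero hp h0 e)
    · exact Int.natAbs_pos.2 (dir_ne_zero h0 l)
  no_line s hs := by
    rcases s with e | l
    · simp [diagram] at hs
    · have := h.rank_lt hp (C.type.base l)
      simp only [diagram, Sum.elim_inr] at hs ⊢
      split_ifs at hs ⊢ with hl
      omega
  card_eq k hk := by
    classical
    obtain ⟨v, rfl⟩ := h.exists_rank_eq hp hk
    have h1 := (h.valency hp v).2
    simp only [card_eq_sum_ones]
    rw [h.sum_dying hp, h.sum_born hp]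
    simp only [← card_eq_sum_ones]
    have h2 := card_filter_add_card_filter_not
      (s := {l | C.type.base l = v}) (fun l => C.type.dir l < 0)
    rw [filter_filter, filter_filter] at h2
    omega
  balanced k hk := by
    classical
    obtain ⟨v, rfl⟩ := h.exists_rank_eq hp hk
    have h1 := C.type.balanced v
    rw [h.sum_dying hp, h.sum_born hp]
    have h2 := sum_filter_add_sum_filter_not {l | C.type.base l = v} (fun l => C.type.dir l < 0)
      C.type.dir
    rw [filter_filter, filter_filter] at h2
    have h3 : (∑ l with C.type.base l = v ∧ C.type.dir l < 0, ((C.type.dir l).natAbs : ℤ)) =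
        - ∑ l with C.type.base l = v ∧ C.type.dir l < 0, C.type.dir l := by
      rw [← sum_neg_distrib]
      refine sum_congr rfl fun l hl => ?_
      simp only [mem_filter] at hl
      omega
    have h4 : (∑ l with C.type.base l = v ∧ ¬ C.type.dir l < 0, ((C.type.dir l).natAbs : ℤ)) =
        ∑ l with C.type.base l = v ∧ ¬ C.type.dir l < 0, C.type.dir l := by
      refine sum_congr rfl fun l hl => ?_
      simp only [mem_filter] at hl
      omega
    simp only [diagram, Sum.elim_inl, Sum.elim_inr]
    zify
    simp only [Int.natCast_natAbs] at h3 h4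
    rw [h3, h4]
    linarith

theorem IsOver.diagram_isConnected (h : C.IsOver p) (hp : Function.Injective p) :
    (C.diagram p).IsConnected (numLabels g Δ) := by
  intro c hc
  have key : ∀ u v, c (rank p (C.pos u)) ↔ c (rank p (C.pos v)) := by
    intro u v
    induction C.type.connected u v with
    | rel a b hab =>
      obtain ⟨e, rfl, rfl⟩ := hab
      have h1 := h.rank_lt hp (C.type.tgt e)
      simpa [diagram] using hc (Sum.inl e) (by simp [diagram]) (by simpa [diagram] using h1)
    | refl a => rfl
    | symm a b _ ih => exact ih.symm
    | trans a b c _ _ ih ih' => exact ih.trans ih'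
  intro u hu v hv
  obtain ⟨x, rfl⟩ := h.exists_rank_eq hp hu
  obtain ⟨y, rfl⟩ := h.exists_rank_eq hp hv
  exact (key x y).1

theorem diagram_inl_iff (h : C.IsOver p) (hp : Function.Injective p) (s : C.type.E ⊕ C.type.L) :
    (0 < (C.diagram p).a s ∧ (C.diagram p).b s ≤ numLabels g Δ) ↔ ∃ e, Sum.inl e = s := by
  rcases s with e | l
  · have := h.rank_lt hp (C.type.tgt e)
    simp only [diagram, Sum.elim_inl, Sum.inl.injEq, exists_eq, iff_true]
    omega
  · simp only [diagram, Sum.elim_inr, reduceCtorEq, exists_false, iff_false]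
    split_ifs <;> omega

/-- The weights of the left ends. -/
theorem map_w_left (C : TropCurve g Δ) (p : Fin (numLabels g Δ) → ℝ) :
    ({s | (C.diagram p).a s = 0} : Finset (C.type.E ⊕ C.type.L)).val.map (C.diagram p).w =
      (Δ.filter (fun z => z < 0)).map Int.natAbs := by
  classical
  have h1 : ({s | (C.diagram p).a s = 0} : Finset (C.type.E ⊕ C.type.L)) =
      ({l | C.type.dir l < 0} : Finset C.type.L).map ⟨Sum.inr, Sum.inr_injective⟩ := by
    ext s
    rw [mem_filter]
    rcases s with e | l
    · simp [diagram]
    · simp [diagram]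
  rw [h1, map_val, Multiset.map_map]
  conv_rhs => rw [← C.type.dir_ends, Multiset.filter_map, Multiset.map_map]
  rfl

/-- The weights of the right ends. -/
theorem IsOver.map_w_right (h : C.IsOver p) (hp : Function.Injective p) (h0 : (0 : ℤ) ∉ Δ) :
    ({s | (C.diagram p).b s = numLabels g Δ + 1} : Finset (C.type.E ⊕ C.type.L)).val.map
      (C.diagram p).w = (Δ.filter (fun z => 0 < z)).map Int.natAbs := by
  classical
  have h1 : ({s | (C.diagram p).b s = numLabels g Δ + 1} : Finset (C.type.E ⊕ C.type.L)) =
      ({l | 0 < C.type.dir l} : Finset C.type.L).map ⟨Sum.inr, Sum.inr_injective⟩ := by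
    ext s
    rw [mem_filter]
    rcases s with e | l
    · have := h.rank_lt hp (C.type.tgt e)
      simp [diagram]
      omega
    · have := h.rank_lt hp (C.type.base l)
      have h2 := dir_ne_zero h0 l
      simp only [mem_univ, diagram, Sum.elim_inr, true_and, mem_map, mem_filter,
        Function.Embedding.coeFn_mk, Sum.inr.injEq, exists_eq_right]
      split_ifs <;> omega
  rw [h1, map_val, Multiset.map_map]
  conv_rhs => rw [← C.type.dir_ends, Multiset.filter_map, Multiset.map_map]
  rfl

end TropCurve

end TropicalHurwitz

namespace TropicalHurwitz

/-! ### Isomorphisms of tropical curves and of their diagrams -/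

open Finset

/-- A bijection of disjoint unions that preserves the two summands is a pair of bijections. -/
theorem exists_equiv_of_sum {A B A' B' : Type*} (φ : A ⊕ B ≃ A' ⊕ B')
    (h : ∀ s, (∃ a, Sum.inl a = φ s) ↔ ∃ a, Sum.inl a = s) :
    ∃ (f : A ≃ A') (g : B ≃ B'), (∀ a, φ (Sum.inl a) = Sum.inl (f a)) ∧
      ∀ b, φ (Sum.inr b) = Sum.inr (g b) := by
  have h1 : ∀ a, ∃ a', φ (Sum.inl a) = Sum.inl a' := fun a =>
    ((h _).2 ⟨a, rfl⟩).imp fun _ h => h.symm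
  have h2 : ∀ b, ∃ b', φ (Sum.inr b) = Sum.inr b' := by
    intro b
    rcases hb : φ (Sum.inr b) with a' | b'
    · obtain ⟨a, ha⟩ := (h (Sum.inr b)).1 ⟨a', hb.symm⟩
      cases ha
    · exact ⟨b', rfl⟩
  choose f hf using h1
  choose g hg using h2
  have hf' : Function.Bijective f := by
    constructor
    · intro a a' he
      have := φ.injective ((hf a).trans (by rw [he, hf a']))
      exact Sum.inl_injective this
    · intro a'
      obtain ⟨s, hs⟩ := φ.surjective (Sum.inl a')
      rcases s with a | b
      · exact ⟨a, Sum.inl_injective ((hf a).symm.trans hs)⟩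
      · rw [hg] at hs
        cases hs
  have hg' : Function.Bijective g := by
    constructor
    · intro b b' he
      have := φ.injective ((hg b).trans (by rw [he, hg b']))
      exact Sum.inr_injective this
    · intro b'
      obtain ⟨s, hs⟩ := φ.surjective (Sum.inr b')
      rcases s with a | b
      · rw [hf] at hs
        cases hs
      · exact ⟨b, Sum.inr_injective ((hg b).symm.trans hs)⟩
  exact ⟨Equiv.ofBijective f hf', Equiv.ofBijective g hg', hf, hg⟩

namespace TropCurve

variable {g : ℕ} {Δ : Multiset ℤ} {C C' : TropCurve g Δ} {p : Fin (numLabels g Δ) → ℝ}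

/-- Isomorphic curves have isomorphic diagrams. -/
theorem IsOver.exists_isIso (h : C.IsOver p) (hp : Function.Injective p) (h0 : (0 : ℤ) ∉ Δ)
    (hiso : C.Iso C') : ∃ φ, (C.diagram p).IsIso (C'.diagram p) φ := by
  obtain ⟨φV, φE, φL, ⟨-, h2, h3⟩, h4, -⟩ := hiso
  have hends : ∀ e, φV (C.type.src e) = C'.type.src (φE e) ∧
      φV (C.type.tgt e) = C'.type.tgt (φE e) := by
    intro e
    rcases (h2 e).2 with h5 | h5
    · exact h5
    · exact absurd h5.1 (h.wt_ne_zero hp h0 e)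
  refine ⟨Equiv.sumCongr φE φL, ⟨fun s => ?_, fun s => ?_, fun s => ?_⟩⟩
  · rcases s with e | l
    · simpa [diagram] using (h2 e).1
    · simp [diagram, (h3 l).2]
  · rcases s with e | l
    · simp [diagram, ← (hends e).1, h4]
    · simp [diagram, h3 l, h4]
  · rcases s with e | l
    · simp [diagram, ← (hends e).2, h4]
    · simp [diagram, h3 l, h4]

/-- Curves over `p` with isomorphic diagrams are isomorphic: the ranks determine the vertices and their
positions, and the positions of the end points of an edge of positive weight determine its length. -/
theorem IsOver.iso_of_isIso (h : C.IsOver p) (h' : C'.IsOver p) (hp : Function.Injective p)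
    (h0 : (0 : ℤ) ∉ Δ) {φ : C.type.E ⊕ C.type.L ≃ C'.type.E ⊕ C'.type.L}
    (hφ : (C.diagram p).IsIso (C'.diagram p) φ) : C.Iso C' := by
  obtain ⟨φE, φL, hE, hL⟩ := exists_equiv_of_sum φ (by
    intro s
    rw [← diagram_inl_iff h hp, ← diagram_inl_iff h' hp, hφ.a, hφ.b])
  set ℓ := Equiv.ofBijective _ (h.label_bijective hp) with hℓ
  set ℓ' := Equiv.ofBijective _ (h'.label_bijective hp) with hℓ'
  have hlab : ∀ i, (ℓ.symm.trans ℓ') (C.type.label i) = C'.type.label i := by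
    intro i
    have : ℓ.symm (C.type.label i) = i := ℓ.symm_apply_apply i
    rw [Equiv.trans_apply, this]
    rfl
  have hpos : ∀ v, C'.pos ((ℓ.symm.trans ℓ') v) = C.pos v := by
    intro v
    obtain ⟨i, rfl⟩ := (h.valency hp v).1
    rw [hlab, h, h']
  have hV : ∀ u u', rank p (C.pos u) = rank p (C'.pos u') → (ℓ.symm.trans ℓ') u = u' := by
    intro u u' hu
    rw [← h'.rank_inj hp, hpos, hu]
  have hsrc : ∀ e, (ℓ.symm.trans ℓ') (C.type.src e) = C'.type.src (φE e) := by
    intro e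
    have := hφ.a (Sum.inl e)
    rw [hE] at this
    simp only [diagram, Sum.elim_inl, Nat.add_right_cancel_iff] at this
    exact hV _ _ this.symm
  have htgt : ∀ e, (ℓ.symm.trans ℓ') (C.type.tgt e) = C'.type.tgt (φE e) := by
    intro e
    have := hφ.b (Sum.inl e)
    rw [hE] at this
    simp only [diagram, Sum.elim_inl, Nat.add_right_cancel_iff] at this
    exact hV _ _ this.symm
  have hwt : ∀ e, C'.type.wt (φE e) = C.type.wt e := by
    intro e
    have := hφ.w (Sum.inl e)
    rwa [hE] at this
  refine ⟨ℓ.symm.trans ℓ', φE, φL, ⟨hlab, fun e => ⟨hwt e, Or.inl ⟨hsrc e, htgt e⟩⟩, fun l => ?_⟩,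
    hpos, fun e => ?_⟩
  · have h1 := hφ.w (Sum.inr l)
    have h2 := hφ.a (Sum.inr l)
    have h3 := hφ.b (Sum.inr l)
    have h4 := h.rank_lt hp (C.type.base l)
    have h5 := h'.rank_lt hp (C'.type.base (φL l))
    rw [hL] at h1 h2 h3
    simp only [diagram, Sum.elim_inr] at h1 h2 h3
    have h6 : rank p (C.pos (C.type.base l)) = rank p (C'.pos (C'.type.base (φL l))) ∧
        C'.type.dir (φL l) = C.type.dir l := by
      split_ifs at h2 h3 <;> omega
    exact ⟨(hV _ _ h6.1).symm, h6.2⟩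
  · have h1 := pos_sub_pos (C := C) e
    have h2 := pos_sub_pos (C := C') (φE e)
    rw [← hsrc, ← htgt, hpos, hpos, h1, hwt] at h2
    have h3 : (C.type.wt e : ℝ) ≠ 0 := by exact_mod_cast h.wt_ne_zero hp h0 e
    exact (mul_left_cancel₀ h3 h2).symm

end TropCurve

/-! ### Automorphisms -/

namespace Diagram

variable {S : Type} {D : Diagram S} {n : ℕ}

variable (D) in
/-- The data of a strand that are preserved by isomorphisms. -/
def key (s : S) : ℕ × ℕ × ℕ := (D.w s, D.a s, D.b s)

variable (D) in
/-- The keys of pairs of different strands that can be exchanged. -/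
def pairKeys : Set (ℕ × ℕ × ℕ) := {i | ∃ s s', s ≠ s' ∧ D.key s = i ∧ D.key s' = i}

variable [Fintype S]

theorem pairKeys_finite : D.pairKeys.Finite :=
  (Set.finite_range D.key).subset fun _ ⟨s, _, _, h, _⟩ => ⟨s, h⟩

open scoped Classical in
theorem IsTrivalent.card_key_le (hD : D.IsTrivalent n) (i : ℕ × ℕ × ℕ) :
    #{s | D.key s = i} ≤ 2 := by
  rcases ({s | D.key s = i} : Finset S).eq_empty_or_nonempty with h | ⟨s, hs⟩
  · rw [h]
    simp
  rw [mem_filter] at hs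
  obtain ⟨-, rfl⟩ := hs
  have hle := hD.le s
  have hlt := hD.lt s
  by_cases hb : D.b s ≤ n
  · obtain ⟨s₁, s₂, s₃, -, -, ⟨h, -⟩ | ⟨h, -⟩⟩ := hD.cases (k := D.b s - 1) (by omega)
    · refine (card_le_card (t := {s₁, s₂}) fun s' hs' => ?_).trans card_le_two
      simp only [mem_filter, key, Prod.mk.injEq] at hs'
      simpa using (h s').1 (by omega)
    · refine (card_le_card (t := {s₃}) fun s' hs' => ?_).trans (by simp)
      simp only [mem_filter, key, Prod.mk.injEq] at hs'
      simpa using (h s').1 (by omega)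
  · have ha : D.a s ≠ 0 := fun ha => hb (hD.no_line s ha)
    obtain ⟨s₁, s₂, s₃, -, -, ⟨-, h⟩ | ⟨-, h⟩⟩ := hD.cases (k := D.a s - 1) (by omega)
    · refine (card_le_card (t := {s₃}) fun s' hs' => ?_).trans (by simp)
      simp only [mem_filter, key, Prod.mk.injEq] at hs'
      simpa using (h s').1 (by omega)
    · refine (card_le_card (t := {s₁, s₂}) fun s' hs' => ?_).trans card_le_two
      simp only [mem_filter, key, Prod.mk.injEq] at hs'
      simpa using (h s').1 (by omega)

theorem IsTrivalent.eq_or_eq_of_key (hD : D.IsTrivalent n) {s s' x : S} (hne : s ≠ s')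
    (hs : D.key s' = D.key s) (hx : D.key x = D.key s) : x = s ∨ x = s' := by
  classical
  by_contra hcon
  rw [not_or] at hcon
  have h1 : ({x, s, s'} : Finset S) ⊆ ({y | D.key y = D.key s} : Finset S) := by
    intro y hy
    simp only [mem_insert, mem_singleton] at hy
    rw [mem_filter]
    rcases hy with rfl | rfl | rfl
    · exact ⟨mem_univ _, hx⟩
    · exact ⟨mem_univ _, rfl⟩
    · exact ⟨mem_univ _, hs⟩
  have h2 := (card_le_card h1).trans (hD.card_key_le _)
  rw [card_eq_three.2 ⟨x, s, s', hcon.1, hcon.2, hne, rfl⟩] at h2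
  omega

/-- At most two strands of a trivalent diagram have the same data, so that the automorphisms are the
independent exchanges of two such strands. -/
theorem IsTrivalent.card_aut (hD : D.IsTrivalent n) :
    Nat.card D.Aut = 2 ^ D.pairKeys.ncard := by
  classical
  have h1 : Nat.card D.Aut = Fintype.card {φ : Equiv.Perm S // D.key ∘ φ = D.key} := by
    rw [← Nat.card_eq_fintype_card]
    refine Nat.card_congr (Equiv.subtypeEquivRight fun φ => ?_)
    simp only [funext_iff, Function.comp_apply, key, Prod.mk.injEq]
    exact ⟨fun h s => ⟨h.w s, h.a s, h.b s⟩,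
      fun h => ⟨fun s => (h s).1, fun s => (h s).2.1, fun s => (h s).2.2⟩⟩
  have h2 : D.pairKeys.ncard = #{i ∈ univ.image D.key | i ∈ D.pairKeys} := by
    rw [← Set.ncard_coe_finset]
    congr 1
    ext i
    simp only [coe_filter, mem_image, mem_univ, true_and, Set.mem_ofPred_eq]
    exact ⟨fun h => ⟨h.imp fun s h' => by obtain ⟨s', -, h'', -⟩ := h'; exact h'', h⟩, fun h => h.2⟩
  rw [h1, DomMulAct.stabilizer_card', h2, ← prod_const, prod_filter]
  refine prod_congr rfl fun i hi => ?_
  obtain ⟨s, -, hs⟩ := mem_image.1 hi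
  rw [Fintype.card_subtype]
  have hle := hD.card_key_le i
  split_ifs with hpair
  · obtain ⟨s, s', hne, h3, h4⟩ := hpair
    have : #({s, s'} : Finset S) ≤ #{s | D.key s = i} := card_le_card fun x hx => by
      rw [mem_insert, mem_singleton] at hx
      rw [mem_filter]
      rcases hx with rfl | rfl
      · exact ⟨mem_univ _, h3⟩
      · exact ⟨mem_univ _, h4⟩
    rw [card_pair hne] at this
    rw [show #{s | D.key s = i} = 2 by omega]
    rfl
  · have : #{s | D.key s = i} ≤ 1 := card_le_one.2 fun x hx y hy => by
      by_contra hne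
      exact hpair ⟨x, y, hne, (mem_filter.1 hx).2, (mem_filter.1 hy).2⟩
    exact Nat.factorial_eq_one.2 this

end Diagram

namespace CombType

variable {g : ℕ} {Δ : Multiset ℤ} (α : CombType g Δ)

/-- The component of an end at `v` consists of this end only. -/
theorem comp_eq_leg_iff {v : α.V} {l : α.L} (hl : α.base l = v) (x : α.Piece v) :
    α.comp x = α.comp (.leg l) ↔ x = .leg l := by
  refine ⟨fun h => ?_, fun h => by rw [h]⟩
  let c : α.Component v → Prop := Quot.lift (fun x => x = .leg l) (by
    intro a b hab
    cases hab with
    | src e h => simp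
    | tgt e h => simp
    | base l' h =>
      simp only [Piece.leg.injEq, reduceCtorEq, eq_iff_iff, iff_false]
      rintro rfl
      contradiction)
  have h1 : c (α.comp x) := by
    rw [h]
    exact rfl
  exact h1

/-- If every vertex has a label and there are no loops, then two components with the same type are
two ends of the same direction: a component with a vertex is determined by the label there. -/
theorem exists_sameType_iff (hl : Function.Surjective α.label) (hloop : ∀ e, α.src e ≠ α.tgt e)
    (v : α.V) : (∃ c c' : α.Component v, c ≠ c' ∧ α.SameType c c') ↔
      ∃ l l', l ≠ l' ∧ α.base l = v ∧ α.base l' = v ∧ α.dir l = α.dir l' := by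
  constructor
  · rintro ⟨c, c', hne, φV, φE, φL, h1, h2, h3⟩
    have hno : ∀ (w : α.V) (hw : w ≠ v), α.comp (.vertex w hw) ≠ c := by
      intro w hw hc
      obtain ⟨i, hi⟩ := hl w
      have h4 := (h1 ⟨w, hw, hc⟩ i).1 hi
      obtain ⟨hw', hc'⟩ := (φV ⟨w, hw, hc⟩).2
      refine hne (hc.symm.trans (Eq.trans ?_ hc'))
      congr 2
      exact hi.symm.trans h4
    have hno' : ∀ (w : α.V) (hw : w ≠ v), α.comp (.vertex w hw) ≠ c' := by
      intro w hw hc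
      obtain ⟨hw', hc'⟩ := (φV.symm ⟨w, hw, hc⟩).2
      exact hno _ hw' hc'
    obtain ⟨x, rfl⟩ := Quot.exists_rep c
    have hleg : ∃ l, x = .leg l ∧ α.base l = v := by
      cases x with
      | vertex w hw => exact absurd rfl (hno w hw)
      | edge e =>
        exfalso
        by_cases hs : α.src e = v
        · have ht : α.tgt e ≠ v := fun ht => hloop e (hs.trans ht.symm)
          exact hno _ ht (Quot.sound (Incident.tgt e ht)).symm
        · exact hno _ hs (Quot.sound (Incident.src e hs)).symm
      | leg l =>
        refine ⟨l, rfl, ?_⟩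
        by_contra hb
        exact hno _ hb (Quot.sound (Incident.base l hb)).symm
    obtain ⟨l, rfl, hb⟩ := hleg
    obtain ⟨h4, -⟩ := h3 ⟨l, rfl⟩
    refine ⟨l, (φL ⟨l, rfl⟩).1, fun he => ?_, hb, ?_, h4.symm⟩
    · have h5 := (φL ⟨l, rfl⟩).2
      rw [← he] at h5
      exact hne h5
    · by_contra hb'
      refine hno' _ hb' ?_
      exact (Quot.sound (Incident.base _ hb')).symm.trans (φL ⟨l, rfl⟩).2
  · rintro ⟨l, l', hne, hb, hb', hd⟩
    have hV : ∀ {l}, α.base l = v →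
        IsEmpty {w : α.V // ∃ h : w ≠ v, α.comp (.vertex w h) = α.comp (.leg l)} := fun hb =>
      ⟨fun ⟨w, h, hc⟩ => by cases (α.comp_eq_leg_iff hb _).1 hc⟩
    have hE : ∀ {l}, α.base l = v →
        IsEmpty {e : α.E // α.comp (v := v) (.edge e) = α.comp (.leg l)} := fun hb =>
      ⟨fun ⟨e, hc⟩ => by cases (α.comp_eq_leg_iff hb _).1 hc⟩
    have hL : ∀ {l l'}, α.base l = v →
        α.comp (v := v) (.leg l') = α.comp (.leg l) → l' = l := fun hb hc => by
      cases (α.comp_eq_leg_iff hb _).1 hc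
      rfl
    refine ⟨α.comp (.leg l), α.comp (.leg l'), fun h => hne (hL hb' h), ?_⟩
    have i1 := hV hb
    have i2 := hV hb'
    have i3 := hE hb
    have i4 := hE hb'
    refine ⟨Equiv.equivOfIsEmpty _ _, Equiv.equivOfIsEmpty _ _,
      ⟨fun _ => ⟨l', rfl⟩, fun _ => ⟨l, rfl⟩, fun x => Subtype.ext (hL hb x.2).symm,
        fun x => Subtype.ext (hL hb' x.2).symm⟩,
      fun w => i1.elim w, fun e => i3.elim e, fun x => ⟨?_, fun w => i1.elim w⟩⟩
    rw [hL hb x.2]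
    exact hd.symm

end CombType

namespace TropCurve

variable {g : ℕ} {Δ : Multiset ℤ} {C : TropCurve g Δ} {p : Fin (numLabels g Δ) → ℝ}

/-- Pairs of bounded strands that can be exchanged are cycles of two edges of equal weight. -/
theorem IsOver.numWieners_eq (h : C.IsOver p) (hp : Function.Injective p) (h0 : (0 : ℤ) ∉ Δ) :
    C.type.numWieners = ((C.diagram p).pairKeys ∩
      {i | 0 < i.2.1 ∧ i.2.2 ≤ numLabels g Δ}).ncard := by
  classical
  have hD := h.diagram_isTrivalent hp h0
  have hkey : ∀ e e', (C.diagram p).key (Sum.inl e) = (C.diagram p).key (Sum.inl e') ↔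
      s(C.type.src e, C.type.tgt e) = s(C.type.src e', C.type.tgt e') ∧
        C.type.wt e = C.type.wt e' := by
    intro e e'
    simp only [Diagram.key, diagram, Sum.elim_inl, Prod.mk.injEq, Nat.add_right_cancel_iff,
      h.rank_inj hp, Sym2.eq_iff]
    constructor
    · rintro ⟨h1, h2, h3⟩
      exact ⟨Or.inl ⟨h2, h3⟩, h1⟩
    · rintro ⟨⟨h2, h3⟩ | ⟨h2, h3⟩, h1⟩
      · exact ⟨h1, h2, h3⟩
      · have h4 := h.pos_lt hp h0 e
        have h5 := h.pos_lt hp h0 e'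
        rw [h2, h3] at h4
        exact absurd h4 h5.not_gt
  have hbounded : ∀ s, (C.diagram p).key s ∈ {i : ℕ × ℕ × ℕ | 0 < i.2.1 ∧ i.2.2 ≤ numLabels g Δ} ↔
      ∃ e, Sum.inl e = s := fun s => diagram_inl_iff h hp s
  symm
  refine Set.ncard_congr (fun i _ => {e | (C.diagram p).key (Sum.inl e) = i}) ?_ ?_ ?_
  · rintro i ⟨⟨s, s', hne, rfl, h2⟩, hi⟩
    obtain ⟨e, rfl⟩ := (hbounded s).1 hi
    obtain ⟨e', rfl⟩ := (hbounded s').1 (by rw [h2]; exact hi)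
    have hee : e ≠ e' := fun he => hne (by rw [he])
    obtain ⟨h3, h4⟩ := (hkey e e').1 h2.symm
    refine ⟨e, e', hee, ?_, fun he => ?_, h3, h4⟩
    · ext x
      simp only [Set.mem_ofPred_eq, Set.mem_insert_iff, Set.mem_singleton_iff]
      constructor
      · intro hx
        exact (hD.eq_or_eq_of_key hne h2 hx).imp Sum.inl_injective.eq_iff.1 Sum.inl_injective.eq_iff.1
      · rintro (rfl | rfl)
        · rfl
        · exact h2
    · have := h.pos_lt hp h0 e
      rw [he] at this
      exact lt_irrefl _ this
  · rintro i j ⟨⟨s, -, -, rfl, -⟩, hi⟩ - hij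
    obtain ⟨e, rfl⟩ := (hbounded s).1 hi
    have : e ∈ {x | (C.diagram p).key (Sum.inl x) = (C.diagram p).key (Sum.inl e)} := rfl
    rw [hij] at this
    exact this
  · rintro P ⟨e, e', hne, rfl, -, h3, h4⟩
    have h2 := (hkey e e').2 ⟨h3, h4⟩
    refine ⟨(C.diagram p).key (Sum.inl e), ⟨⟨Sum.inl e, Sum.inl e', by simpa using hne, rfl, h2.symm⟩,
      (hbounded _).2 ⟨e, rfl⟩⟩, ?_⟩
    ext x
    simp only [Set.mem_ofPred_eq, Set.mem_insert_iff, Set.mem_singleton_iff]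
    constructor
    · intro hx
      exact (hD.eq_or_eq_of_key (by simpa using hne) h2.symm hx).imp Sum.inl_injective.eq_iff.1
        Sum.inl_injective.eq_iff.1
    · rintro (rfl | rfl)
      · rfl
      · exact h2.symm

/-- Pairs of ends that can be exchanged correspond to the vertices whose removal leaves two
components of the same type. -/
theorem IsOver.numTwins_eq (h : C.IsOver p) (hp : Function.Injective p) (h0 : (0 : ℤ) ∉ Δ) :
    C.type.numTwins = ((C.diagram p).pairKeys \
      {i | 0 < i.2.1 ∧ i.2.2 ≤ numLabels g Δ}).ncard := by
  classical
  have hkey : ∀ l l', (C.diagram p).key (Sum.inr l) = (C.diagram p).key (Sum.inr l') ↔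
      C.type.base l = C.type.base l' ∧ C.type.dir l = C.type.dir l' := by
    intro l l'
    rw [← h.rank_inj hp]
    have h1 := h.rank_lt hp (C.type.base l)
    have h2 := h.rank_lt hp (C.type.base l')
    simp only [Diagram.key, diagram, Sum.elim_inr, Prod.mk.injEq]
    constructor
    · rintro ⟨h3, h4, h5⟩
      split_ifs at h4 h5 <;> omega
    · rintro ⟨h3, h4⟩
      rw [h3, h4]
      simp
  have hend : ∀ s, (C.diagram p).key s ∉ {i : ℕ × ℕ × ℕ | 0 < i.2.1 ∧ i.2.2 ≤ numLabels g Δ} ↔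
      ∃ l, Sum.inr l = s := by
    intro s
    have h1 : (C.diagram p).key s ∈ {i : ℕ × ℕ × ℕ | 0 < i.2.1 ∧ i.2.2 ≤ numLabels g Δ} ↔
      ∃ e, Sum.inl e = s := diagram_inl_iff h hp s
    rw [h1]
    rcases s with e | l <;> simp
  have hpair : ∀ i ∈ (C.diagram p).pairKeys \ {i | 0 < i.2.1 ∧ i.2.2 ≤ numLabels g Δ},
      ∃ v l l', l ≠ l' ∧ C.type.base l = v ∧ C.type.base l' = v ∧ C.type.dir l = C.type.dir l' ∧
        (C.diagram p).key (Sum.inr l) = i := by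
    rintro i ⟨⟨s, s', hne, rfl, h2⟩, hi⟩
    obtain ⟨l, rfl⟩ := (hend s).1 hi
    obtain ⟨l', rfl⟩ := (hend s').1 (by rw [h2]; exact hi)
    obtain ⟨h3, h4⟩ := (hkey l l').1 h2.symm
    exact ⟨_, l, l', fun he => hne (by rw [he]), h3, rfl, h4, rfl⟩
  have htwin := C.type.exists_sameType_iff (h.label_bijective hp).2
    (fun e he => by
      have := h.pos_lt hp h0 e
      rw [he] at this
      exact lt_irrefl _ this)
  choose v hv using hpair
  symm
  refine Set.ncard_congr v (fun i hi => ?_) (fun i j hi hj hij => ?_) (fun u hu => ?_)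
  · obtain ⟨l, l', hne, h1, h2, h3, -⟩ := hv i hi
    exact (htwin _).2 ⟨l, l', hne, h1, h2, h3⟩
  · obtain ⟨l₁, l₂, hne, h1, h2, h3, rfl⟩ := hv i hi
    obtain ⟨l₃, l₄, hne', h1', h2', h3', rfl⟩ := hv j hj
    -- two different pairs of ends at a vertex would give valency four
    by_contra hcon
    have hval := (h.valency hp (v _ hi)).2
    rw [hkey] at hcon
    rw [← hij] at h1' h2'
    have hdir : C.type.dir l₁ ≠ C.type.dir l₃ := fun hd => hcon ⟨h1.trans h1'.symm, hd⟩
    have hsub : ({l₁, l₂, l₃, l₄} : Finset C.type.L) ⊆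
        ({l | C.type.base l = v _ hi} : Finset C.type.L) := by
      intro l hl
      simp only [mem_insert, mem_singleton] at hl
      rw [mem_filter]
      rcases hl with rfl | rfl | rfl | rfl
      · exact ⟨mem_univ _, h1⟩
      · exact ⟨mem_univ _, h2⟩
      · exact ⟨mem_univ _, h1'⟩
      · exact ⟨mem_univ _, h2'⟩
    have h4 := card_le_card hsub
    have h13 : l₁ ≠ l₃ := fun he => hdir (by rw [he])
    have h14 : l₁ ≠ l₄ := fun he => hdir (by rw [h3', he])
    have h23 : l₂ ≠ l₃ := fun he => hdir (by rw [h3, he])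
    have h24 : l₂ ≠ l₄ := fun he => hdir (by rw [h3, h3', he])
    rw [card_insert_of_notMem (by simp [hne, h13, h14]),
      card_insert_of_notMem (by simp [h23, h24]), card_pair hne'] at h4
    omega
  · obtain ⟨l, l', hne, h1, h2, h3⟩ := (htwin u).1 hu
    have hk := (hkey l l').2 ⟨h1.trans h2.symm, h3⟩
    have hi : (C.diagram p).key (Sum.inr l) ∈
        (C.diagram p).pairKeys \ {i | 0 < i.2.1 ∧ i.2.2 ≤ numLabels g Δ} :=
      ⟨⟨Sum.inr l, Sum.inr l', by simpa using hne, rfl, hk.symm⟩, (hend _).2 ⟨l, rfl⟩⟩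
    refine ⟨_, hi, ?_⟩
    obtain ⟨l₁, l₂, -, h4, -, -, h5⟩ := hv _ hi
    rw [← h4, ((hkey l₁ l).1 h5).1, h1]

theorem IsOver.card_aut (h : C.IsOver p) (hp : Function.Injective p) (h0 : (0 : ℤ) ∉ Δ) :
    Nat.card (C.diagram p).Aut = 2 ^ (C.type.numTwins + C.type.numWieners) := by
  rw [(h.diagram_isTrivalent hp h0).card_aut, h.numTwins_eq hp h0, h.numWieners_eq hp h0, add_comm,
    Set.ncard_inter_add_ncard_sdiff_eq_ncard _ _ Diagram.pairKeys_finite]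

/-- The multiplicity of a curve is the product of the weights of its bounded edges divided by the
number of its automorphisms. -/
theorem IsOver.mult_mul_card_aut (h : C.IsOver p) (hp : Function.Injective p) (h0 : (0 : ℤ) ∉ Δ) :
    C.type.mult * Nat.card (C.diagram p).Aut = ∏ e, (C.type.wt e : ℚ) := by
  have h1 := CombType.loopIndex_mul_brDet (h.wt_ne_zero hp h0) (h.label_bijective hp)
  have h2 : (C.type.loopIndex : ℚ) * C.type.brDet = ∏ e, (C.type.wt e : ℚ) := by
    exact_mod_cast h1
  rw [h.card_aut hp h0, CombType.mult, CombType.weight, ← h2, pow_add]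
  push_cast
  have h3 : ∀ k : ℕ, (1 / 2 : ℚ) ^ k * 2 ^ k = 1 := fun k => by
    rw [← mul_pow]
    norm_num
  linear_combination (C.type.loopIndex * C.type.brDet * ((1 / 2 : ℚ) ^ C.type.numWieners *
    2 ^ C.type.numWieners)) * h3 C.type.numTwins + (C.type.loopIndex * C.type.brDet : ℚ) *
    h3 C.type.numWieners

end TropCurve

end TropicalHurwitz

namespace TropicalHurwitz

/-! ### The tropical curve of a diagram -/

open Finset

namespace Diagram

variable {S : Type} [Fintype S] {D : Diagram S} {n : ℕ}

variable (D n) in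
/-- The bounded strands. -/
abbrev Edge : Type := {s : S // 0 < D.a s ∧ D.b s ≤ n}

variable (D n) in
/-- The strands that are not bounded. -/
abbrev End : Type := {s : S // ¬ (0 < D.a s ∧ D.b s ≤ n)}

/-- The branch point where a bounded strand starts. -/
def edgeSrc (hD : D.IsTimed n) (e : D.Edge n) : Fin n :=
  ⟨D.a e.1 - 1, by have := hD.lt e.1; have := e.2; omega⟩

/-- The branch point where a bounded strand ends. -/
def edgeTgt (hD : D.IsTimed n) (e : D.Edge n) : Fin n :=
  ⟨D.b e.1 - 1, by have := hD.lt e.1; have := e.2; omega⟩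

/-- The branch point at an end. -/
def endBase (hD : D.IsTrivalent n) (l : D.End n) : Fin n :=
  ⟨if D.a l.1 = 0 then D.b l.1 - 1 else D.a l.1 - 1, by
    have h1 := hD.lt l.1
    have h2 := hD.no_line l.1
    have h3 := hD.le l.1
    split_ifs with h
    · have := h2 h
      omega
    · omega⟩

variable (D) in
/-- The direction of an end, seen from its branch point. -/
def endDir (s : S) : ℤ := if D.a s = 0 then -(D.w s : ℤ) else D.w s

open scoped Classical in
theorem sum_born (hD : D.IsTrivalent n) (v : Fin n) (φ : S → ℤ) :
    ∑ s with D.a s = v + 1, φ s = ∑ e with edgeSrc hD.toIsTimed e = v, φ e.1 +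
      ∑ l with endBase hD l = v ∧ ¬ D.a l.1 = 0, φ l.1 := by
  simp only [sum_filter]
  rw [← Fintype.sum_subtype_add_sum_subtype (fun s => 0 < D.a s ∧ D.b s ≤ n)]
  congr 1
  · refine sum_congr rfl fun e _ => if_congr ?_ rfl rfl
    have := e.2
    simp only [edgeSrc, Fin.ext_iff]
    omega
  · refine sum_congr rfl fun l _ => if_congr ?_ rfl rfl
    simp only [endBase, Fin.ext_iff]
    split_ifs <;> omega

open scoped Classical in
theorem sum_dying (hD : D.IsTrivalent n) (v : Fin n) (φ : S → ℤ) :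
    ∑ s with D.b s = v + 1, φ s = ∑ e with edgeTgt hD.toIsTimed e = v, φ e.1 +
      ∑ l with endBase hD l = v ∧ D.a l.1 = 0, φ l.1 := by
  simp only [sum_filter]
  rw [← Fintype.sum_subtype_add_sum_subtype (fun s => 0 < D.a s ∧ D.b s ≤ n)]
  congr 1
  · refine sum_congr rfl fun e _ => if_congr ?_ rfl rfl
    have := e.2
    have := hD.lt e.1
    simp only [edgeTgt, Fin.ext_iff]
    omega
  · refine sum_congr rfl fun l _ => if_congr ?_ rfl rfl
    have h1 := l.2
    have h2 := hD.lt l.1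
    have h3 := hD.no_line l.1
    have h4 := v.2
    simp only [endBase, Fin.ext_iff]
    split_ifs with h
    · omega
    · simp only [h, and_false, iff_false]
      omega

theorem valency (hD : D.IsTrivalent n) (v : Fin n) :
    Nat.card {e // edgeSrc hD.toIsTimed e = v} + Nat.card {e // edgeTgt hD.toIsTimed e = v} +
      Nat.card {l // endBase hD l = v} = 3 := by
  classical
  have h1 := sum_born hD v (fun _ => 1)
  have h2 := sum_dying hD v (fun _ => 1)
  have h3 := hD.card_eq v v.2
  have h4 := card_filter_add_card_filter_not (s := {l | endBase hD l = v}) (fun l => D.a l.1 = 0)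
  rw [filter_filter, filter_filter] at h4
  simp only [sum_const, nsmul_eq_mul, mul_one] at h1 h2
  simp only [Nat.card_eq_fintype_card, Fintype.card_subtype]
  omega

open scoped Classical in
/-- The directions of the flags at a branch point have sum zero. -/
theorem sum_flags (hD : D.IsTrivalent n) (v : Fin n) :
    (∑ e with edgeSrc hD.toIsTimed e = v, (D.w e.1 : ℤ)) -
      (∑ e with edgeTgt hD.toIsTimed e = v, (D.w e.1 : ℤ)) +
      ∑ l with endBase hD l = v, D.endDir l.1 = 0 := by
  have h1 := sum_born hD v (fun s => D.w s)
  have h2 := sum_dying hD v (fun s => D.w s)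
  have h3 : (∑ s with D.b s = v + 1, (D.w s : ℤ)) = ∑ s with D.a s = v + 1, (D.w s : ℤ) := by
    exact_mod_cast hD.balanced v v.2
  have h4 := sum_filter_add_sum_filter_not {l | endBase hD l = v} (fun l => D.a l.1 = 0)
    (fun l => D.endDir l.1)
  rw [filter_filter, filter_filter] at h4
  have h5 : ∑ l with endBase hD l = v ∧ D.a l.1 = 0, D.endDir l.1 =
      - ∑ l with endBase hD l = v ∧ D.a l.1 = 0, (D.w l.1 : ℤ) := by
    rw [← sum_neg_distrib]
    refine sum_congr rfl fun l hl => ?_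
    simp only [mem_filter] at hl
    rw [endDir, if_pos hl.2.2]
  have h6 : ∑ l with endBase hD l = v ∧ ¬ D.a l.1 = 0, D.endDir l.1 =
      ∑ l with endBase hD l = v ∧ ¬ D.a l.1 = 0, (D.w l.1 : ℤ) := by
    refine sum_congr rfl fun l hl => ?_
    simp only [mem_filter] at hl
    rw [endDir, if_neg hl.2.2]
  linarith

theorem connected (hD : D.IsTrivalent n) (hc : D.IsConnected n) (u v : Fin n) :
    Relation.EqvGen (fun x y => ∃ e, edgeSrc hD.toIsTimed e = x ∧ edgeTgt hD.toIsTimed e = y)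
      u v := by
  refine hc (fun k => ∀ hk : k < n, Relation.EqvGen (fun x y => ∃ e,
    edgeSrc hD.toIsTimed e = x ∧ edgeTgt hD.toIsTimed e = y) u ⟨k, hk⟩) (fun s ha hb => ?_)
    u u.2 v v.2 (fun _ => Relation.EqvGen.refl _) v.2
  have hrel := Relation.EqvGen.rel (r := fun x y => ∃ e,
    edgeSrc hD.toIsTimed e = x ∧ edgeTgt hD.toIsTimed e = y) _ _ ⟨⟨s, ha, hb⟩, rfl, rfl⟩
  constructor
  · intro h _
    exact (h _).trans _ _ _ hrel
  · intro h _
    exact (h _).trans _ _ _ (hrel.symm _ _)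

/-- Counting the flags at the branch points. -/
theorem two_mul_card_edge (hD : D.IsTrivalent n) :
    2 * Fintype.card (D.Edge n) + Fintype.card (D.End n) = 3 * n := by
  classical
  have h1 : ∑ v : Fin n, (Nat.card {e // edgeSrc hD.toIsTimed e = v} +
      Nat.card {e // edgeTgt hD.toIsTimed e = v} + Nat.card {l // endBase hD l = v}) = 3 * n := by
    rw [sum_congr rfl fun v _ => valency hD v]
    simp [mul_comm]
  have key : ∀ {A : Type} [Fintype A] (t : A → Fin n),
      ∑ v : Fin n, Nat.card {x // t x = v} = Fintype.card A := by
    intro A _ t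
    rw [Fintype.card_congr (Equiv.sigmaFiberEquiv t).symm, Fintype.card_sigma]
    simp only [Nat.card_eq_fintype_card]
  rw [sum_add_distrib, sum_add_distrib, key, key, key] at h1
  omega

variable {Δ : Multiset ℤ}

theorem map_endDir (hD : D.IsTrivalent n) (h0 : (0 : ℤ) ∉ Δ)
    (hleft : ({s | D.a s = 0} : Finset S).val.map D.w =
      (Δ.filter (fun z => z < 0)).map Int.natAbs)
    (hright : ({s | D.b s = n + 1} : Finset S).val.map D.w =
      (Δ.filter (fun z => 0 < z)).map Int.natAbs) :
    (univ : Finset (D.End n)).val.map (fun l => D.endDir l.1) = Δ := by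
  classical
  have h1 : (univ : Finset (D.End n)).map (Function.Embedding.subtype _) =
      ({s | D.a s = 0} : Finset S) ∪ ({s | D.b s = n + 1} : Finset S) := by
    ext s
    have := hD.le s
    simp only [mem_map, mem_univ, true_and, Function.Embedding.subtype_apply, Subtype.exists,
      exists_prop, exists_eq_right, mem_union, mem_filter]
    omega
  have hdisj : Disjoint ({s | D.a s = 0} : Finset S) ({s | D.b s = n + 1} : Finset S) := by
    rw [disjoint_filter]
    intro s _ ha hb
    have := hD.no_line s ha
    omega
  have h2 : (univ : Finset (D.End n)).val.map (fun l => D.endDir l.1) =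
      ({s | D.a s = 0} : Finset S).val.map D.endDir +
        ({s | D.b s = n + 1} : Finset S).val.map D.endDir := by
    rw [← Multiset.map_add, ← disjUnion_val _ _ hdisj, disjUnion_eq_union, ← h1, map_val,
      Multiset.map_map]
    rfl
  have h3 : ({s | D.a s = 0} : Finset S).val.map D.endDir =
      (({s | D.a s = 0} : Finset S).val.map D.w).map (fun m : ℕ => -(m : ℤ)) := by
    rw [Multiset.map_map]
    refine Multiset.map_congr rfl fun s hs => ?_
    replace hs : s ∈ ({s | D.a s = 0} : Finset S) := hs
    rw [endDir, if_pos (by simpa using hs), Function.comp_apply]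
  have h4 : ({s | D.b s = n + 1} : Finset S).val.map D.endDir =
      (({s | D.b s = n + 1} : Finset S).val.map D.w).map (fun m : ℕ => (m : ℤ)) := by
    rw [Multiset.map_map]
    refine Multiset.map_congr rfl fun s hs => ?_
    replace hs : s ∈ ({s | D.b s = n + 1} : Finset S) := hs
    have hb : D.b s = n + 1 := by simpa using hs
    have := hD.no_line s
    rw [endDir, if_neg (by omega), Function.comp_apply]
  have h5 : (Δ.filter (fun z => z < 0)).map ((fun m : ℕ => -(m : ℤ)) ∘ Int.natAbs) =
      Δ.filter (fun z => z < 0) := by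
    conv_rhs => rw [← Multiset.map_id (Δ.filter (fun z => z < 0))]
    refine Multiset.map_congr rfl fun z hz => ?_
    have := (Multiset.mem_filter.1 hz).2
    simp only [Function.comp_apply, id]
    omega
  have h6 : (Δ.filter (fun z => 0 < z)).map ((fun m : ℕ => (m : ℤ)) ∘ Int.natAbs) =
      Δ.filter (fun z => ¬ z < 0) := by
    conv_rhs => rw [← Multiset.map_id (Δ.filter (fun z => ¬ z < 0))]
    have h7 : Δ.filter (fun z => 0 < z) = Δ.filter (fun z => ¬ z < 0) := by
      refine Multiset.filter_congr fun z hz => ?_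
      have : z ≠ 0 := fun h => h0 (h ▸ hz)
      omega
    rw [h7]
    refine Multiset.map_congr rfl fun z hz => ?_
    have := (Multiset.mem_filter.1 hz).2
    simp only [Function.comp_apply, id]
    omega
  rw [h2, h3, h4, hleft, hright, Multiset.map_map, Multiset.map_map, h5, h6,
    Multiset.filter_add_not]

variable {g : ℕ}

/-- The combinatorial type of a diagram. -/
def toCombType (hD : D.IsTrivalent (numLabels g Δ)) (hc : D.IsConnected (numLabels g Δ))
    (h0 : (0 : ℤ) ∉ Δ) (hn : 2 < Multiset.card Δ + 2 * g)
    (hleft : ({s | D.a s = 0} : Finset S).val.map D.w =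
      (Δ.filter (fun z => z < 0)).map Int.natAbs)
    (hright : ({s | D.b s = numLabels g Δ + 1} : Finset S).val.map D.w =
      (Δ.filter (fun z => 0 < z)).map Int.natAbs)
    (ℓ : Equiv.Perm (Fin (numLabels g Δ))) : CombType g Δ where
  V := Fin (numLabels g Δ)
  E := D.Edge (numLabels g Δ)
  L := D.End (numLabels g Δ)
  nonemptyV := ⟨⟨0, by rw [numLabels]; omega⟩⟩
  src := edgeSrc hD.toIsTimed
  tgt := edgeTgt hD.toIsTimed
  wt e := D.w e.1
  base := endBase hD
  dir l := D.endDir l.1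
  label := ℓ
  connected := connected hD hc
  genus_le := by
    have h1 := two_mul_card_edge hD
    have h2 := congrArg Multiset.card (map_endDir hD h0 hleft hright)
    rw [Multiset.card_map, card_val, card_univ] at h2
    rw [h2] at h1
    rw [Fintype.card_fin]
    unfold numLabels at *
    omega
  two_le_val v := by
    rw [valency hD]
    omega
  label_of_val_two v h := by
    rw [valency hD] at h
    omega
  label_count v := by
    refine ⟨0, ?_⟩
    have : Nat.card {i // ℓ i = v} = 1 := by
      rw [Nat.card_eq_one_iff_unique]
      exact ⟨⟨fun a b => Subtype.ext (ℓ.injective (a.2.trans b.2.symm))⟩,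
        ⟨⟨ℓ.symm v, ℓ.apply_symm_apply v⟩⟩⟩
    rw [valency hD, this]
  dir_ends := map_endDir hD h0 hleft hright
  balanced v := by convert sum_flags hD v

/-- Every connected trivalent diagram is the diagram of a tropical curve over `p`. -/
theorem exists_curve (hD : D.IsTrivalent (numLabels g Δ)) (hc : D.IsConnected (numLabels g Δ))
    (h0 : (0 : ℤ) ∉ Δ) (hn : 2 < Multiset.card Δ + 2 * g)
    (hleft : ({s | D.a s = 0} : Finset S).val.map D.w =
      (Δ.filter (fun z => z < 0)).map Int.natAbs)
    (hright : ({s | D.b s = numLabels g Δ + 1} : Finset S).val.map D.w =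
      (Δ.filter (fun z => 0 < z)).map Int.natAbs)
    {p : Fin (numLabels g Δ) → ℝ} (hp : Function.Injective p) :
    ∃ C : TropCurve g Δ, C.IsOver p ∧ ∃ φ, D.IsIso (C.diagram p) φ := by
  classical
  have hinj : Function.Injective fun i => (⟨rank p (p i), rank_lt i⟩ : Fin (numLabels g Δ)) :=
    fun i j h => rank_injective hp (Fin.mk.inj_iff.1 h)
  set ℓ : Equiv.Perm (Fin (numLabels g Δ)) :=
    Equiv.ofBijective _ (Finite.injective_iff_bijective.1 hinj) with hℓ
  have hpos : ∀ v, rank p (p (ℓ.symm v)) = v := fun v =>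
    congrArg Fin.val (ℓ.apply_symm_apply v)
  have hlt : ∀ e : D.Edge (numLabels g Δ), p (ℓ.symm (edgeSrc hD.toIsTimed e)) <
      p (ℓ.symm (edgeTgt hD.toIsTimed e)) := by
    intro e
    rw [← rank_lt_rank_iff, hpos, hpos]
    have := hD.lt e.1
    have := e.2
    simp only [edgeSrc, edgeTgt]
    omega
  have hw : ∀ e : D.Edge (numLabels g Δ), (0 : ℝ) < D.w e.1 := fun e => by
    exact_mod_cast hD.w_pos e.1
  let C : TropCurve g Δ :=
    { type := toCombType hD hc h0 hn hleft hright ℓ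
      pos := fun v => p (ℓ.symm v)
      len := fun e => (p (ℓ.symm (edgeTgt hD.toIsTimed e)) -
        p (ℓ.symm (edgeSrc hD.toIsTimed e))) / D.w e.1
      mem_cell := ⟨fun e => (mul_div_cancel₀ _ (hw e).ne').symm, fun e =>
        div_pos (sub_pos.2 (hlt e)) (hw e)⟩ }
  refine ⟨C, fun i => congrArg p (ℓ.symm_apply_apply i),
    (Equiv.sumCompl fun s => 0 < D.a s ∧ D.b s ≤ numLabels g Δ).symm, IsIso.symm ?_⟩
  refine ⟨fun s => ?_, fun s => ?_, fun s => ?_⟩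
  · rcases s with e | l
    · rfl
    · change D.w l.1 = (D.endDir l.1).natAbs
      rw [endDir]
      split_ifs <;> simp
  · rcases s with e | l
    · change D.a e.1 = rank p (p (ℓ.symm (edgeSrc hD.toIsTimed e))) + 1
      have := e.2
      rw [hpos]
      simp only [edgeSrc]
      omega
    · change D.a l.1 = if D.endDir l.1 < 0 then 0 else rank p (p (ℓ.symm (endBase hD l))) + 1
      have := hD.w_pos l.1
      rw [hpos]
      simp only [endBase, endDir]
      split_ifs <;> omega
  · rcases s with e | l
    · change D.b e.1 = rank p (p (ℓ.symm (edgeTgt hD.toIsTimed e))) + 1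
      have := e.2
      have := hD.lt e.1
      rw [hpos]
      simp only [edgeTgt]
      omega
    · change D.b l.1 = if D.endDir l.1 < 0 then rank p (p (ℓ.symm (endBase hD l))) + 1
        else numLabels g Δ + 1
      have h1 := hD.w_pos l.1
      have h2 := hD.lt l.1
      have h3 := hD.le l.1
      have h4 := l.2
      rw [hpos]
      simp only [endBase, endDir]
      split_ifs <;> omega

end Diagram

end TropicalHurwitz

namespace TropicalHurwitz

/-! ### Monodromy representations as sequences of permutations -/

open Equiv Equiv.Perm Finset

section Monodromy

variable {d n : ℕ}

/-- Sequences of permutations that differ by transpositions, start with a permutation of cycle type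
`η`, end with a permutation of cycle type `ν`, and act transitively. They record the partial
products of a monodromy representation. -/
structure IsMonodromySeq (n : ℕ) (η ν : d.Partition) (P : ℕ → Perm (Fin d)) : Prop where
  isSwap : ∀ k < n, (P (k + 1) * (P k)⁻¹).IsSwap
  const : ∀ k, n ≤ k → P k = P n
  type_left : (P 0).partition.parts = η.parts
  type_right : (P n).partition.parts = ν.parts
  transitive : IsTransitiveSeq n P

theorem prod_reverse_ofFn {G : Type*} [Group G] (P : ℕ → G) (n : ℕ) :
    (List.ofFn fun i : Fin n => P (i + 1) * (P i)⁻¹).reverse.prod = P n * (P 0)⁻¹ := by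
  induction n with
  | zero => simp
  | succ n ih =>
    rw [List.ofFn_succ', List.concat_eq_append, List.reverse_append, List.prod_append]
    simp only [Fin.val_castSucc, Fin.val_last, ih]
    simp

theorem parts_partition_inv (σ : Perm (Fin d)) : σ⁻¹.partition.parts = σ.partition.parts := by
  rw [parts_partition, parts_partition, cycleType_inv, support_inv]

/-- The group generated by the entries of a monodromy representation is transitive if and only if
there are no invariant subsets of all partial products. -/
theorem isPretransitive_iff (P : ℕ → Perm (Fin d)) :
    MulAction.IsPretransitive (Subgroup.closure ({P 0, (P n)⁻¹} ∪
      Set.range fun i : Fin n => P (i + 1) * (P i)⁻¹) : Subgroup (Perm (Fin d))) (Fin d) ↔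
      IsTransitiveSeq n P := by
  set H := Subgroup.closure ({P 0, (P n)⁻¹} ∪ Set.range fun i : Fin n => P (i + 1) * (P i)⁻¹) with hH
  constructor
  · intro h c hc x y hx
    have hinv : ∀ k ≤ n, ∀ x, c ((P k)⁻¹ x) ↔ c x := by
      intro k hk x
      obtain ⟨z, rfl⟩ := (P k).surjective x
      rw [← Perm.mul_apply, inv_mul_cancel, Perm.one_apply, hc k hk]
    have key : ∀ τ ∈ H, ∀ x, c (τ x) ↔ c x := by
      intro τ hτ
      induction hτ using Subgroup.closure_induction with
      | mem τ hτ =>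
        rcases hτ with (rfl | rfl) | ⟨i, rfl⟩
        · exact hc 0 n.zero_le
        · exact hinv n le_rfl
        · intro x
          rw [Perm.mul_apply, hc (i + 1) i.2, hinv i i.2.le]
      | one => exact fun x => Iff.rfl
      | mul τ τ' _ _ h1 h2 => exact fun x => (h1 (τ' x)).trans (h2 x)
      | inv τ _ h1 =>
        intro x
        obtain ⟨z, rfl⟩ := τ.surjective x
        rw [← Perm.mul_apply, inv_mul_cancel, Perm.one_apply, h1]
    obtain ⟨⟨τ, hτ⟩, rfl⟩ := h.exists_smul_eq x y
    exact (key τ hτ x).2 hx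
  · intro h
    have hmem : ∀ k ≤ n, P k ∈ H := by
      intro k
      induction k with
      | zero => exact fun _ => Subgroup.subset_closure (Or.inl (Or.inl rfl))
      | succ k ih =>
        intro hk
        have h1 : P (k + 1) * (P k)⁻¹ ∈ H := Subgroup.subset_closure (Or.inr ⟨⟨k, hk⟩, rfl⟩)
        have h2 := H.mul_mem h1 (ih (by omega))
        rwa [inv_mul_cancel_right] at h2
    refine ⟨fun x y => ?_⟩
    have := h (fun z => ∃ τ ∈ H, τ x = z) (by
      intro k hk z
      constructor
      · rintro ⟨τ, hτ, h1⟩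
        exact ⟨(P k)⁻¹ * τ, H.mul_mem (H.inv_mem (hmem k hk)) hτ, by
          rw [Perm.mul_apply, h1, ← Perm.mul_apply, inv_mul_cancel, Perm.one_apply]⟩
      · rintro ⟨τ, hτ, h1⟩
        exact ⟨P k * τ, H.mul_mem (hmem k hk) hτ, by rw [Perm.mul_apply, h1]⟩)
      x y ⟨1, H.one_mem, rfl⟩
    obtain ⟨τ, hτ, rfl⟩ := this
    exact ⟨⟨τ, hτ⟩, rfl⟩

theorem isMonodromy_iff (η ν : d.Partition) {P : ℕ → Perm (Fin d)}
    (hP : ∀ k, n ≤ k → P k = P n) :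
    IsMonodromy η ν (P 0) (fun i : Fin n => P (i + 1) * (P i)⁻¹) (P n)⁻¹ ↔
      IsMonodromySeq n η ν P := by
  constructor
  · rintro ⟨h1, h2, h3, -, h5⟩
    rw [parts_partition_inv] at h2
    exact ⟨fun k hk => h3 ⟨k, hk⟩, hP, h1, h2, (isPretransitive_iff P).1 h5⟩
  · rintro ⟨h1, -, h3, h4, h5⟩
    refine ⟨h3, ?_, fun i => h1 i i.2, ?_, (isPretransitive_iff P).2 h5⟩
    · rw [parts_partition_inv, h4]
    · rw [prod_reverse_ofFn]
      group

/-- Taking partial products is a bijection from monodromy representations to sequences of permutations. -/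
theorem card_isMonodromy (η ν : d.Partition) :
    Nat.card {t : Perm (Fin d) × (Fin n → Perm (Fin d)) × Perm (Fin d) //
      IsMonodromy η ν t.1 t.2.1 t.2.2} = Nat.card {P // IsMonodromySeq n η ν P} := by
  symm
  refine Nat.card_eq_of_bijective (fun P => ⟨(P.1 0, (fun i : Fin n => P.1 (i + 1) * (P.1 i)⁻¹),
    (P.1 n)⁻¹), (isMonodromy_iff η ν P.2.const).2 P.2⟩) ⟨fun P P' h => ?_, ?_⟩
  · have h0 : P.1 0 = P'.1 0 := (Prod.ext_iff.1 (Subtype.ext_iff.1 h)).1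
    have h1 : (fun i : Fin n => P.1 (i + 1) * (P.1 i)⁻¹) =
        fun i : Fin n => P'.1 (i + 1) * (P'.1 i)⁻¹ :=
      (Prod.ext_iff.1 (Prod.ext_iff.1 (Subtype.ext_iff.1 h)).2).1
    have key : ∀ k ≤ n, P.1 k = P'.1 k := by
      intro k
      induction k with
      | zero => exact fun _ => h0
      | succ k ih =>
        intro hk
        have h2 := congrFun h1 ⟨k, hk⟩
        simp only [ih (by omega)] at h2
        exact mul_right_cancel h2
    refine Subtype.ext (funext fun k => ?_)
    rcases le_total k n with hk | hk
    · exact key k hk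
    · rw [P.2.const k hk, P'.2.const k hk, key n le_rfl]
  · rintro ⟨⟨σ, τ, ρ⟩, h⟩
    simp only at h
    -- the partial products
    let P : ℕ → Perm (Fin d) := fun k => Nat.rec σ (fun k τ' =>
      (if hk : k < n then τ ⟨k, hk⟩ else 1) * τ') k
    have hsucc : ∀ k, P (k + 1) = (if hk : k < n then τ ⟨k, hk⟩ else 1) * P k := fun k => rfl
    have hconst : ∀ k, n ≤ k → P k = P n := by
      intro k hk
      induction k, hk using Nat.le_induction with
      | base => rfl
      | succ k hk ih => rw [hsucc, dif_neg (by omega), one_mul, ih]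
    have hτ : (fun i : Fin n => P (i + 1) * (P i)⁻¹) = τ := by
      funext i
      rw [hsucc, dif_pos i.2, mul_inv_cancel_right]
    have hρ : (P n)⁻¹ = ρ := by
      have h1 := h.prod_eq_one
      rw [← hτ, prod_reverse_ofFn] at h1
      have h2 : P 0 = σ := rfl
      rw [h2, mul_assoc, inv_mul_cancel_right] at h1
      exact (eq_inv_of_mul_eq_one_left h1).symm
    have hmon : IsMonodromy η ν (P 0) (fun i : Fin n => P (i + 1) * (P i)⁻¹) (P n)⁻¹ := by
      rw [hτ, hρ]
      exact h
    refine ⟨⟨P, (isMonodromy_iff η ν hconst).1 hmon⟩, Subtype.ext (Prod.ext rfl (Prod.ext hτ hρ))⟩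

theorem finite_isMonodromySeq (η ν : d.Partition) : Finite {P // IsMonodromySeq n η ν P} := by
  refine Finite.of_injective (fun P => fun k : Fin (n + 1) => P.1 k) fun P P' h => ?_
  refine Subtype.ext (funext fun k => ?_)
  rcases le_total k n with hk | hk
  · exact congrFun h ⟨k, by omega⟩
  · rw [P.2.const k hk, P'.2.const k hk]
    exact congrFun h (Fin.last n)

end Monodromy

/-! ### The fibre of the branch map -/

namespace ModuliSpace

variable {g : ℕ} {Δ : Multiset ℤ} {p : Fin (numLabels g Δ) → ℝ}

/-- A representative of a point of the moduli space. -/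
def curve (q : ModuliSpace g Δ) : TropCurve g Δ := Quotient.out (s := TropCurve.setoid g Δ) q.1

theorem isOver_curve {q : ModuliSpace g Δ} (hq : br g Δ q = p) : q.curve.IsOver p := by
  intro i
  rw [← hq, br, ← Quotient.out_eq (s := TropCurve.setoid g Δ) q.1]
  rfl

/-- Isomorphic curves over `p` are the same point. -/
theorem eq_of_iso {q q' : ModuliSpace g Δ} (h : q.curve.Iso q'.curve) : q = q' := by
  refine Subtype.ext ?_
  rw [← Quotient.out_eq (s := TropCurve.setoid g Δ) q.1,
    ← Quotient.out_eq (s := TropCurve.setoid g Δ) q'.1]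
  exact Quotient.sound (s := TropCurve.setoid g Δ) h

/-- Every curve over a point with distinct coordinates belongs to the moduli space. -/
theorem exists_iso {C : TropCurve g Δ} (h : C.IsOver p) (hp : Function.Injective p)
    (h0 : (0 : ℤ) ∉ Δ) : ∃ q : ModuliSpace g Δ, br g Δ q = p ∧ C.Iso q.curve := by
  have htop := h.isTop hp h0
  refine ⟨⟨Quotient.mk (TropCurve.setoid g Δ) C, C, rfl, fun _ => htop.2.1, fun hlt => ?_⟩,
    funext fun i => h i, ?_⟩
  · exact absurd htop.2.2 hlt.ne
  · exact (TropCurve.setoid g Δ).symm (Quotient.exact (Quotient.out_eq _))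

end ModuliSpace

section Fibre

variable {g : ℕ} {Δ : Multiset ℤ} {p : Fin (numLabels g Δ) → ℝ} {d : ℕ} {η ν : d.Partition}
  {C : TropCurve g Δ}

/-- The sequences of permutations with a coloring by the diagram of a curve are monodromy
representations. -/
theorem TropCurve.IsOver.isMonodromySeq (h : C.IsOver p) (hp : Function.Injective p)
    (h0 : (0 : ℤ) ∉ Δ) (h_neg : η.parts = (Δ.filter (fun z => z < 0)).map Int.natAbs)
    (h_pos : ν.parts = (Δ.filter (fun z => 0 < z)).map Int.natAbs) {P : ℕ → Perm (Fin d)}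
    {F : ℕ → Fin d → C.type.E ⊕ C.type.L} (hF : (C.diagram p).IsCover (numLabels g Δ) P F)
    (hP : ∀ k, numLabels g Δ ≤ k → P k = P (numLabels g Δ)) :
    IsMonodromySeq (numLabels g Δ) η ν P where
  isSwap k hk := (hF.step k hk).isSwap
  const := hP
  type_left := by
    rw [h_neg, ← C.map_w_left p]
    refine (hF.zero.partition _ fun s => ?_).symm
    have := (h.diagram_isTimed hp h0).lt s
    rw [Diagram.Alive]
    omega
  type_right := by
    rw [h_pos, ← h.map_w_right hp h0]
    refine ((hF.coloring _ le_rfl).partition _ fun s => ?_).symm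
    have := (h.diagram_isTimed hp h0).lt s
    have := (h.diagram_isTimed hp h0).le s
    rw [Diagram.Alive]
    omega
  transitive := hF.isTransitiveSeq (h.diagram_isTrivalent hp h0) (h.diagram_isConnected hp)

/-- Up to the automorphisms, the covers of the diagram of a curve are the monodromy representations
that belong to the curve. -/
theorem TropCurve.IsOver.card_monodromy (h : C.IsOver p) (hp : Function.Injective p)
    (h0 : (0 : ℤ) ∉ Δ) (h_neg : η.parts = (Δ.filter (fun z => z < 0)).map Int.natAbs)
    (h_pos : ν.parts = (Δ.filter (fun z => 0 < z)).map Int.natAbs) :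
    Nat.card {P : {P // IsMonodromySeq (numLabels g Δ) η ν P} //
      Nonempty ((C.diagram p).Marking (numLabels g Δ) P.1)} * Nat.card (C.diagram p).Aut =
        d.factorial * ∏ e, C.type.wt e := by
  classical
  have hD := h.diagram_isTrivalent hp h0
  have hsum : ∑ s with (C.diagram p).a s = 0, (C.diagram p).w s = d := by
    change (({s | (C.diagram p).a s = 0} : Finset _).val.map (C.diagram p).w).sum = d
    rw [C.map_w_left p, ← h_neg, η.parts_sum]
  have hprod : ∏ s with 0 < (C.diagram p).a s ∧ (C.diagram p).b s ≤ numLabels g Δ,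
      (C.diagram p).w s = ∏ e, C.type.wt e := by
    simp only [prod_filter, TropCurve.diagram_inl_iff h hp]
    rw [Fintype.prod_sum_type]
    simp [TropCurve.diagram]
  rw [← hprod, ← hD.card_cover hsum]
  have hmark : ∀ P : {P : {P // IsMonodromySeq (numLabels g Δ) η ν P} //
      Nonempty ((C.diagram p).Marking (numLabels g Δ) P.1)},
      Nat.card ((C.diagram p).Marking (numLabels g Δ) P.1.1) = Nat.card (C.diagram p).Aut :=
    fun P => Diagram.card_marking hD.toIsTimed P.2
  have hfin : ∀ P : {P : {P // IsMonodromySeq (numLabels g Δ) η ν P} //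
      Nonempty ((C.diagram p).Marking (numLabels g Δ) P.1)},
      Finite ((C.diagram p).Marking (numLabels g Δ) P.1.1) := fun P =>
    Nat.finite_of_card_ne_zero (by rw [hmark, h.card_aut hp h0]; positivity)
  rw [← card_sigma_of_card_eq hmark]
  refine Nat.card_congr ⟨fun x => ⟨fun k => (x.1.1.1 k, x.2.1 k), x.2.2.1, fun k hk => ?_⟩,
    fun y => ⟨⟨⟨fun k => (y.1 k).1, ?_⟩, ⟨fun k => (y.1 k).2, y.2.1, fun k hk => ?_⟩⟩,
      ⟨fun k => (y.1 k).2, y.2.1, fun k hk => ?_⟩⟩, fun x => rfl, fun y => rfl⟩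
  · simp only [x.1.1.2.const k hk, x.2.2.2 k hk]
  · exact h.isMonodromySeq hp h0 h_neg h_pos y.2.1 fun k hk => by simp only [y.2.2 k hk]
  · simp only [y.2.2 k hk]
  · simp only [y.2.2 k hk]

/-- Every monodromy representation belongs to exactly one point of the fibre. -/
theorem existsUnique_marking (hp : Function.Injective p) (h0 : (0 : ℤ) ∉ Δ)
    (hn : 2 < Multiset.card Δ + 2 * g)
    (h_neg : η.parts = (Δ.filter (fun z => z < 0)).map Int.natAbs)
    (h_pos : ν.parts = (Δ.filter (fun z => 0 < z)).map Int.natAbs) {P : ℕ → Perm (Fin d)}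
    (hP : IsMonodromySeq (numLabels g Δ) η ν P) :
    ∃! q : br g Δ ⁻¹' {p}, Nonempty ((q.1.curve.diagram p).Marking (numLabels g Δ) P) := by
  classical
  have hfin : Fintype (CanonicalStrand P (numLabels g Δ)) := Fintype.ofFinite _
  have hpos : 0 < numLabels g Δ := by rw [numLabels]; omega
  have hcov := canonicalDiagram_isCover hP.isSwap
  have htimed := canonicalDiagram_isTimed (P := P) (n := numLabels g Δ)
  have hD := hcov.isTrivalent htimed hpos hP.transitive
  obtain ⟨C, hC, φ, hφ⟩ := Diagram.exists_curve hD (hcov.isConnected htimed hP.transitive) h0 hn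
    (by
      rw [← h_neg, ← hP.type_left]
      refine hcov.zero.partition _ fun s => ?_
      have := htimed.lt s
      rw [Diagram.Alive]
      omega)
    (by
      rw [← h_pos, ← hP.type_right]
      refine (hcov.coloring _ le_rfl).partition _ fun s => ?_
      have := htimed.lt s
      have := htimed.le s
      rw [Diagram.Alive]
      omega) hp
  obtain ⟨q, hq, hiso⟩ := ModuliSpace.exists_iso hC hp h0
  obtain ⟨ψ, hψ⟩ := hC.exists_isIso hp h0 hiso
  have hcov' := hcov.of_isIso (hφ.trans hψ)
  refine ⟨⟨q, hq⟩, ⟨⟨fun k => φ.trans ψ ∘ canonicalMark P (numLabels g Δ) (min k (numLabels g Δ)),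
    ⟨?_, fun k hk => ?_⟩, fun k hk => ?_⟩⟩, ?_⟩
  · simpa using hcov'.zero
  · have := hcov'.step k hk
    simpa only [min_eq_left hk.le, min_eq_left (show k + 1 ≤ numLabels g Δ from hk)] using this
  · simp only [min_eq_right hk, min_self]
  · rintro ⟨q', hq'⟩ ⟨F, hF, -⟩
    have hover := ModuliSpace.isOver_curve hq
    have hover' := ModuliSpace.isOver_curve (show br g Δ q' = p from hq')
    obtain ⟨χ, hχ, -⟩ := hF.exists_isIso (hover'.diagram_isTimed hp h0) hcov'
      (hover.diagram_isTimed hp h0)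
    exact Subtype.ext (ModuliSpace.eq_of_iso (hover'.iso_of_isIso hover hp h0 hχ))

end Fibre

end TropicalHurwitz

end

open TropicalHurwitz

theorem theorem5p28 (g : ℕ) (Δ : Multiset ℤ) (h_nonzero : (0 : ℤ) ∉ Δ) (h_sum : Δ.sum = 0)
    (h_labels : 2 < Multiset.card Δ + 2 * g)
    (d : ℕ) (η ν : d.Partition)
    (h_neg : η.parts = (Δ.filter (fun z => z < 0)).map Int.natAbs)
    (h_pos : ν.parts = (Δ.filter (fun z => 0 < z)).map Int.natAbs)
    (p : Fin (TropicalHurwitz.numLabels g Δ) → ℝ) (hp : Function.Injective p) :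
    TropicalHurwitz.IsBrGeneral g Δ p ∧
      (TropicalHurwitz.br g Δ ⁻¹' {p}).Finite ∧
      TropicalHurwitz.degreeAt g Δ p = TropicalHurwitz.hurwitzNumber g d η ν := by
  have hover : ∀ q : br g Δ ⁻¹' {p}, q.1.curve.IsOver p := fun q => ModuliSpace.isOver_curve q.2
  have hmono : ∀ q : br g Δ ⁻¹' {p}, Nat.card {P : {P // IsMonodromySeq (numLabels g Δ) η ν P} //
      Nonempty ((q.1.curve.diagram p).Marking (numLabels g Δ) P.1)} *
        Nat.card (q.1.curve.diagram p).Aut = d.factorial * ∏ e, q.1.curve.type.wt e := fun q =>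
    (hover q).card_monodromy hp h_nonzero h_neg h_pos
  have haut : ∀ q : br g Δ ⁻¹' {p}, Nat.card (q.1.curve.diagram p).Aut ≠ 0 := fun q => by
    rw [(hover q).card_aut hp h_nonzero]
    positivity
  -- the monodromy representations are distributed among the points of the fibre
  have hunique : ∀ P : {P // IsMonodromySeq (numLabels g Δ) η ν P}, ∃! q : br g Δ ⁻¹' {p},
      Nonempty ((q.1.curve.diagram p).Marking (numLabels g Δ) P.1) := fun P =>
    existsUnique_marking hp h_nonzero h_labels h_neg h_pos P.2
  choose cl hcl hcl' using hunique
  have hiff : ∀ P q, cl P = q ↔ Nonempty ((q.1.curve.diagram p).Marking (numLabels g Δ) P.1) :=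
    fun P q => ⟨fun h => h ▸ hcl P, fun h => (hcl' P q h).symm⟩
  have hfinM : Finite {P // IsMonodromySeq (numLabels g Δ) η ν P} := finite_isMonodromySeq η ν
  have hsurj : Function.Surjective cl := by
    intro q
    have h1 := hmono q
    have h2 : d.factorial * ∏ e, q.1.curve.type.wt e ≠ 0 :=
      mul_ne_zero d.factorial_ne_zero
        (Finset.prod_ne_zero_iff.2 fun e _ => (hover q).wt_ne_zero hp h_nonzero e)
    rw [← h1] at h2
    obtain ⟨P⟩ := (Nat.card_ne_zero.1 (left_ne_zero_of_mul h2)).1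
    exact ⟨P.1, (hiff _ _).2 P.2⟩
  have hfinQ : Finite (br g Δ ⁻¹' {p}) := Finite.of_surjective cl hsurj
  have hfinQ' : Fintype (br g Δ ⁻¹' {p}) := Fintype.ofFinite _
  refine ⟨fun q hq => (ModuliSpace.isOver_curve hq).isTop hp h_nonzero, hfinQ, ?_⟩
  have hn : numSimple g η ν = numLabels g Δ := by
    have h1 : Multiset.card η.parts + Multiset.card ν.parts = Multiset.card Δ := by
      have h2 : Δ.filter (fun z => 0 < z) = Δ.filter (fun z => ¬ z < 0) := by
        refine Multiset.filter_congr fun z hz => ?_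
        have : z ≠ 0 := fun h => h_nonzero (h ▸ hz)
        omega
      rw [h_neg, h_pos, Multiset.card_map, Multiset.card_map, h2, ← Multiset.card_add,
        Multiset.filter_add_not]
    rw [numSimple, numLabels, h1]
  have hcount : Nat.card {P // IsMonodromySeq (numLabels g Δ) η ν P} = ∑ q : br g Δ ⁻¹' {p},
      Nat.card {P : {P // IsMonodromySeq (numLabels g Δ) η ν P} //
        Nonempty ((q.1.curve.diagram p).Marking (numLabels g Δ) P.1)} := by
    rw [Nat.card_congr (Equiv.sigmaFiberEquiv cl).symm, Nat.card_sigma]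
    exact Finset.sum_congr rfl fun q _ => Nat.card_congr (Equiv.subtypeEquivRight fun P => hiff P q)
  have hmult : ∀ q : br g Δ ⁻¹' {p}, (Nat.card {P : {P // IsMonodromySeq (numLabels g Δ) η ν P} //
      Nonempty ((q.1.curve.diagram p).Marking (numLabels g Δ) P.1)} : ℚ) =
        d.factorial * q.1.type.mult := by
    intro q
    have h1 : (q.1.type.mult : ℚ) * Nat.card (q.1.curve.diagram p).Aut =
        ∏ e, (q.1.curve.type.wt e : ℚ) := (hover q).mult_mul_card_aut hp h_nonzero
    have h2 := hmono q
    have h3 : (Nat.card (q.1.curve.diagram p).Aut : ℚ) ≠ 0 := by exact_mod_cast haut q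
    refine mul_right_cancel₀ h3 ?_
    rw [mul_assoc, h1]
    exact_mod_cast h2
  have hd : (d.factorial : ℚ) ≠ 0 := by exact_mod_cast d.factorial_ne_zero
  rw [degreeAt, ← finsum_set_coe_eq_finsum_mem, finsum_eq_sum_of_fintype, hurwitzNumber, hn,
    card_isMonodromy, hcount, eq_div_iff hd, Nat.cast_sum, Finset.sum_mul]
  exact Finset.sum_congr rfl fun q _ => by rw [hmult, mul_comm]
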